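/- Let $M$ be a smooth $m$-dimensional manifold, $X_1,X_2$ smooth vector fields on $M$, and $\gamma(t)=e^{tX_1}(x_0)$, $t\in I=[0,1]$, an integral curve of $X_1$ along which $X_1,X_2$ are linearly independent; put $\Delta=\mathrm{span}\{X_1,X_2\}$ with the metric making $X_1,X_2$ orthonormal. For $0\le t,s\le 1$ let $g^s_t=e^{(s-t)X_1}_*X_2$, and let $\dot g^s_t$ be its derivative in $t$. For controls $v=(v_1,v_2)\in L^2([0,s],\mathbb R^2)$ let $F_s(v)=x(s)$ be the endpoint map of $\dot x=(1+v_1)X_1(x)+v_2X_2(x)$, $x(0)=x_0$, with $$d_0F_s(v)=\int_0^s v_1\,dt\,X_1(\gamma(s))+\int_0^s v_2(t)\,g^s_t(\gamma(s))\,dt ,$$ let $J_s(v)=\frac12\int_0^s(1+v_1)^2+v_2^2\,dt$, so that $d_0J_s(v)=\int_0^s v_1\,dt$, and let $\mathcal F_s=(F_s,J_s)$. Assume that $\gamma$ is a regular singular curve: there is $0\neq\lambda_0\in T^*_{x_0}M$ such that, with $\lambda(t)=(e^{-tX_1})^*\lambda_0$, the covector $\lambda(1)$ annihilates the image of $d_0F_1$,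 and $\lambda(t)\in(\Delta^2_{\gamma(t)})^\perp\setminus(\Delta^3_{\gamma(t)})^\perp$ for all $t\in I$, where $\Delta^2=\Delta+[\Delta,\Delta]$ and $\Delta^3=\Delta^2+[\Delta,\Delta^2]$. **Conjugate points.** Let $s\in I$. On $L^2([0,s])\oplus\mathbb R\oplus L^2([0,s])\ni(v,c,w)$ (the completion of the controls under $v_1=v$, $w(t)=\int_0^tv_2$, $c=w(s)$) put $$\ker d_0\mathring F_s=\Big\{\int_0^s w(t)\,\dot g^s_t(\gamma(s))\,dt=\int_0^s v\,dt\,X_1(\gamma(s))+c\,X_2(\gamma(s))\Big\},\qquad \ker d_0\mathring{\mathcal F}_s=\ker d_0\mathring F_s\cap\Big\{\int_0^s v\,dt=0\Big\},$$ and consider on each of them the Hessian $$Q_s(v,c,w)=\int_0^s\langle\lambda(s),[\dot g^s_t,g^s_t](\gamma(s))\rangle\,w(t)^2\,dt+\int_0^s\Big\langle\lambda(s),\Big[cX_2+\int_0^t w(\tau)\dot g^s_\tau\,d\tau,\;w(t)\dot g^s_t\Big](\gamma(s))\Big\rangle\,dt .$$ The point $\gamma(s)$ is a *conjugate point along $\gamma$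 for $F_s$* (resp. for $\mathcal F_s$) if $\{(v,0,0)\mid\int_0^s v\,dt=0\}$ is a proper subspace of the kernel of the restriction of $Q_s$ to $\ker d_0\mathring F_s$ (resp. to $\ker d_0\mathring{\mathcal F}_s$). **Jacobi equation.** Let $\omega$ be the canonical symplectic form of $T^*M$. Regard $\lambda(s)$ as a vertical vector of $T_{\lambda(s)}(T^*M)$ and let $\Sigma=\lambda(s)^\angle/\mathbb R\lambda(s)$ be the reduced symplectic space ($^\angle$ is the skew-orthogonal complement), $\Pi=T^*_{\gamma(s)}M/\mathbb R\lambda(s)\subset\Sigma$ the Lagrangian subspace of vertical vectors. Let $\vec\xi_1,\vec\xi_2,\vec\eta^s_t\in\Sigma$ be the classes of the Hamiltonian lifts at $\lambda(s)$ of $\mu\mapsto\langle\mu,X_1\rangle,\ \langle\mu,X_2\rangle,\ \langle\mu,g^s_t\rangle$ (so $\vec\eta^s_s=\vec\xi_2$), a dot the derivative in $t$, and $l^0_{t,s}=\omega(\dot{\vec\eta}{}^s_t,\vec\eta^s_t)$. The Jacobi equation on $\Sigma$ is $$l^0_{t,s}\,\dot k(t)=\omega(\dot{\vec\eta}{}^s_t,k(t))\,\dot{\vec\eta}{}^s_t,\qquad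 t\in[0,s].$$ For $b\in\Sigma$ consider the boundary conditions $$(a)\quad k(0)\in\Pi\cap\mathrm{span}\{\vec\xi_1,b\}^\angle+\mathrm{span}\{\vec\xi_1,b\},\quad k(s)\in\Pi;\qquad (b)\quad k(0)\in\Pi\cap\mathrm{span}\{b\}^\angle+\mathrm{span}\{b\},\quad k(s)\in\Pi .$$ **Proposition.** Let $s\in I$. Let $b=\vec\eta^s_0$; or let $b=\vec\xi_2$, provided that $\Pi\cap\mathrm{span}\{\vec\xi_1,\vec\eta^s_t\mid t\in[0,s]\}=0$. 1. Suppose that $\gamma|_{[0,s]}$ has corank one (the image of $d_0F_s$ has codimension one) and is strictly singular ($\mu\circ d_0F_s+\mu_0\,d_0J_s=0$ implies $\mu_0=0$). Then $\gamma(s)$ is a conjugate point along $\gamma$ for $F_s$ (resp. for $\mathcal F_s$) if and only if the Jacobi equation has a solution $k\not\equiv0$ that satisfies (a) (resp. (b)). 2. Without the assumptions of 1, $\gamma(s)$ is a conjugate point along $\gamma$ for $F_s$ (resp. for $\mathcal F_s$) if and only if the Jacobi equation has a nonconstant solution that satisfies (a) (resp. (b)). -/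

import Mathlib

open Set MeasureTheory Bundle
open scoped Manifold ContDiff Topology

noncomputable section

namespace RankTwo

/-! ### Reduction of a symplectic space by a line -/

section Reduction

variable {V : Type*} [AddCommGroup V] [Module ℝ V]

/-- The reduced space `e^∠ / ℝ e`, where `e^∠ = {ν | B(e, ν) = 0}`. -/
abbrev Reduced (B : LinearMap.BilinForm ℝ V) (e : V) : Type _ :=
  (LinearMap.ker (B e)) ⧸ ((Submodule.span ℝ {e}).comap (LinearMap.ker (B e)).subtype)

variable (B : LinearMap.BilinForm ℝ V) (e : V)

/-- The class in `e^∠ / ℝ e` of a vector of `e^∠` (and `0` for a vector outside `e^∠`). -/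
def toReduced (ν : V) : Reduced B e :=
  open Classical in
  if h : ν ∈ LinearMap.ker (B e) then Submodule.Quotient.mk ⟨ν, h⟩ else 0

/-- The bilinear form induced by an alternating form `B` on `e^∠ / ℝ e`. -/
def reducedForm (hB : B.IsAlt) : LinearMap.BilinForm ℝ (Reduced B e) :=
  Submodule.liftQ _
    { toFun := fun a => Submodule.liftQ _
        ((B a.1).comp (LinearMap.ker (B e)).subtype) (by
          rintro ⟨x, hx⟩ h
          obtain ⟨c, rfl⟩ := Submodule.mem_span_singleton.1 (Submodule.mem_comap.1 h)
          have ha : B e a.1 = 0 := a.2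
          have h2 : B a.1 e = 0 := by rw [← hB.neg_eq, ha, neg_zero]
          simp [h2])
      map_add' := by
        intro a b
        refine Submodule.linearMap_qext _ ?_
        ext x
        simp
      map_smul' := by
        intro c a
        refine Submodule.linearMap_qext _ ?_
        ext x
        simp }
    (by
      rintro ⟨x, hx⟩ h
      obtain ⟨c, rfl⟩ := Submodule.mem_span_singleton.1 (Submodule.mem_comap.1 h)
      refine Submodule.linearMap_qext _ ?_
      ext y
      have hy : B e y.1 = 0 := y.2
      simp [hy])

theorem reducedForm_mk (hB : B.IsAlt) (a b : LinearMap.ker (B e)) :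
    reducedForm B e hB (Submodule.Quotient.mk a) (Submodule.Quotient.mk b) = B a.1 b.1 := rfl

end Reduction

/-! ### The cotangent bundle and its canonical symplectic form -/

/-- The model space `ℝ^m`. -/
abbrev Mod (m : ℕ) : Type := EuclideanSpace ℝ (Fin m)

/-- The model space of `T^*M`. By definition of `TangentSpace` it is also the tangent space
`T_μ(T^*M)` at every `μ`, read in the canonical coordinates `(q, p)` of `T^*M` that are induced by
the preferred chart of `M` at the base point of `μ`. -/
abbrev PhaseMod (m : ℕ) : Type := Mod m × (Mod m →L[ℝ] ℝ)

/-- The canonical symplectic form `ω = d σ = ∑ dp_i ∧ dq_i` on a tangent space of `T^*M`, in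
canonical coordinates. For a vertical vector `μ` it satisfies `ω(μ, ζ) = ⟨μ, dπ ζ⟩`. -/
def symp (m : ℕ) : LinearMap.BilinForm ℝ (PhaseMod m) :=
  LinearMap.mk₂ ℝ (fun u v => u.2 v.1 - v.2 u.1)
    (by intros; simp; ring) (by intros; simp; ring) (by intros; simp; ring)
    (by intros; simp; ring)

theorem symp_apply (m : ℕ) (u v : PhaseMod m) : symp m u v = u.2 v.1 - v.2 u.1 := rfl

theorem symp_isAlt (m : ℕ) : (symp m).IsAlt := fun u => by simp [symp_apply]

section Manifold

variable {m : ℕ} {M : Type*} [TopologicalSpace M] [ChartedSpace (EuclideanSpace ℝ (Fin m)) M]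
  [IsManifold (𝓡 m) ∞ M]

variable (m M) in
/-- Vector fields on `M`. -/
abbrev VField : Type _ := ∀ x : M, TangentSpace (𝓡 m) x

/-- Smoothness of a vector field. -/
def IsSmoothField (X : VField m M) : Prop :=
  ContMDiff (𝓡 m) (𝓡 m).tangent ∞ (fun x => (⟨x, X x⟩ : TangentBundle (𝓡 m) M))

variable (m M) in
/-- The cotangent bundle `T^*M`. -/
abbrev Cotangent : Type _ :=
  TotalSpace (Mod m →L[ℝ] ℝ) (fun x : M => TangentSpace (𝓡 m) x →L[ℝ] ℝ)

/-- The fibrewise linear Hamiltonian `μ ↦ ⟨μ, X(π μ)⟩` of a vector field. -/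
def linHam (X : VField m M) (μ : Cotangent m M) : ℝ := μ.2 (X μ.1)

/-- The Hamiltonian lift of a function `a` on `T^*M` at the point `μ`: the vector `a⃗` of
`T_μ(T^*M)` with `ω_μ(·, a⃗) = d_μ a(·)`. -/
def hamLift (a : Cotangent m M → ℝ) (μ : Cotangent m M) : PhaseMod m :=
  Classical.epsilon fun v : PhaseMod m => ∀ u : PhaseMod m,
    symp m u v = mfderiv ((𝓡 m).prod 𝓘(ℝ, Mod m →L[ℝ] ℝ)) 𝓘(ℝ, ℝ) a μ u

/-- The interval integral of a curve in a fixed tangent space `T_x M`. -/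
def tanIntegral (x : M) (f : ℝ → TangentSpace (𝓡 m) x) (a b : ℝ) : TangentSpace (𝓡 m) x :=
  intervalIntegral (E := Mod m) f a b volume

/-- `Φ` is a (smooth) local flow `(t, x) ↦ e^{tX}(x)` of the vector field `X`,
with open domain `D`. -/
structure IsLocalFlow (X : VField m M) (Φ : ℝ → M → M) (D : Set (ℝ × M)) : Prop where
  isOpen : IsOpen D
  smooth : ContMDiffOn (𝓘(ℝ, ℝ).prod (𝓡 m)) (𝓡 m) ∞ (fun p : ℝ × M => Φ p.1 p.2) D
  interval : ∀ t x, (t, x) ∈ D → ∀ τ ∈ uIcc 0 t, (τ, x) ∈ D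
  zero : ∀ x, (0, x) ∈ D → Φ 0 x = x
  deriv : ∀ t x, (t, x) ∈ D → HasMFDerivAt 𝓘(ℝ, ℝ) (𝓡 m) (fun τ => Φ τ x) t
    ((1 : ℝ →L[ℝ] ℝ).smulRight (X (Φ t x)))

variable (m M) in
/-- The data in play: a frame `X₁, X₂` of the distribution, the flow of `X₁`, the initial point,
and the initial value of a covector along the integral curve of `X₁`. -/
structure Data where
  X₁ : VField m M
  X₂ : VField m M
  flow : ℝ → M → M
  x₀ : M
  cov₀ : TangentSpace (𝓡 m) x₀ →L[ℝ] ℝ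

namespace Data

variable (S : Data m M)

/-- The reference curve `γ(t) = e^{tX₁}(x₀)`. -/
def γ (t : ℝ) : M := S.flow t S.x₀

/-- The curve of covectors `λ(t) = (e^{-tX₁})^* λ₀ ∈ T^*_{γ(t)}M`. -/
def lam (t : ℝ) : TangentSpace (𝓡 m) (S.γ t) →L[ℝ] ℝ :=
  S.cov₀.comp (mfderiv (𝓡 m) (𝓡 m) (S.flow t) S.x₀).inverse

/-- The point `λ(t)` of `T^*M`. -/
def lamPt (t : ℝ) : Cotangent m M := ⟨S.γ t, S.lam t⟩

/-- The vector field `g_t^s = e^{(s-t)X₁}_* X₂`, i.e. the pull-back of `X₂` by `e^{(t-s)X₁}`. -/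
def g (s t : ℝ) : VField m M := VectorField.mpullback (𝓡 m) (𝓡 m) (S.flow (t - s)) S.X₂

/-- The vector field `ġ_t^s`, the derivative of `g_t^s` in `t`. -/
def gDot (s t : ℝ) : VField m M := fun x => deriv (fun τ => S.g s τ x) t

/-- `Δ² = Δ + [Δ, Δ]` at the point `x`, where `Δ = span {X₁, X₂}`. -/
def Δ₂ (x : M) : Submodule ℝ (TangentSpace (𝓡 m) x) :=
  Submodule.span ℝ {S.X₁ x, S.X₂ x, VectorField.mlieBracket (𝓡 m) S.X₁ S.X₂ x}

/-- `Δ³ = Δ² + [Δ, Δ²]` at the point `x`. -/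
def Δ₃ (x : M) : Submodule ℝ (TangentSpace (𝓡 m) x) :=
  S.Δ₂ x ⊔ Submodule.span ℝ
    {VectorField.mlieBracket (𝓡 m) S.X₁ (VectorField.mlieBracket (𝓡 m) S.X₁ S.X₂) x,
     VectorField.mlieBracket (𝓡 m) S.X₂ (VectorField.mlieBracket (𝓡 m) S.X₁ S.X₂) x}

/-! #### First order: differentials of the endpoint map and of the energy -/

/-- The space `L²([0,s], ℝ)`. -/
abbrev L2 (s : ℝ) : Type := Lp ℝ 2 (volume.restrict (Ioc (0 : ℝ) s))

/-- The differential at `v = 0` of the endpoint map `F_s` of the control system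
`ẋ = (1 + v₁) X₁(x) + v₂ X₂(x)`, `x(0) = x₀`:
`d₀F_s(v) = ∫₀ˢ v₁(t) dt X₁(γ(s)) + ∫₀ˢ v₂(t) g_t^s(γ(s)) dt`. -/
def dF (s : ℝ) (v : L2 s × L2 s) : TangentSpace (𝓡 m) (S.γ s) :=
  (∫ t in (0 : ℝ)..s, v.1 t) • S.X₁ (S.γ s) +
    tanIntegral (S.γ s) (fun t => v.2 t • S.g s t (S.γ s)) 0 s

/-- The differential at `v = 0` of the energy `J_s(v) = ½ ∫₀ˢ (1 + v₁)² + v₂² dt`. -/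
def dJ (s : ℝ) (v : L2 s × L2 s) : ℝ := ∫ t in (0 : ℝ)..s, v.1 t

/-- `γ|_{[0,s]}` has corank one: the image of `d₀F_s` has codimension one in `T_{γ(s)}M`. -/
def CorankOne (s : ℝ) : Prop :=
  Module.finrank ℝ (TangentSpace (𝓡 m) (S.γ s) ⧸ Submodule.span ℝ (range (S.dF s))) = 1

/-- `γ|_{[0,s]}` is strictly singular: every Lagrange multiplier `(μ, μ₀)` of the extended
endpoint map `(F_s, J_s)` has `μ₀ = 0`. -/
def StrictlySingular (s : ℝ) : Prop :=
  ∀ (μ : TangentSpace (𝓡 m) (S.γ s) →L[ℝ] ℝ) (μ₀ : ℝ),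
    (∀ v : L2 s × L2 s, μ (S.dF s v) + μ₀ * dJ s v = 0) → μ₀ = 0

/-- `λ(·)` is an extremal lift of `γ|_{[0,1]}` with vanishing cost multiplier: it does not vanish
and `λ(1)` annihilates the image of `d₀F`. -/
def IsAbnormalLift : Prop := S.cov₀ ≠ 0 ∧ ∀ v : L2 1 × L2 1, S.lam 1 (S.dF 1 v) = 0

/-- `λ(t) ∈ (Δ²)^⊥ \ (Δ³)^⊥` for all `t ∈ [0,1]`. -/
def IsRegularLift : Prop := ∀ t ∈ Icc (0 : ℝ) 1,
  (∀ u ∈ S.Δ₂ (S.γ t), S.lam t u = 0) ∧ ¬ (∀ u ∈ S.Δ₃ (S.γ t), S.lam t u = 0)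

/-! #### Second order on the completed control space, and conjugate points -/

/-- The completed control space `L²([0,s]) ⊕ ℝ ⊕ L²([0,s])` with elements `(v, c, w)`. -/
abbrev Ctrl (s : ℝ) : Type := L2 s × ℝ × L2 s

/-- The differential at the origin of the endpoint map extended to the completed control space,
`(v, c, w) ↦ ∫₀ˢ v dt X₁(γ(s)) + c X₂(γ(s)) - ∫₀ˢ w(t) ġ_t^s(γ(s)) dt`. It extends `dF`
continuously along the substitution `v₁ = v`, `w(t) = ∫₀ᵗ v₂`, `c = w(s)`. -/
def dFext (s : ℝ) (x : Ctrl s) : TangentSpace (𝓡 m) (S.γ s) :=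
  (∫ t in (0 : ℝ)..s, x.1 t) • S.X₁ (S.γ s) + x.2.1 • S.X₂ (S.γ s) -
    tanIntegral (S.γ s) (fun t => x.2.2 t • S.gDot s t (S.γ s)) 0 s

/-- The kernel of the differential of the extended `F_s`. -/
def kerF (s : ℝ) : Set (Ctrl s) := {x | S.dFext s x = 0}

/-- The kernel of the differential of the extended `(F_s, J_s)`. -/
def kerFJ (s : ℝ) : Set (Ctrl s) := {x | S.dFext s x = 0 ∧ ∫ t in (0 : ℝ)..s, x.1 t = 0}

/-- The pairing `⟨λ(s), [X, Y](γ(s))⟩`. -/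
def brk (s : ℝ) (X Y : VField m M) : ℝ :=
  S.lam s (VectorField.mlieBracket (𝓡 m) X Y (S.γ s))

/-- The Hessian at the origin, along `λ(s)`, of the endpoint map on the completed control space:
`∫₀ˢ ⟨λ(s), [ġ_t, g_t]⟩ w(t)² dt + ∫₀ˢ ⟨λ(s), [c X₂ + ∫₀ᵗ w(τ) ġ_τ dτ, w(t) ġ_t]⟩ dt`,
the brackets being evaluated at `γ(s)`. -/
def hess (s : ℝ) (x : Ctrl s) : ℝ :=
  (∫ t in (0 : ℝ)..s, S.brk s (S.gDot s t) (S.g s t) * x.2.2 t ^ 2) +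
  ∫ t in (0 : ℝ)..s, (x.2.1 * S.brk s S.X₂ (S.gDot s t) +
    ∫ τ in (0 : ℝ)..t, x.2.2 τ * S.brk s (S.gDot s τ) (S.gDot s t)) * x.2.2 t

/-- The kernel of the restriction of the Hessian to a subspace `K`, that is, the set of the
elements of `K` which are orthogonal to `K` for the associated symmetric bilinear form. -/
def hessKer (s : ℝ) (K : Set (Ctrl s)) : Set (Ctrl s) :=
  {x | x ∈ K ∧ ∀ y ∈ K, QuadraticMap.polar (S.hess s) x y = 0}

/-- The trivial part `Z₁ = {(v, 0, 0) | ∫₀ˢ v dt = 0}` of the kernel of the Hessian. -/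
def Z₁ (s : ℝ) : Set (Ctrl s) := {x | x.2.1 = 0 ∧ x.2.2 = 0 ∧ ∫ t in (0 : ℝ)..s, x.1 t = 0}

/-- `γ(s)` is a conjugate point along `γ` for the endpoint map `F_s`:
`Z₁` is a proper subspace of the kernel of the Hessian. -/
def IsConjF (s : ℝ) : Prop := Z₁ s ⊂ S.hessKer s (S.kerF s)

/-- `γ(s)` is a conjugate point along `γ` for the extended endpoint map `(F_s, J_s)`. -/
def IsConjFJ (s : ℝ) : Prop := Z₁ s ⊂ S.hessKer s (S.kerFJ s)

/-! #### The Jacobi equation on the reduced symplectic space -/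

/-- `λ(s) ∈ T^*_{γ(s)}M` as a vertical vector of `T_{λ(s)}(T^*M)`, i.e. the Euler field. -/
def euler (s : ℝ) : PhaseMod m := (0, S.lam s)

/-- The reduced symplectic space `Σ = λ(s)^∠ / ℝ λ(s)`. -/
abbrev Sig (s : ℝ) : Type := Reduced (symp m) (S.euler s)

/-- The symplectic form of `Σ`. -/
def om (s : ℝ) : LinearMap.BilinForm ℝ (S.Sig s) :=
  reducedForm (symp m) (S.euler s) (symp_isAlt m)

/-- The Lagrangian subspace `Π = T^*_{γ(s)}M / ℝ λ(s)` of `Σ` (classes of vertical vectors). -/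
def Pi (s : ℝ) : Submodule ℝ (S.Sig s) :=
  ((LinearMap.range (LinearMap.inr ℝ (Mod m) (Mod m →L[ℝ] ℝ))).comap
    (LinearMap.ker (symp m (S.euler s))).subtype).map (Submodule.mkQ _)

/-- The class in `Σ` of the Hamiltonian lift at `λ(s)` of a vector field. -/
def liftSig (s : ℝ) (X : VField m M) : S.Sig s :=
  toReduced (symp m) (S.euler s) (hamLift (linHam X) (S.lamPt s))

/-- `ξ⃗₁`, the Hamiltonian lift of `X₁` at `λ(s)`. -/
def ξ₁ (s : ℝ) : S.Sig s := S.liftSig s S.X₁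

/-- `ξ⃗₂`, the Hamiltonian lift of `X₂` at `λ(s)`. -/
def ξ₂ (s : ℝ) : S.Sig s := S.liftSig s S.X₂

/-- `η⃗_t^s`, the Hamiltonian lift of `g_t^s` at `λ(s)`. -/
def η (s t : ℝ) : S.Sig s := S.liftSig s (S.g s t)

/-- The derivative of `η⃗_t^s` in `t`. -/
def ηDot (s t : ℝ) : S.Sig s :=
  toReduced (symp m) (S.euler s) (deriv (fun τ => hamLift (linHam (S.g s τ)) (S.lamPt s)) t)

/-- `l⁰_{t,s} = ω_{λ(s)}(η̇_t^s, η_t^s)`. -/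
def l (s t : ℝ) : ℝ := S.om s (S.ηDot s t) (S.η s t)

/-- `k` solves the Jacobi equation `l⁰_{t,s} k̇(t) = ω(η̇_t^s, k(t)) η̇_t^s` on `[0,s]`. -/
def IsJacobi (s : ℝ) (k : ℝ → S.Sig s) : Prop :=
  ∀ t ∈ Icc (0 : ℝ) s, ∃ k' : S.Sig s, HasDerivWithinAt k k' (Icc 0 s) t ∧
    S.l s t • k' = S.om s (S.ηDot s t) (k t) • S.ηDot s t

/-- The subspace `Π ∩ Γ^∠ + Γ` of `Σ`, with `^∠` the skew-orthogonal complement. -/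
def bdry (s : ℝ) (Γ : Submodule ℝ (S.Sig s)) : Submodule ℝ (S.Sig s) :=
  S.Pi s ⊓ (S.om s).orthogonal Γ ⊔ Γ

/-- `k` solves the Jacobi equation with boundary conditions
`k(0) ∈ Π ∩ Γ^∠ + Γ` and `k(s) ∈ Π`. -/
def IsJacobiBVP (s : ℝ) (Γ : Submodule ℝ (S.Sig s)) (k : ℝ → S.Sig s) : Prop :=
  S.IsJacobi s k ∧ k 0 ∈ S.bdry s Γ ∧ k s ∈ S.Pi s

/-- The span `Z` in `Σ` of `ξ⃗₁` and of all `η⃗_t^s`, `t ∈ [0,s]`. -/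
def Zspan (s : ℝ) : Submodule ℝ (S.Sig s) :=
  Submodule.span ℝ (insert (S.ξ₁ s) (S.η s '' Icc 0 s))

end Data

end Manifold

end RankTwo

end

/-! The reduced space `Σ` turns the analysis into linear algebra. For Hamiltonian lifts, `ω(X⃗, Y⃗)
= ⟨λ, [X, Y]⟩` (`symp_hamLift`), and a vertical vector pairs with a vector of `Σ` through the base
projection of the latter (`om_vertical`). With `W(t) = ∫₀ᵗ w η'`, the differential of the endpoint
map is therefore the base projection of `(∫ v) ξ₁ + c η(s) - W(s)` (called `endL`), and the Hessian
is built from `ω(η', η)`, `ω(η(s), η')` and `ω(η'(τ), η'(t))`. Two facts about the curve enter.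
Since `X₁` is invariant under its own flow, `ω(ξ₁, η(t)) = 0`. Since `⟨λ, [X₁, X₂]⟩` vanishes along
`γ`, so does its derivative `⟨λ, [X₁, [X₁, X₂]]⟩`; regularity then forces `⟨λ, [X₂, [X₁, X₂]]⟩ ≠ 0`,
that is `l ≠ 0`. The structure `JacobiFrame` records exactly what is used afterwards.

Lagrange multipliers (`mem_hessKer_iff`): a functional on controls that vanishes on the kernel of
the differential factors through the differential. Hence `(v, c, w)` is in the kernel of the Hessian
iff there is a vertical `κ` with `l w = ω(η', κ + W)` almost everywhere, `ω(κ - endL, η(s)) = 0`,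
and `ω(κ, ξ₁) = 0` in case the mean `a` of `v` is free. The first relation says that `κ + W` solves
the Jacobi equation.

Boundary conditions (`Gauge`): put `k = κ + W - a ξ₁ - c β` with a solution `β` of the Jacobi
equation such that `β(0)` and `β(s)` are `b` and `η(s)` up to the same vertical vector `ρ`. Then
`k(s)` is vertical because `endL` is, and `k(0)` is vertical plus a combination of `ξ₁` and `b`. For
`b = η(0)` take `β = η`; the function `ω(κ + W(t), η(t))` is constant, which carries the condition
at `s` to `ω(κ, b) = 0`. For `b = ξ₂ = η(s)` with `Π ∩ Z = 0`, where `Z` is the span of `ξ₁` and the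
`η(t)`, the base projection is injective on `Z`, so some vertical `ρ` has the same products with `Z`
as `η(s)`; then `β = η(s) - ρ` is a constant solution, and `endL`, vertical and in `Z`, vanishes.

The control is trivial exactly if `k` is constant, which gives the second statement. For the first,
a constant solution that meets the boundary conditions is a vertical `μ` skew-orthogonal to all
`η(t)` (`eq_zero_of_constant`). Strict singularity makes `μ` annihilate `X₁` as well, hence the
image of `d₀F`; corank one makes `μ` a multiple of `λ(s)`, which is zero in `Σ`. -/

noncomputable section

namespace RankTwo

/-! ### Hamiltonian lifts and Lie brackets in the preferred chart. -/

section Coordinates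

variable {m : ℕ} {M : Type*} [TopologicalSpace M] [ChartedSpace (EuclideanSpace ℝ (Fin m)) M]
  [IsManifold (𝓡 m) ∞ M]

instance isManifold_one : IsManifold (𝓡 m) 1 M := IsManifold.of_le (n := ∞) (by simp)
instance isManifold_two : IsManifold (𝓡 m) 2 M :=
  IsManifold.of_le (n := ∞) (WithTop.coe_le_coe.2 le_top)
instance isManifold_three : IsManifold (𝓡 m) 3 M :=
  IsManifold.of_le (n := ∞) (WithTop.coe_le_coe.2 le_top)

/-- The tangent coordinates at `x` with respect to the preferred chart at `q`. -/
def tcoord (q x : M) : Mod m →L[ℝ] Mod m :=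
  (trivializationAt (Mod m) (TangentSpace (𝓡 m)) q).continuousLinearMapAt ℝ x

/-- The inverse of `tcoord`. -/
def tcoordSymm (q x : M) : Mod m →L[ℝ] Mod m :=
  (trivializationAt (Mod m) (TangentSpace (𝓡 m)) q).symmL ℝ x

theorem tcoord_symm {q x : M} (hx : x ∈ (extChartAt (𝓡 m) q).source) (v : Mod m) :
    tcoord q x (tcoordSymm q x v) = v :=
  (trivializationAt (Mod m) (TangentSpace (𝓡 m)) q).continuousLinearMapAt_symmL
    (R := ℝ) (by simpa using hx) v

theorem tcoordSymm_tcoord {q x : M} (hx : x ∈ (extChartAt (𝓡 m) q).source) (v : Mod m) :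
    tcoordSymm q x (tcoord q x v) = v :=
  (trivializationAt (Mod m) (TangentSpace (𝓡 m)) q).symmL_continuousLinearMapAt
    (R := ℝ) (by simpa using hx) v

theorem tcoord_eq_mfderiv {q x : M} (hx : x ∈ (extChartAt (𝓡 m) q).source) :
    tcoord q x = mfderiv (𝓡 m) 𝓘(ℝ, Mod m) (extChartAt (𝓡 m) q) x :=
  TangentBundle.continuousLinearMapAt_trivializationAt (by simpa using hx)

theorem tcoordSymm_eq_mfderiv {q : M} {y : Mod m} (hy : y ∈ (extChartAt (𝓡 m) q).target) :
    tcoordSymm q ((extChartAt (𝓡 m) q).symm y) =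
      mfderiv 𝓘(ℝ, Mod m) (𝓡 m) (extChartAt (𝓡 m) q).symm y := by
  have h := TangentBundle.symmL_trivializationAt (I := 𝓡 m) (x₀ := q)
    (x := (extChartAt (𝓡 m) q).symm y) (by simpa using (extChartAt (𝓡 m) q).map_target hy)
  rw [(extChartAt (𝓡 m) q).right_inv hy] at h
  rw [show range (𝓡 m) = univ by simp, mfderivWithin_univ] at h
  exact h

theorem tcoord_self (q : M) : tcoord (m := m) q q = ContinuousLinearMap.id ℝ _ := by
  rw [tcoord_eq_mfderiv (mem_extChartAt_source q)]
  exact mfderiv_extChartAt_self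

/-- The coordinate representation of a vector field in the preferred chart at `q`. -/
def hat (q : M) (X : VField m M) (y : Mod m) : Mod m :=
  tcoord q ((extChartAt (𝓡 m) q).symm y) (X ((extChartAt (𝓡 m) q).symm y))

theorem hat_self (q : M) (X : VField m M) : hat q X (extChartAt (𝓡 m) q q) = X q := by
  unfold hat
  rw [extChartAt_to_inv, tcoord_self]
  rfl

theorem hat_contDiffAt {q : M} {X : VField m M} {y : Mod m} {n : ℕ∞}
    (hy : y ∈ (extChartAt (𝓡 m) q).target)
    (hX : ContMDiffAt (𝓡 m) (𝓡 m).tangent n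
      (fun x => (⟨x, X x⟩ : TangentBundle (𝓡 m) M)) ((extChartAt (𝓡 m) q).symm y)) :
    ContDiffAt ℝ n (hat q X) y := by
  have hx := (extChartAt (𝓡 m) q).map_target hy
  have : IsManifold (𝓡 m) (n + 1) M := IsManifold.of_le (n := ∞) (by
    rw [show ((n : WithTop ℕ∞) + 1) = ((n + 1 : ℕ∞) : WithTop ℕ∞) by simp]
    exact_mod_cast le_top)
  have : ContMDiffVectorBundle n (Mod m) (TangentSpace (𝓡 m) : M → Type _) (𝓡 m) :=
    TangentBundle.contMDiffVectorBundle
  have h1 := ((trivializationAt (Mod m) (TangentSpace (𝓡 m)) q).contMDiffAt_section_iff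
    (IB := 𝓡 m) (n := n) (by simpa using hx)).1 hX
  have h2 : ContMDiffAt 𝓘(ℝ, Mod m) (𝓡 m) n (extChartAt (𝓡 m) q).symm y := by
    have := (contMDiffOn_extChartAt_symm (I := 𝓡 m) (n := n) q) y hy
    exact this.contMDiffAt ((isOpen_extChartAt_target q).mem_nhds hy)
  have h3 := (h1.comp y h2).contDiffAt
  refine h3.congr_of_eventuallyEq ?_
  filter_upwards [(isOpen_extChartAt_target q).mem_nhds hy] with z hz
  have hz' := (extChartAt (𝓡 m) q).map_target hz
  exact congrFun ((trivializationAt (Mod m) (TangentSpace (𝓡 m)) q).coe_linearMapAt_of_mem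
    (R := ℝ) (b := (extChartAt (𝓡 m) q).symm z) (by simpa using hz')) _

/-- The bracket is defined through pull-backs by the inverse chart, and these agree with `hat` near
the centre. The chart has identity differential at its own centre, so the outer conjugation
disappears. -/
theorem mlieBracket_eq_hat (q : M) (X Y : VField m M) :
    VectorField.mlieBracket (𝓡 m) X Y q =
      (fderiv ℝ (hat q Y) (extChartAt (𝓡 m) q q) (hat q X (extChartAt (𝓡 m) q q)) -
        fderiv ℝ (hat q X) (extChartAt (𝓡 m) q q) (hat q Y (extChartAt (𝓡 m) q q)) : Mod m) := by
  have key : ∀ Z : VField m M,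
      VectorField.mpullbackWithin 𝓘(ℝ, Mod m) (𝓡 m) (extChartAt (𝓡 m) q).symm Z (range (𝓡 m))
        =ᶠ[𝓝 (extChartAt (𝓡 m) q q)] hat q Z := by
    intro Z
    filter_upwards [extChartAt_target_mem_nhds (I := 𝓡 m) q] with y hy
    have h := isInvertible_mfderivWithin_extChartAt_symm (I := 𝓡 m) hy
    have h2 := mfderiv_extChartAt_comp_mfderivWithin_extChartAt_symm (I := 𝓡 m) hy
    have h3 := mfderivWithin_extChartAt_symm_comp_mfderiv_extChartAt (I := 𝓡 m) hy
    rw [VectorField.mpullbackWithin_apply, ContinuousLinearMap.inverse_eq h3 h2]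
    unfold hat
    rw [tcoord_eq_mfderiv ((extChartAt (𝓡 m) q).map_target hy)]
    rfl
  rw [← VectorField.mlieBracketWithin_univ, VectorField.mlieBracketWithin_apply]
  have h0 : (mfderiv (𝓡 m) 𝓘(ℝ, Mod m) (extChartAt (𝓡 m) q) q).inverse
      = ContinuousLinearMap.id ℝ (Mod m) := by
    rw [mfderiv_extChartAt_self]
    exact ContinuousLinearMap.inverse_id
  have h1 : ((extChartAt (𝓡 m) q).symm ⁻¹' univ ∩ range (𝓡 m)) = univ := by simp
  rw [h1]
  have h4 := (key X).lieBracketWithin_vectorField_eq_nhds (𝕜 := ℝ) (s := univ) (key Y)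
  refine (DFunLike.congr_fun h0 _).trans ?_
  refine h4.trans ?_
  rw [VectorField.lieBracketWithin_univ]
  rfl

theorem inCoordinates_apply_cotangent (q x : M) (p : TangentSpace (𝓡 m) x →L[ℝ] ℝ) (w : Mod m) :
    (ContinuousLinearMap.inCoordinates (Mod m) (TangentSpace (𝓡 m)) ℝ
      (Trivial M ℝ) q x q x p : Mod m →L[ℝ] ℝ) w = p (tcoordSymm q x w) :=
  DFunLike.congr_fun (Bundle.Trivial.continuousLinearMapAt_trivialization ℝ M ℝ x) _

theorem linHam_eq_extChartAt (X : VField m M) (μ ν : Cotangent m M)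
    (hν : ν.1 ∈ (extChartAt (𝓡 m) μ.1).source) :
    linHam X ν = (extChartAt ((𝓡 m).prod 𝓘(ℝ, Mod m →L[ℝ] ℝ)) μ ν).2
      (hat μ.1 X (extChartAt ((𝓡 m).prod 𝓘(ℝ, Mod m →L[ℝ] ℝ)) μ ν).1) := by
  rw [FiberBundle.extChartAt]
  have h1 : (ContinuousLinearMap.inCoordinates (Mod m) (TangentSpace (𝓡 m)) ℝ
      (Trivial M ℝ) μ.1 ν.1 μ.1 ν.1 ν.2 : Mod m →L[ℝ] ℝ) (tcoord μ.1 ν.1 (X ν.1)) =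
      linHam X ν :=
    (inCoordinates_apply_cotangent _ _ _ _).trans
      (congrArg (fun w => ν.2 w) (tcoordSymm_tcoord hν (X ν.1)))
  rw [← h1]
  show _ = (ContinuousLinearMap.inCoordinates (Mod m) (TangentSpace (𝓡 m)) ℝ
      (Trivial M ℝ) μ.1 ν.1 μ.1 ν.1 ν.2 : Mod m →L[ℝ] ℝ)
        (hat μ.1 X (extChartAt (𝓡 m) μ.1 ν.1))
  unfold hat
  rw [(extChartAt (𝓡 m) μ.1).left_inv hν]

theorem extChartAt_cotangent_self (q : M) (p : Mod m →L[ℝ] ℝ) :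
    extChartAt ((𝓡 m).prod 𝓘(ℝ, Mod m →L[ℝ] ℝ)) (⟨q, p⟩ : Cotangent m M) ⟨q, p⟩ =
      (extChartAt (𝓡 m) q q, p) := by
  rw [FiberBundle.extChartAt]
  refine Prod.ext rfl ?_
  show (ContinuousLinearMap.inCoordinates (Mod m) (TangentSpace (𝓡 m)) ℝ
      (Trivial M ℝ) q q q q p : Mod m →L[ℝ] ℝ) = p
  ext w
  have := tcoordSymm_tcoord (mem_extChartAt_source (I := 𝓡 m) q) w
  rw [tcoord_self] at this
  exact (inCoordinates_apply_cotangent q q p w).trans (congrArg p this)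

/-- A manifold derivative is read in the preferred chart of `T^*M`, which is the bundle chart over
the chart at `q`. There `linHam X` becomes the function `z ↦ z.2 (hat q X z.1)` of a vector space.
-/
theorem hasMFDerivAt_linHam {X : VField m M} {q : M} {p : Mod m →L[ℝ] ℝ}
    {f : PhaseMod m →L[ℝ] ℝ}
    (hf : HasFDerivAt (fun z : PhaseMod m => z.2 (hat q X z.1)) f (extChartAt (𝓡 m) q q, p)) :
    HasMFDerivAt ((𝓡 m).prod 𝓘(ℝ, Mod m →L[ℝ] ℝ)) 𝓘(ℝ, ℝ) (linHam X)
      (⟨q, p⟩ : Cotangent m M) f := by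
  set C := extChartAt ((𝓡 m).prod 𝓘(ℝ, Mod m →L[ℝ] ℝ)) (⟨q, p⟩ : Cotangent m M) with hCdef
  have hC : C ⟨q, p⟩ = (extChartAt (𝓡 m) q q, p) := extChartAt_cotangent_self q p
  have hsrc : ∀ ν ∈ C.source, ν.1 ∈ (extChartAt (𝓡 m) q).source := by
    intro ν hν
    rw [hCdef, FiberBundle.extChartAt] at hν
    simp only [mfld_simps] at hν
    simpa using hν.1
  have heq : linHam X =ᶠ[𝓝 (⟨q, p⟩ : Cotangent m M)]
      (fun z : PhaseMod m => z.2 (hat q X z.1)) ∘ C := by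
    filter_upwards [extChartAt_source_mem_nhds
      (I := (𝓡 m).prod 𝓘(ℝ, Mod m →L[ℝ] ℝ)) (⟨q, p⟩ : Cotangent m M)] with ν hν
    exact linHam_eq_extChartAt X ⟨q, p⟩ ν (hsrc ν hν)
  refine ⟨?_, ?_⟩
  · refine ContinuousAt.congr ?_ heq.symm
    refine ContinuousAt.comp ?_ (continuousAt_extChartAt _)
    exact hC.symm ▸ hf.continuousAt
  · rw [← hCdef, hC]
    refine HasFDerivAt.hasFDerivWithinAt ?_
    refine hf.congr_of_eventuallyEq ?_
    have ht := extChartAt_target_mem_nhds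
      (I := (𝓡 m).prod 𝓘(ℝ, Mod m →L[ℝ] ℝ)) (⟨q, p⟩ : Cotangent m M)
    rw [← hCdef, hC] at ht
    filter_upwards [ht] with z hz
    show linHam X (C.symm z) = _
    rw [linHam_eq_extChartAt X ⟨q, p⟩ _ (hsrc _ (C.map_target hz))]
    rw [← hCdef, C.right_inv hz]

/-- The canonical form is nondegenerate, so the vector chosen in `hamLift` is unique: vertical test
vectors determine its first component, horizontal ones its second. -/
theorem hamLift_eq_of_hasMFDerivAt {a : Cotangent m M → ℝ} {μ : Cotangent m M}
    {f : PhaseMod m →L[ℝ] ℝ}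
    (hf : HasMFDerivAt ((𝓡 m).prod 𝓘(ℝ, Mod m →L[ℝ] ℝ)) 𝓘(ℝ, ℝ) a μ f) (v : PhaseMod m)
    (hv : ∀ u, symp m u v = f u) : hamLift a μ = v := by
  have h0 : ∀ u : PhaseMod m,
      mfderiv ((𝓡 m).prod 𝓘(ℝ, Mod m →L[ℝ] ℝ)) 𝓘(ℝ, ℝ) a μ u = f u := fun u =>
    DFunLike.congr_fun hf.mfderiv u
  have h1 : ∀ u : PhaseMod m,
      symp m u (hamLift a μ) = mfderiv ((𝓡 m).prod 𝓘(ℝ, Mod m →L[ℝ] ℝ)) 𝓘(ℝ, ℝ) a μ u :=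
    Classical.epsilon_spec (p := fun v : PhaseMod m => ∀ u : PhaseMod m,
      symp m u v = mfderiv ((𝓡 m).prod 𝓘(ℝ, Mod m →L[ℝ] ℝ)) 𝓘(ℝ, ℝ) a μ u)
      ⟨v, fun u => (hv u).trans (h0 u).symm⟩
  have h2 : ∀ u : PhaseMod m, symp m u (hamLift a μ - v) = 0 := fun u => by
    rw [map_sub, sub_eq_zero]
    exact (h1 u).trans ((h0 u).trans (hv u).symm)
  refine sub_eq_zero.1 (Prod.ext ?_ ?_)
  · refine SeparatingDual.eq_zero_of_forall_dual_eq_zero (R := ℝ) fun p => ?_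
    simpa [symp_apply] using h2 (0, p)
  · ext w
    have := h2 (w, 0)
    simp only [symp_apply, zero_apply, zero_sub, neg_eq_zero] at this
    exact this

theorem hamLift_linHam {X : VField m M} {q : M} (p : Mod m →L[ℝ] ℝ)
    (hX : DifferentiableAt ℝ (hat q X) (extChartAt (𝓡 m) q q)) :
    hamLift (linHam X) (⟨q, p⟩ : Cotangent m M) =
      (hat q X (extChartAt (𝓡 m) q q),
        -(p ∘L fderiv ℝ (hat q X) (extChartAt (𝓡 m) q q))) := by
  have h2 : HasFDerivAt (fun z : PhaseMod m => hat q X z.1)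
      ((fderiv ℝ (hat q X) (extChartAt (𝓡 m) q q)) ∘L
        ContinuousLinearMap.fst ℝ (Mod m) (Mod m →L[ℝ] ℝ)) (extChartAt (𝓡 m) q q, p) :=
    HasFDerivAt.comp (g := hat q X) (extChartAt (𝓡 m) q q, p) hX.hasFDerivAt hasFDerivAt_fst
  have hd := (hasFDerivAt_snd (𝕜 := ℝ) (p := (extChartAt (𝓡 m) q q, p))).clm_apply h2
  refine hamLift_eq_of_hasMFDerivAt (hasMFDerivAt_linHam hd) _ fun u => ?_
  simp [symp_apply]
  ring

/-- This identity translates all brackets of the Hessian into symplectic products. Differentiability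
at the one point suffices, which matters because `g` and `gDot` are only known to be regular near
`γ(s)`. -/
theorem symp_hamLift {X Y : VField m M} {q : M} (p : Mod m →L[ℝ] ℝ)
    (hX : DifferentiableAt ℝ (hat q X) (extChartAt (𝓡 m) q q))
    (hY : DifferentiableAt ℝ (hat q Y) (extChartAt (𝓡 m) q q)) :
    symp m (hamLift (linHam X) (⟨q, p⟩ : Cotangent m M))
      (hamLift (linHam Y) (⟨q, p⟩ : Cotangent m M)) =
      p (VectorField.mlieBracket (𝓡 m) X Y q) := by
  rw [hamLift_linHam p hX, hamLift_linHam p hY, mlieBracket_eq_hat, symp_apply, map_sub]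
  show -(p ∘L fderiv ℝ (hat q X) (extChartAt (𝓡 m) q q)) _ -
    -(p ∘L fderiv ℝ (hat q Y) (extChartAt (𝓡 m) q q)) _ = _
  simp
  ring

end Coordinates

/-! ### Pull-back of a vector field by a flow in a vector space. -/

section EuclideanFlow

variable {E : Type*} [NormedAddCommGroup E] [NormedSpace ℝ E]

theorem fderiv_slice {F : ℝ × E → E} {p : ℝ × E} (hF : DifferentiableAt ℝ F p) :
    fderiv ℝ (fun z => F (p.1, z)) p.2 =
      (fderiv ℝ F p) ∘L ContinuousLinearMap.inr ℝ ℝ E := by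
  have h1 : HasFDerivAt (fun z : E => (p.1, z)) (ContinuousLinearMap.inr ℝ ℝ E) p.2 := by
    have := (hasFDerivAt_const (𝕜 := ℝ) p.1 p.2).prodMk (hasFDerivAt_id p.2)
    exact this
  exact (HasFDerivAt.comp (g := F) p.2 hF.hasFDerivAt h1).fderiv

theorem hasDerivAt_slice {G : Type*} [NormedAddCommGroup G] [NormedSpace ℝ G]
    {F : ℝ × E → G} {p : ℝ × E} (hF : DifferentiableAt ℝ F p) :
    HasDerivAt (fun t => F (t, p.2)) (fderiv ℝ F p (1, 0)) p.1 := by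
  have h1 : HasDerivAt (fun t : ℝ => (t, p.2)) ((1 : ℝ), (0 : E)) p.1 :=
    (hasDerivAt_id p.1).prodMk (hasDerivAt_const p.1 p.2)
  exact HasFDerivAt.comp_hasDerivAt (l := F) p.1 hF.hasFDerivAt h1

theorem contDiffAt_sliceDeriv {F : ℝ × E → E} {p : ℝ × E} (hF : ContDiffAt ℝ ∞ F p) :
    ContDiffAt ℝ ∞ (fun p : ℝ × E => fderiv ℝ (fun z => F (p.1, z)) p.2) p := by
  have h1 : ContDiffAt ℝ ∞ (fun p => (fderiv ℝ F p) ∘L ContinuousLinearMap.inr ℝ ℝ E) p :=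
    (hF.fderiv_right (m := ∞) (by simp)).clm_comp contDiffAt_const
  refine h1.congr_of_eventuallyEq ?_
  filter_upwards [(hF.of_le (m := 1) (by simp)).eventually (by simp)] with p' hp'
  exact fderiv_slice (hp'.differentiableAt (by simp))

theorem contDiffAt_pullback [CompleteSpace E] {F : ℝ × E → E} {Y : E → E} {p : ℝ × E}
    (hF : ContDiffAt ℝ ∞ F p) (hY : ContDiffAt ℝ ∞ Y (F p))
    (hA : (fderiv ℝ (fun z => F (p.1, z)) p.2).IsInvertible) :
    ContDiffAt ℝ ∞ (fun p : ℝ × E => (fderiv ℝ (fun z => F (p.1, z)) p.2).inverse (Y (F p))) p := by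
  obtain ⟨e, he⟩ := hA
  have h1 : ContDiffAt ℝ ∞ (ContinuousLinearMap.inverse : (E →L[ℝ] E) → (E →L[ℝ] E))
      (fderiv ℝ (fun z => F (p.1, z)) p.2) := he ▸ contDiffAt_map_inverse e
  exact (ContDiffAt.comp p h1 (contDiffAt_sliceDeriv hF)).clm_apply (hY.comp p hF)

/-- The derivative in time of the pull-back of a vector field by a flow. -/
theorem hasDerivAt_pullback [CompleteSpace E] {F : ℝ × E → E} {X Y : E → E} {p : ℝ × E}
    (hF : ContDiffAt ℝ ∞ F p) (hX : ContDiffAt ℝ ∞ X (F p)) (hY : ContDiffAt ℝ ∞ Y (F p))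
    (hA : (fderiv ℝ (fun z => F (p.1, z)) p.2).IsInvertible)
    (hflow : ∀ᶠ p' in 𝓝 p, HasDerivAt (fun τ => F (τ, p'.2)) (X (F p')) p'.1) :
    HasDerivAt (fun t => (fderiv ℝ (fun z => F (t, z)) p.2).inverse (Y (F (t, p.2))))
      ((fderiv ℝ (fun z => F (p.1, z)) p.2).inverse
        (fderiv ℝ Y (F p) (X (F p)) - fderiv ℝ X (F p) (Y (F p)))) p.1 := by
  set A : ℝ × E → E →L[ℝ] E := fun p => fderiv ℝ (fun z => F (p.1, z)) p.2 with hAdef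
  set G : ℝ × E → E := fun p => (A p).inverse (Y (F p)) with hGdef
  have hG : ContDiffAt ℝ ∞ G p := contDiffAt_pullback hF hY hA
  have hAs : ContDiffAt ℝ ∞ A p := contDiffAt_sliceDeriv hF
  have hAd := hAs.differentiableAt (by simp)
  have hGd := hG.differentiableAt (by simp)
  have hFd := hF.differentiableAt (by simp)
  have hXd := hX.differentiableAt (by simp)
  have hYd := hY.differentiableAt (by simp)
  have hF1 : ∀ᶠ p' in 𝓝 p, ContDiffAt ℝ 1 F p' :=
    (hF.of_le (m := 1) (by simp)).eventually (by simp)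
  have hdF : ∀ᶠ p' in 𝓝 p, fderiv ℝ F p' (1, 0) = X (F p') := by
    filter_upwards [hflow, hF1] with p' h1 h2
    exact (hasDerivAt_slice (h2.differentiableAt (by simp))).unique h1
  -- The linearized flow equation `∂ₜ A = DX ∘ A`, from the symmetry of the second derivative of
  -- `F`.
  have hAt : ∀ v, fderiv ℝ A p (1, 0) v = fderiv ℝ X (F p) (A p v) := by
    intro v
    have hdd : DifferentiableAt ℝ (fderiv ℝ F) p :=
      (hF.fderiv_right (m := ∞) (by simp)).differentiableAt (by simp)
    have e1 : A =ᶠ[𝓝 p] fun p => (fderiv ℝ F p) ∘L ContinuousLinearMap.inr ℝ ℝ E := by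
      filter_upwards [hF1] with p' hp'
      exact fderiv_slice (hp'.differentiableAt (by simp))
    have e2 : fderiv ℝ A p (1, 0) v = fderiv ℝ (fderiv ℝ F) p (1, 0) (0, v) := by
      rw [e1.fderiv_eq]
      rw [(hdd.hasFDerivAt.clm_comp (hasFDerivAt_const _ p)).fderiv]
      simp
    have e3 : fderiv ℝ (fderiv ℝ F) p (1, 0) (0, v) = fderiv ℝ (fderiv ℝ F) p (0, v) (1, 0) :=
      (hF.isSymmSndFDerivAt (by
        simpa using (WithTop.coe_le_coe.2 le_top : ((2 : ℕ∞) : WithTop ℕ∞) ≤ ∞))) _ _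
    have e4 : fderiv ℝ (fun p' => fderiv ℝ F p' (1, 0)) p (0, v) =
        fderiv ℝ (fderiv ℝ F) p (0, v) (1, 0) := by
      rw [(hdd.hasFDerivAt.clm_apply (hasFDerivAt_const _ p)).fderiv]
      simp
    have e5 : fderiv ℝ (fun p' => X (F p')) p (0, v) = fderiv ℝ X (F p) (A p v) := by
      have h := (HasFDerivAt.comp (g := X) p hXd.hasFDerivAt hFd.hasFDerivAt).fderiv
      rw [show (X ∘ F) = fun p' => X (F p') from rfl] at h
      rw [h, hAdef]
      simp only [fderiv_slice hFd]
      simp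
    rw [e2, e3, ← e4, ← e5]
    exact congrArg (fun L : (ℝ × E) →L[ℝ] E => L (0, v)) (Filter.EventuallyEq.fderiv_eq hdF)
  -- Differentiating the product `A G = Y ∘ F` in time and solving for `∂ₜ G` avoids a formula for
  -- the derivative of the inverse. Invertibility persists near `p` because invertible operators
  -- form an open set.
  have hmul : ∀ᶠ p' in 𝓝 p, A p' (G p') = Y (F p') := by
    obtain ⟨e, he⟩ := hA
    have hn : ∀ᶠ p' in 𝓝 p, A p' ∈ range ((↑) : (E ≃L[ℝ] E) → E →L[ℝ] E) :=
      hAs.continuousAt.preimage_mem_nhds (by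
        rw [show A p = (e : E →L[ℝ] E) from he.symm]; exact ContinuousLinearEquiv.nhds e)
    filter_upwards [hn] with p' hp'
    obtain ⟨e', he'⟩ := hp'
    simp only [hGdef, ← he', ContinuousLinearMap.inverse_equiv]
    simp
  have ht : Filter.Tendsto (fun t : ℝ => (t, p.2)) (𝓝 p.1) (𝓝 p) :=
    (continuous_id.prodMk continuous_const).tendsto' p.1 p rfl
  have d1 := (hasDerivAt_slice hAd).clm_apply (hasDerivAt_slice hGd)
  have d2 : HasDerivAt (fun t => Y (F (t, p.2))) (fderiv ℝ Y (F p) (X (F p))) p.1 := by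
    have := HasFDerivAt.comp_hasDerivAt (l := Y) p.1 hYd.hasFDerivAt (hasDerivAt_slice hFd)
    rw [hdF.self_of_nhds] at this
    exact this
  have d3 := d1.congr_of_eventuallyEq (f₁ := fun t => Y (F (t, p.2)))
    ((ht.eventually hmul).mono fun t h => h.symm)
  have d4 := d3.unique d2
  have d5 := hasDerivAt_slice hGd
  have hinv : ∀ w, (A p).inverse (A p w) = w := by
    obtain ⟨e, he⟩ := hA
    intro w
    rw [show A p = (e : E →L[ℝ] E) from he.symm, ContinuousLinearMap.inverse_equiv]
    simp
  have d6 : fderiv ℝ G p (1, 0) = (A p).inverse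
      (fderiv ℝ Y (F p) (X (F p)) - fderiv ℝ X (F p) (Y (F p))) := by
    rw [← d4, hAt]
    have : A p (G p) = Y (F p) := hmul.self_of_nhds
    simp only [Prod.mk.eta, this, add_sub_cancel_left, hinv]
  rw [d6] at d5
  exact d5

end EuclideanFlow

/-! ### The flow on the manifold in charts. -/

section ManifoldFlow

variable {m : ℕ} {M : Type*} [TopologicalSpace M] [ChartedSpace (EuclideanSpace ℝ (Fin m)) M]
  [IsManifold (𝓡 m) ∞ M]

/-- The coordinate representation of a flow, in the preferred charts at `x₀` and at `r`. -/
def flowHat (Φ : ℝ → M → M) (x₀ r : M) (p : ℝ × Mod m) : Mod m :=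
  extChartAt (𝓡 m) r (Φ p.1 ((extChartAt (𝓡 m) x₀).symm p.2))

/-- The domain of `flowHat`. -/
def flowHatDomain (Φ : ℝ → M → M) (D : Set (ℝ × M)) (x₀ r : M) : Set (ℝ × Mod m) :=
  {p | p.2 ∈ (extChartAt (𝓡 m) x₀).target ∧ (p.1, (extChartAt (𝓡 m) x₀).symm p.2) ∈ D ∧
    Φ p.1 ((extChartAt (𝓡 m) x₀).symm p.2) ∈ (extChartAt (𝓡 m) r).source}

variable {X : VField m M} {Φ : ℝ → M → M} {D : Set (ℝ × M)} {x₀ r : M} {p : ℝ × Mod m}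

theorem contMDiffAt_symmPair (hp : p.2 ∈ (extChartAt (𝓡 m) x₀).target) :
    ContMDiffAt 𝓘(ℝ, ℝ × Mod m) (𝓘(ℝ, ℝ).prod (𝓡 m)) ∞
      (fun p : ℝ × Mod m => (p.1, (extChartAt (𝓡 m) x₀).symm p.2)) p := by
  have h2 : ContMDiffAt 𝓘(ℝ, Mod m) (𝓡 m) ∞ (extChartAt (𝓡 m) x₀).symm p.2 :=
    ((contMDiffOn_extChartAt_symm (I := 𝓡 m) (n := ∞) x₀) p.2 hp).contMDiffAt
      ((isOpen_extChartAt_target x₀).mem_nhds hp)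
  exact (contDiffAt_fst.contMDiffAt).prodMk (h2.comp p contDiffAt_snd.contMDiffAt)

theorem contMDiffAt_flow_symmPair (hΦ : IsLocalFlow X Φ D) (hp : p ∈ flowHatDomain Φ D x₀ r) :
    ContMDiffAt 𝓘(ℝ, ℝ × Mod m) (𝓡 m) ∞
      (fun p : ℝ × Mod m => Φ p.1 ((extChartAt (𝓡 m) x₀).symm p.2)) p := by
  have h := (hΦ.smooth _ hp.2.1).contMDiffAt (hΦ.isOpen.mem_nhds hp.2.1)
  exact ContMDiffAt.comp (g := fun p : ℝ × M => Φ p.1 p.2) p h (contMDiffAt_symmPair hp.1)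

theorem contDiffAt_flowHat (hΦ : IsLocalFlow X Φ D) (hp : p ∈ flowHatDomain Φ D x₀ r) :
    ContDiffAt ℝ ∞ (flowHat Φ x₀ r) p := by
  have h1 := contMDiffAt_flow_symmPair hΦ hp
  have h2 : ContMDiffAt (𝓡 m) 𝓘(ℝ, Mod m) ∞ (extChartAt (𝓡 m) r)
      (Φ p.1 ((extChartAt (𝓡 m) x₀).symm p.2)) :=
    contMDiffAt_extChartAt' (by simpa using hp.2.2)
  exact (ContMDiffAt.comp p h2 h1).contDiffAt

theorem eventually_mem_flowHatDomain (hΦ : IsLocalFlow X Φ D)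
    (hp : p ∈ flowHatDomain Φ D x₀ r) : ∀ᶠ p' in 𝓝 p, p' ∈ flowHatDomain Φ D x₀ r := by
  have h1 := (contMDiffAt_symmPair (x₀ := x₀) hp.1).continuousAt
  have h2 := (contMDiffAt_flow_symmPair hΦ hp).continuousAt
  filter_upwards [continuousAt_snd.preimage_mem_nhds
      ((isOpen_extChartAt_target (I := 𝓡 m) x₀).mem_nhds hp.1),
    h1.preimage_mem_nhds (hΦ.isOpen.mem_nhds hp.2.1),
    h2.preimage_mem_nhds ((isOpen_extChartAt_source (I := 𝓡 m) r).mem_nhds hp.2.2)] with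
      p' a1 a2 a3
  exact ⟨a1, a2, a3⟩

theorem hasDerivAt_flowHat (hΦ : IsLocalFlow X Φ D) (hp : p ∈ flowHatDomain Φ D x₀ r) :
    HasDerivAt (fun τ => flowHat Φ x₀ r (τ, p.2)) (hat r X (flowHat Φ x₀ r p)) p.1 := by
  have h1 := hΦ.deriv _ _ hp.2.1
  have h2 : HasMFDerivAt (𝓡 m) 𝓘(ℝ, Mod m) (extChartAt (𝓡 m) r) _ _ :=
    (mdifferentiableAt_extChartAt (I := 𝓡 m) (x := r) (by simpa using hp.2.2)).hasMFDerivAt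
  have h3 : HasMFDerivAt 𝓘(ℝ, ℝ) 𝓘(ℝ, Mod m) (fun τ => flowHat Φ x₀ r (τ, p.2)) p.1
      ((1 : ℝ →L[ℝ] ℝ).smulRight (hat r X (flowHat Φ x₀ r p))) := by
    refine (HasMFDerivAt.comp p.1 h2 h1).congr_mfderiv ?_
    unfold hat flowHat
    rw [(extChartAt (𝓡 m) r).left_inv hp.2.2, tcoord_eq_mfderiv hp.2.2]
    refine ContinuousLinearMap.ext fun c => ?_
    exact (mfderiv (𝓡 m) 𝓘(ℝ, Mod m) (extChartAt (𝓡 m) r) _).map_smul c _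
  have h4 : HasFDerivAt (fun τ => flowHat Φ x₀ r (τ, p.2))
      ((1 : ℝ →L[ℝ] ℝ).smulRight (hat r X (flowHat Φ x₀ r p))) p.1 :=
    hasMFDerivAt_iff_hasFDerivAt.1 h3
  simpa using h4.hasDerivAt

/-- The differential of a flow map, between model spaces. -/
def dflow (Φ : ℝ → M → M) (t : ℝ) (x : M) : Mod m →L[ℝ] Mod m :=
  mfderiv (𝓡 m) (𝓡 m) (Φ t) x

theorem contMDiffAt_flow {t : ℝ} {x : M} (hΦ : IsLocalFlow X Φ D) (hx : (t, x) ∈ D) :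
    ContMDiffAt (𝓡 m) (𝓡 m) ∞ (Φ t) x := by
  have h := (hΦ.smooth _ hx).contMDiffAt (hΦ.isOpen.mem_nhds hx)
  have h1 : ContMDiffAt (𝓡 m) (𝓘(ℝ, ℝ).prod (𝓡 m)) ∞ (fun y : M => (t, y)) x :=
    contMDiffAt_const.prodMk contMDiffAt_id
  exact ContMDiffAt.comp (g := fun p : ℝ × M => Φ p.1 p.2) x h h1

theorem fderiv_flowHat (hΦ : IsLocalFlow X Φ D) (hp : p ∈ flowHatDomain Φ D x₀ r) :
    fderiv ℝ (fun z => flowHat Φ x₀ r (p.1, z)) p.2 =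
      (tcoord r (Φ p.1 ((extChartAt (𝓡 m) x₀).symm p.2))) ∘L
        (dflow Φ p.1 ((extChartAt (𝓡 m) x₀).symm p.2)) ∘L
        (tcoordSymm x₀ ((extChartAt (𝓡 m) x₀).symm p.2)) := by
  have h1 : HasMFDerivAt 𝓘(ℝ, Mod m) (𝓡 m) (extChartAt (𝓡 m) x₀).symm p.2 _ :=
    (((contMDiffOn_extChartAt_symm (I := 𝓡 m) (n := ∞) x₀) p.2 hp.1).contMDiffAt
      ((isOpen_extChartAt_target x₀).mem_nhds hp.1)).mdifferentiableAt (by simp) |>.hasMFDerivAt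
  have h2 := ((contMDiffAt_flow hΦ hp.2.1).mdifferentiableAt (by simp)).hasMFDerivAt
  have h3 : HasMFDerivAt (𝓡 m) 𝓘(ℝ, Mod m) (extChartAt (𝓡 m) r) _ _ :=
    (mdifferentiableAt_extChartAt (I := 𝓡 m) (x := r) (by simpa using hp.2.2)).hasMFDerivAt
  have h4 : HasMFDerivAt 𝓘(ℝ, Mod m) 𝓘(ℝ, Mod m) (fun z => flowHat Φ x₀ r (p.1, z)) p.2
      ((tcoord r (Φ p.1 ((extChartAt (𝓡 m) x₀).symm p.2))) ∘L
        (dflow Φ p.1 ((extChartAt (𝓡 m) x₀).symm p.2)) ∘L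
        (tcoordSymm x₀ ((extChartAt (𝓡 m) x₀).symm p.2))) := by
    rw [tcoord_eq_mfderiv hp.2.2, tcoordSymm_eq_mfderiv hp.1]
    exact HasMFDerivAt.comp p.2 h3 (HasMFDerivAt.comp p.2 h2 h1)
  have h5 : HasFDerivAt (fun z => flowHat Φ x₀ r (p.1, z))
      ((tcoord r (Φ p.1 ((extChartAt (𝓡 m) x₀).symm p.2))) ∘L
        (dflow Φ p.1 ((extChartAt (𝓡 m) x₀).symm p.2)) ∘L
        (tcoordSymm x₀ ((extChartAt (𝓡 m) x₀).symm p.2))) p.2 :=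
    hasMFDerivAt_iff_hasFDerivAt.1 h4
  exact h5.fderiv

theorem isInvertible_tcoord {q x : M} (hx : x ∈ (extChartAt (𝓡 m) q).source) :
    (tcoord (m := m) q x).IsInvertible :=
  ContinuousLinearMap.IsInvertible.of_inverse (g := tcoordSymm q x)
    (by ext1 v; exact tcoord_symm hx v) (by ext1 v; exact tcoordSymm_tcoord hx v)

theorem isInvertible_tcoordSymm {q x : M} (hx : x ∈ (extChartAt (𝓡 m) q).source) :
    (tcoordSymm (m := m) q x).IsInvertible :=
  ContinuousLinearMap.IsInvertible.of_inverse (g := tcoord q x)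
    (by ext1 v; exact tcoordSymm_tcoord hx v) (by ext1 v; exact tcoord_symm hx v)

theorem inverse_tcoordSymm {q x : M} (hx : x ∈ (extChartAt (𝓡 m) q).source) :
    (tcoordSymm (m := m) q x).inverse = tcoord q x :=
  ContinuousLinearMap.inverse_eq
    (by ext1 v; exact tcoordSymm_tcoord hx v) (by ext1 v; exact tcoord_symm hx v)

theorem inverse_tcoord {q x : M} (hx : x ∈ (extChartAt (𝓡 m) q).source) :
    (tcoord (m := m) q x).inverse = tcoordSymm q x :=
  ContinuousLinearMap.inverse_eq
    (by ext1 v; exact tcoord_symm hx v) (by ext1 v; exact tcoordSymm_tcoord hx v)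

/-- The coordinate changes at source and target cancel those inside `hat`, so the pull-back on `M`
is the pull-back of the coordinate fields by `flowHat` and the Euclidean results apply. -/
theorem hat_mpullback (hΦ : IsLocalFlow X Φ D) (hp : p ∈ flowHatDomain Φ D x₀ r)
    (Y : VField m M) :
    hat x₀ (VectorField.mpullback (𝓡 m) (𝓡 m) (Φ p.1) Y) p.2 =
      (fderiv ℝ (fun z => flowHat Φ x₀ r (p.1, z)) p.2).inverse
        (hat r Y (flowHat Φ x₀ r p)) := by
  have hs := (extChartAt (𝓡 m) x₀).map_target hp.1
  rw [fderiv_flowHat hΦ hp, (isInvertible_tcoord hp.2.2).inverse_comp_of_left,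
    (isInvertible_tcoordSymm hs).inverse_comp_of_right, inverse_tcoord hp.2.2,
    inverse_tcoordSymm hs]
  unfold hat flowHat
  rw [(extChartAt (𝓡 m) r).left_inv hp.2.2]
  exact congrArg (fun w => tcoord x₀ ((extChartAt (𝓡 m) x₀).symm p.2)
    ((dflow Φ p.1 ((extChartAt (𝓡 m) x₀).symm p.2)).inverse w))
    (tcoordSymm_tcoord hp.2.2 (Y (Φ p.1 ((extChartAt (𝓡 m) x₀).symm p.2)))).symm

theorem mem_flowHatDomain_center {t : ℝ} (hx : (t, x₀) ∈ D) :
    (t, extChartAt (𝓡 m) x₀ x₀) ∈ flowHatDomain Φ D x₀ (Φ t x₀) := by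
  refine ⟨mem_extChartAt_target x₀, ?_, ?_⟩
  · simpa using hx
  · simp

end ManifoldFlow

/-! ### Derivative of pull-backs on the manifold, group law, invariance of the field. -/

section FlowLaw

variable {m : ℕ} {M : Type*} [TopologicalSpace M] [ChartedSpace (EuclideanSpace ℝ (Fin m)) M]
  [IsManifold (𝓡 m) ∞ M]
variable {X : VField m M} {Φ : ℝ → M → M} {D : Set (ℝ × M)} {x : M} {a b : ℝ}

theorem isInvertible_fderiv_flowHat (hΦ : IsLocalFlow X Φ D) (hx : (a, x) ∈ D)
    (hinv : (dflow (m := m) Φ a x).IsInvertible) :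
    (fderiv ℝ (fun z => flowHat Φ x (Φ a x) (a, z)) (extChartAt (𝓡 m) x x)).IsInvertible := by
  have h := fderiv_flowHat hΦ (mem_flowHatDomain_center hx)
  have hs : (extChartAt (𝓡 m) x).symm (extChartAt (𝓡 m) x x) = x := extChartAt_to_inv x
  simp only [hs] at h
  rw [h]
  exact (isInvertible_tcoord (mem_extChartAt_source _)).comp
    (hinv.comp (isInvertible_tcoordSymm (mem_extChartAt_source _)))

theorem smoothField_contDiffAt_hat {Y : VField m M} (hY : IsSmoothField Y) {r : M} {y : Mod m}
    (hy : y ∈ (extChartAt (𝓡 m) r).target) : ContDiffAt ℝ ∞ (hat r Y) y :=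
  hat_contDiffAt (n := ⊤) hy (hY _)

theorem flowHat_center : flowHat Φ x (Φ a x) (a, extChartAt (𝓡 m) x x) =
    extChartAt (𝓡 m) (Φ a x) (Φ a x) := by
  unfold flowHat
  rw [extChartAt_to_inv]

theorem contDiffAt_hat_mpullback (hΦ : IsLocalFlow X Φ D) (hx : (a, x) ∈ D)
    (hinv : (dflow (m := m) Φ a x).IsInvertible) {Y : VField m M} (hY : IsSmoothField Y) :
    ContDiffAt ℝ ∞ (fun p : ℝ × Mod m =>
      hat x (VectorField.mpullback (𝓡 m) (𝓡 m) (Φ p.1) Y) p.2) (a, extChartAt (𝓡 m) x x) := by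
  have hp := mem_flowHatDomain_center (m := m) (Φ := Φ) hx
  have h1 := contDiffAt_pullback (F := flowHat Φ x (Φ a x)) (Y := hat (Φ a x) Y)
    (contDiffAt_flowHat hΦ hp)
    (by rw [flowHat_center (m := m)]; exact smoothField_contDiffAt_hat hY (mem_extChartAt_target _))
    (isInvertible_fderiv_flowHat hΦ hx hinv)
  refine h1.congr_of_eventuallyEq ?_
  filter_upwards [eventually_mem_flowHatDomain hΦ hp] with p hp
  exact hat_mpullback hΦ hp Y

/-- The derivative in time of the pull-back of a vector field by the flow of `X`. -/
theorem hasDerivAt_mpullback (hΦ : IsLocalFlow X Φ D) (hX : IsSmoothField X) (hx : (a, x) ∈ D)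
    (hinv : (dflow (m := m) Φ a x).IsInvertible) {Y : VField m M} (hY : IsSmoothField Y) :
    HasDerivAt (fun t => (VectorField.mpullback (𝓡 m) (𝓡 m) (Φ t) Y x : Mod m))
      (VectorField.mpullback (𝓡 m) (𝓡 m) (Φ a) (VectorField.mlieBracket (𝓡 m) X Y) x : Mod m)
      a := by
  have hp := mem_flowHatDomain_center (m := m) (Φ := Φ) hx
  have hc := flowHat_center (m := m) (Φ := Φ) (x := x) (a := a)
  have hh : ∀ Z : VField m M, hat (Φ a x) Z (flowHat Φ x (Φ a x) (a, extChartAt (𝓡 m) x x)) =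
    Z (Φ a x) := fun Z => by rw [hc, hat_self]
  have h1 := hasDerivAt_pullback (F := flowHat Φ x (Φ a x)) (X := hat (Φ a x) X)
    (Y := hat (Φ a x) Y) (contDiffAt_flowHat hΦ hp)
    (by rw [hc]; exact smoothField_contDiffAt_hat hX (mem_extChartAt_target _))
    (by rw [hc]; exact smoothField_contDiffAt_hat hY (mem_extChartAt_target _))
    (isInvertible_fderiv_flowHat hΦ hx hinv)
    ((eventually_mem_flowHatDomain hΦ hp).mono fun p hp => hasDerivAt_flowHat hΦ hp)
  have h2 : fderiv ℝ (hat (Φ a x) Y) (flowHat Φ x (Φ a x) (a, extChartAt (𝓡 m) x x))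
        (hat (Φ a x) X (flowHat Φ x (Φ a x) (a, extChartAt (𝓡 m) x x))) -
      fderiv ℝ (hat (Φ a x) X) (flowHat Φ x (Φ a x) (a, extChartAt (𝓡 m) x x))
        (hat (Φ a x) Y (flowHat Φ x (Φ a x) (a, extChartAt (𝓡 m) x x))) =
      hat (Φ a x) (VectorField.mlieBracket (𝓡 m) X Y)
        (flowHat Φ x (Φ a x) (a, extChartAt (𝓡 m) x x)) := by
    rw [hh (VectorField.mlieBracket (𝓡 m) X Y), mlieBracket_eq_hat, hc]
  -- The target chart stays centred at `Φ a x` while the time varies near `a`, so that the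
  -- derivative is taken in one fixed chart.
  have hself : ∀ t (Z : VField m M), (t, extChartAt (𝓡 m) x x) ∈ flowHatDomain Φ D x (Φ a x) →
      (VectorField.mpullback (𝓡 m) (𝓡 m) (Φ t) Z x : Mod m) =
      (fderiv ℝ (fun z => flowHat Φ x (Φ a x) (t, z)) (extChartAt (𝓡 m) x x)).inverse
        (hat (Φ a x) Z (flowHat Φ x (Φ a x) (t, extChartAt (𝓡 m) x x))) := by
    intro t Z ht
    have := hat_mpullback hΦ ht Z
    rw [hat_self] at this
    exact this
  rw [h2, ← hself _ _ hp] at h1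
  refine h1.congr_of_eventuallyEq ?_
  have ht : Filter.Tendsto (fun t : ℝ => (t, extChartAt (𝓡 m) x x)) (𝓝 a)
      (𝓝 (a, extChartAt (𝓡 m) x x)) :=
    (continuous_id.prodMk continuous_const).tendsto' _ _ rfl
  filter_upwards [ht.eventually (eventually_mem_flowHatDomain hΦ hp)] with t ht
  exact hself t Y ht

theorem IsLocalFlow.zero_mem (hΦ : IsLocalFlow X Φ D) (hx : (a, x) ∈ D) : (0, x) ∈ D :=
  hΦ.interval a x hx 0 left_mem_uIcc

/-- As functions of `b`, both sides are integral curves of `X` with the same value at `0`, and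
integral curves of a smooth field on a Hausdorff manifold are unique. The uniqueness theorem wants
an open interval, so the segment from `0` to `b` is first enlarged inside the open domain. -/
theorem IsLocalFlow.add [T2Space M] (hΦ : IsLocalFlow X Φ D) (hX : IsSmoothField X)
    (ha : (a, x) ∈ D) (hb : (b, Φ a x) ∈ D) (hab : (a + b, x) ∈ D) :
    Φ b (Φ a x) = Φ (a + b) x := by
  set U : Set ℝ := {τ | (τ, Φ a x) ∈ D ∧ (τ + a, x) ∈ D} with hU
  have hUo : IsOpen U :=
    (hΦ.isOpen.preimage (f := fun τ : ℝ => (τ, Φ a x)) (by fun_prop)).inter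
      (hΦ.isOpen.preimage (f := fun τ : ℝ => (τ + a, x)) (by fun_prop))
  have hsub : uIcc 0 b ⊆ U := by
    intro τ hτ
    refine ⟨hΦ.interval _ _ hb τ hτ, ?_⟩
    -- Whatever the signs of `a` and `b`, the segment from `a` to `a + b` is covered by the two
    -- segments from `0`.
    have : τ + a ∈ uIcc 0 a ∨ τ + a ∈ uIcc 0 (a + b) := by
      simp only [mem_uIcc] at hτ ⊢
      by_contra hcon
      push Not at hcon
      grind
    rcases this with h | h
    · exact hΦ.interval _ _ ha _ h
    · exact hΦ.interval _ _ hab _ h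
  obtain ⟨c, d, hcd, hcdU⟩ : ∃ c d, uIcc 0 b ⊆ Ioo c d ∧ Ioo c d ⊆ U := by
    obtain ⟨ε, hε, h1⟩ := Metric.isOpen_iff.1 hUo (min 0 b) (hsub ⟨le_rfl, min_le_max⟩)
    obtain ⟨δ, hδ, h2⟩ := Metric.isOpen_iff.1 hUo (max 0 b) (hsub ⟨min_le_max, le_rfl⟩)
    refine ⟨min 0 b - ε, max 0 b + δ, fun τ hτ => ⟨?_, ?_⟩, fun τ hτ => ?_⟩
    · have := hτ.1; linarith
    · have := hτ.2; linarith
    · rcases lt_or_ge τ (min 0 b) with h | h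
      · exact h1 (by rw [Metric.mem_ball, Real.dist_eq, abs_lt]; constructor <;> linarith [hτ.1])
      · rcases lt_or_ge (max 0 b) τ with h' | h'
        · exact h2 (by rw [Metric.mem_ball, Real.dist_eq, abs_lt]; constructor <;> linarith [hτ.2])
        · exact hsub ⟨h, h'⟩
  have hc1 : IsMIntegralCurveOn (fun τ => Φ τ (Φ a x)) X (Ioo c d) := fun τ hτ =>
    (hΦ.deriv τ _ (hcdU hτ).1).hasMFDerivWithinAt
  have hc2 : IsMIntegralCurveOn (fun τ => Φ (τ + a) x) X (Ioo c d) := by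
    have h0 : IsMIntegralCurveOn (fun τ => Φ τ x) X {t | (t, x) ∈ D} := fun τ hτ =>
      (hΦ.deriv τ _ hτ).hasMFDerivWithinAt
    exact (h0.comp_add a).mono fun τ hτ => (hcdU hτ).2
  have h0 : (0 : ℝ) ∈ Ioo c d := hcd left_mem_uIcc
  have := isMIntegralCurveOn_Ioo_eqOn_of_contMDiff_boundaryless (I := 𝓡 m) h0
    (hX.of_le (by simp)) hc1 hc2 (by
      simp only [zero_add]
      exact hΦ.zero _ (hcdU h0).1)
  have h3 := this (hcd right_mem_uIcc)
  simp only at h3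
  rw [h3, add_comm]

theorem IsLocalFlow.eventually_add [T2Space M] (hΦ : IsLocalFlow X Φ D) (hX : IsSmoothField X)
    (ha : (a, x) ∈ D) (hb : (b, Φ a x) ∈ D) (hab : (a + b, x) ∈ D) :
    ∀ᶠ y in 𝓝 x, Φ b (Φ a y) = Φ (a + b) y := by
  have hc : ContinuousAt (Φ a) x := (contMDiffAt_flow hΦ ha).continuousAt
  filter_upwards [(Continuous.prodMk_right a).continuousAt.preimage_mem_nhds
      (hΦ.isOpen.mem_nhds ha),
    (Continuous.prodMk_right (a + b)).continuousAt.preimage_mem_nhds (hΦ.isOpen.mem_nhds hab),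
    (ContinuousAt.comp (g := fun z : M => (b, z)) (Continuous.prodMk_right b).continuousAt
      hc).preimage_mem_nhds (hΦ.isOpen.mem_nhds hb)] with y h1 h2 h3
  exact hΦ.add hX h1 h3 h2

theorem hasMFDerivAt_flow (hΦ : IsLocalFlow X Φ D) (ha : (a, x) ∈ D) :
    HasMFDerivAt (𝓡 m) (𝓡 m) (Φ a) x (dflow Φ a x) :=
  ((contMDiffAt_flow hΦ ha).mdifferentiableAt (by simp)).hasMFDerivAt

theorem dflow_comp [T2Space M] (hΦ : IsLocalFlow X Φ D) (hX : IsSmoothField X)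
    (ha : (a, x) ∈ D) (hb : (b, Φ a x) ∈ D) (hab : (a + b, x) ∈ D) :
    (dflow (m := m) Φ b (Φ a x)) ∘L (dflow Φ a x) = dflow Φ (a + b) x := by
  have h1 := (hasMFDerivAt_flow hΦ hb).comp x (hasMFDerivAt_flow hΦ ha)
  have h2 := (hasMFDerivAt_flow hΦ hab).congr_of_eventuallyEq (hΦ.eventually_add hX ha hb hab)
  exact hasMFDerivAt_unique h1 h2

theorem IsLocalFlow.eventually_zero (hΦ : IsLocalFlow X Φ D) (h0 : (0, x) ∈ D) :
    ∀ᶠ y in 𝓝 x, Φ 0 y = y := by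
  filter_upwards [(Continuous.prodMk_right (0 : ℝ)).continuousAt.preimage_mem_nhds
    (hΦ.isOpen.mem_nhds h0)] with y h
  exact hΦ.zero y h

theorem dflow_zero (hΦ : IsLocalFlow X Φ D) (h0 : (0, x) ∈ D) :
    dflow Φ 0 x = ContinuousLinearMap.id ℝ (Mod m) := by
  have h1 := hasMFDerivAt_flow hΦ h0
  have h2 := (hasMFDerivAt_id (I := 𝓡 m) x).congr_of_eventuallyEq (hΦ.eventually_zero h0)
  have h3 := hΦ.zero x h0
  exact hasMFDerivAt_unique h1 h2

/-- The inverse is the differential of the time `-a` flow map at `Φ a x`, by the group law. -/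
theorem dflow_isInvertible [T2Space M] (hΦ : IsLocalFlow X Φ D) (hX : IsSmoothField X)
    (ha : (a, x) ∈ D) (hb : (-a, Φ a x) ∈ D) : (dflow (m := m) Φ a x).IsInvertible := by
  have h0 := hΦ.zero_mem ha
  have h0' := hΦ.zero_mem hb
  have hx : Φ (-a) (Φ a x) = x := by
    rw [hΦ.add hX ha hb (by simpa using h0)]
    simpa using hΦ.zero x h0
  have h1 := dflow_comp hΦ hX ha hb (by simpa using h0)
  have h2 := dflow_comp (m := m) hΦ hX hb (by simpa [hx] using ha) (by simpa using h0')
  rw [add_neg_cancel, dflow_zero hΦ h0] at h1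
  rw [neg_add_cancel, dflow_zero hΦ h0', hx] at h2
  exact ContinuousLinearMap.IsInvertible.of_inverse h2 h1

/-- Differentiate `Φ a (Φ τ x) = Φ (τ + a) x` at `τ = 0`. -/
theorem dflow_field [T2Space M] (hΦ : IsLocalFlow X Φ D) (hX : IsSmoothField X)
    (ha : (a, x) ∈ D) : dflow Φ a x (X x) = X (Φ a x) := by
  have h0 := hΦ.zero_mem ha
  have hx := hΦ.zero x h0
  have e1 : ∀ᶠ τ in 𝓝 (0 : ℝ), Φ a (Φ τ x) = Φ (τ + a) x := by
    have hc : ContinuousAt (fun τ => Φ τ x) 0 := (hΦ.deriv 0 x h0).continuousAt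
    filter_upwards [(by fun_prop : ContinuousAt (fun τ : ℝ => (τ, x)) 0).preimage_mem_nhds
        (hΦ.isOpen.mem_nhds h0),
      (by fun_prop : ContinuousAt (fun τ : ℝ => (τ + a, x)) 0).preimage_mem_nhds
        (hΦ.isOpen.mem_nhds (by simpa using ha)),
      (continuousAt_const.prodMk hc : ContinuousAt (fun τ => (a, Φ τ x)) 0).preimage_mem_nhds
        (hΦ.isOpen.mem_nhds (by simpa [hx] using ha))] with τ h1 h2 h3
    exact hΦ.add hX h1 h3 h2
  have d1 : HasMFDerivAt 𝓘(ℝ, ℝ) (𝓡 m) (fun τ => Φ a (Φ τ x)) 0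
      ((dflow Φ a x) ∘L ((1 : ℝ →L[ℝ] ℝ).smulRight (show Mod m from X x))) := by
    have h1 := hΦ.deriv 0 x h0
    have h2 : HasMFDerivAt (𝓡 m) (𝓡 m) (Φ a) (Φ 0 x) (dflow Φ a (Φ 0 x)) :=
      hasMFDerivAt_flow hΦ (by rw [hx]; exact ha)
    have h3 := HasMFDerivAt.comp (0 : ℝ) h2 h1
    rw [hx] at h3
    exact h3
  have d2 : HasMFDerivAt 𝓘(ℝ, ℝ) (𝓡 m) (fun τ => Φ (τ + a) x) 0
      ((1 : ℝ →L[ℝ] ℝ).smulRight (show Mod m from X (Φ a x))) := by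
    have h0 : IsMIntegralCurveOn (fun τ => Φ τ x) X {t | (t, x) ∈ D} := fun τ hτ =>
      (hΦ.deriv τ _ hτ).hasMFDerivWithinAt
    have h1 := h0.comp_add a 0 (by simpa using ha)
    have h2 := h1.hasMFDerivAt ((hΦ.isOpen.preimage (f := fun τ : ℝ => (τ + a, x))
      (by fun_prop)).mem_nhds (by simpa using ha))
    have h3 : ((fun τ => Φ τ x) ∘ fun τ => τ + a) 0 = Φ a x := by simp
    rw [h3] at h2
    exact h2
  have h := hasMFDerivAt_unique d1 (d2.congr_of_eventuallyEq e1)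
  have h4 := congrArg (fun L : ℝ →L[ℝ] Mod m => L 1) h
  have h5 : dflow Φ a x ((1 : ℝ) • (show Mod m from X x)) =
    (1 : ℝ) • (show Mod m from X (Φ a x)) := h4
  rw [one_smul, one_smul] at h5
  exact h5

end FlowLaw

/-! ### Interchange of a time derivative with a space derivative. -/

section MixedDerivative

variable {E G : Type*} [NormedAddCommGroup E] [NormedSpace ℝ E] [NormedAddCommGroup G]
  [NormedSpace ℝ G]

theorem fderiv_slice' {F : ℝ × E → G} {p : ℝ × E} (hF : DifferentiableAt ℝ F p) :
    fderiv ℝ (fun z => F (p.1, z)) p.2 =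
      (fderiv ℝ F p) ∘L ContinuousLinearMap.inr ℝ ℝ E := by
  have h1 : HasFDerivAt (fun z : E => (p.1, z)) (ContinuousLinearMap.inr ℝ ℝ E) p.2 := by
    have := (hasFDerivAt_const (𝕜 := ℝ) p.1 p.2).prodMk (hasFDerivAt_id p.2)
    exact this
  exact (HasFDerivAt.comp (g := F) p.2 hF.hasFDerivAt h1).fderiv

/-- Symmetry of the second derivative of `F`. No regularity of `H` is assumed: near `p` it coincides
with a partial derivative of `F`. -/
theorem hasDerivAt_fderiv_slice {F H : ℝ × E → G} {p : ℝ × E} (hF : ContDiffAt ℝ ∞ F p)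
    (hH : ∀ᶠ p' in 𝓝 p, HasDerivAt (fun τ => F (τ, p'.2)) (H p') p'.1) :
    HasDerivAt (fun τ => fderiv ℝ (fun z => F (τ, z)) p.2)
      (fderiv ℝ (fun z => H (p.1, z)) p.2) p.1 := by
  have hF1 : ∀ᶠ p' in 𝓝 p, ContDiffAt ℝ 1 F p' :=
    (hF.of_le (m := 1) (by simp)).eventually (by simp)
  have hdd : DifferentiableAt ℝ (fderiv ℝ F) p :=
    (hF.fderiv_right (m := ∞) (by simp)).differentiableAt (by simp)
  have hdF : H =ᶠ[𝓝 p] fun p' => fderiv ℝ F p' (1, 0) := by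
    filter_upwards [hH, hF1] with p' h1 h2
    exact h1.unique (hasDerivAt_slice (h2.differentiableAt (by simp)))
  have hHd : HasFDerivAt H _ p :=
    (hdd.hasFDerivAt.clm_apply (hasFDerivAt_const (1, (0 : E)) p)).congr_of_eventuallyEq hdF
  have h3 : HasDerivAt (fun τ => (fderiv ℝ F (τ, p.2)) ∘L ContinuousLinearMap.inr ℝ ℝ E)
      ((fderiv ℝ (fderiv ℝ F) p (1, 0)) ∘L ContinuousLinearMap.inr ℝ ℝ E) p.1 := by
    have := (hasDerivAt_slice hdd).clm_comp
      (hasDerivAt_const p.1 (ContinuousLinearMap.inr ℝ ℝ E))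
    simpa using this
  have ht : Filter.Tendsto (fun t : ℝ => (t, p.2)) (𝓝 p.1) (𝓝 p) :=
    (continuous_id.prodMk continuous_const).tendsto' p.1 p rfl
  have h4 := h3.congr_of_eventuallyEq (f₁ := fun τ => fderiv ℝ (fun z => F (τ, z)) p.2)
    ((ht.eventually hF1).mono fun t h => fderiv_slice' (h.differentiableAt (by simp)))
  refine h4.congr_deriv ?_
  rw [fderiv_slice' hHd.differentiableAt, hHd.fderiv]
  ext v
  have := (hF.isSymmSndFDerivAt (by
        simpa using (WithTop.coe_le_coe.2 le_top : ((2 : ℕ∞) : WithTop ℕ∞) ≤ ∞))) (1, 0) (0, v)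
  simpa using this

end MixedDerivative

/-! ### The reference curve, its covectors, and lifts of pulled-back fields. -/

section CurveData

variable {m : ℕ} {M : Type*} [TopologicalSpace M] [ChartedSpace (EuclideanSpace ℝ (Fin m)) M]
  [IsManifold (𝓡 m) ∞ M]

theorem IsSmoothField.mlieBracket {X Y : VField m M} (hX : IsSmoothField X)
    (hY : IsSmoothField Y) : IsSmoothField (VectorField.mlieBracket (𝓡 m) X Y) := by
  intro x
  have : IsManifold (𝓡 m) ((⊤ : ℕ∞) + 1) M := ‹IsManifold (𝓡 m) ∞ M›
  have : IsManifold (𝓡 m) (minSmoothness ℝ 2) M := by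
    rw [minSmoothness_of_isRCLikeNormedField]; infer_instance
  have : IsManifold (𝓡 m) (minSmoothness ℝ 3) M := by
    rw [minSmoothness_of_isRCLikeNormedField]; infer_instance
  exact ContMDiffAt.mlieBracket_vectorField (m := ⊤) (n := ⊤) (hX x) (hY x) (by simp)

/-- The standing assumptions on the frame, the flow and the reference curve. -/
structure IsRegularCurve (S : Data m M) (D : Set (ℝ × M)) : Prop where
  smooth₁ : IsSmoothField S.X₁
  smooth₂ : IsSmoothField S.X₂
  flow : IsLocalFlow S.X₁ S.flow D
  mem_start : ∀ t ∈ Icc (0 : ℝ) 1, (t, S.x₀) ∈ D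
  mem_curve : ∀ t ∈ Icc (0 : ℝ) 1, ∀ τ ∈ Icc (0 : ℝ) 1, (τ - t, S.γ t) ∈ D
  rank : ∀ t ∈ Icc (0 : ℝ) 1, LinearIndependent ℝ ![S.X₁ (S.γ t), S.X₂ (S.γ t)]
  lift : S.cov₀ ≠ 0
  regular : S.IsRegularLift

/-- The pull-back of a vector field by `e^{(t-s)X₁}`. -/
abbrev pull (S : Data m M) (s t : ℝ) (Y : VField m M) : VField m M :=
  VectorField.mpullback (𝓡 m) (𝓡 m) (S.flow (t - s)) Y

/-- A covector of the curve as a functional on the model space. -/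
def covec (S : Data m M) (t : ℝ) : Mod m →L[ℝ] ℝ := S.lam t

namespace IsRegularCurve

variable [T2Space M] {S : Data m M} {D : Set (ℝ × M)} {s t : ℝ}

theorem flow_γ (h : IsRegularCurve S D) (hs : s ∈ Icc (0 : ℝ) 1) (ht : t ∈ Icc (0 : ℝ) 1) :
    S.flow (t - s) (S.γ s) = S.γ t := by
  have := h.flow.add h.smooth₁ (h.mem_start s hs) (h.mem_curve s hs t ht)
    (by rw [add_sub_cancel]; exact h.mem_start t ht)
  rw [add_sub_cancel] at this
  exact this

theorem inv_curve (h : IsRegularCurve S D) (hs : s ∈ Icc (0 : ℝ) 1) (ht : t ∈ Icc (0 : ℝ) 1) :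
    (dflow (m := m) S.flow (t - s) (S.γ s)).IsInvertible :=
  dflow_isInvertible h.flow h.smooth₁ (h.mem_curve s hs t ht)
    (by rw [h.flow_γ hs ht, neg_sub]; exact h.mem_curve t ht s hs)

theorem inv_start (h : IsRegularCurve S D) (hs : s ∈ Icc (0 : ℝ) 1) :
    (dflow (m := m) S.flow s S.x₀).IsInvertible :=
  dflow_isInvertible h.flow h.smooth₁ (h.mem_start s hs)
    (by have := h.mem_curve s hs 0 (by simp)
        rwa [zero_sub] at this)

theorem covec_eq (S : Data m M) (t : ℝ) (u : Mod m) :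
    covec S t u = (show Mod m →L[ℝ] ℝ from S.cov₀) ((dflow S.flow t S.x₀).inverse u) := rfl

/-- By the chain rule for the flow, the covectors `λ(t)` are transported into each other along `γ`.
-/
theorem covec_inverse (h : IsRegularCurve S D) (hs : s ∈ Icc (0 : ℝ) 1)
    (ht : t ∈ Icc (0 : ℝ) 1) (u : Mod m) :
    covec S s ((dflow S.flow (t - s) (S.γ s)).inverse u) = covec S t u := by
  have h1 := dflow_comp h.flow h.smooth₁ (h.mem_start s hs) (h.mem_curve s hs t ht)
    (by rw [add_sub_cancel]; exact h.mem_start t ht)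
  rw [add_sub_cancel] at h1
  rw [covec_eq, covec_eq, ← h1]
  have h2 := (h.inv_start hs).inverse_comp_of_right (g := dflow S.flow (t - s) (S.γ s))
  exact congrArg (fun L : Mod m →L[ℝ] Mod m =>
    (show Mod m →L[ℝ] ℝ from S.cov₀) (L u)) h2.symm

theorem pull_curve (h : IsRegularCurve S D) (hs : s ∈ Icc (0 : ℝ) 1)
    (ht : t ∈ Icc (0 : ℝ) 1) (Y : VField m M) :
    (pull S s t Y (S.γ s) : Mod m) =
      (dflow S.flow (t - s) (S.γ s)).inverse (Y (S.γ t) : Mod m) := by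
  have : ∀ x y : M, x = y → (Y x : Mod m) = (Y y : Mod m) := fun x y hxy => by rw [hxy]
  exact congrArg (dflow S.flow (t - s) (S.γ s)).inverse (this _ _ (h.flow_γ hs ht))

/-- Moves a pairing at the fixed point `γ(s)` to the point `γ(t)`, where the conditions on `λ(t)`
are available. -/
theorem covec_pull (h : IsRegularCurve S D) (hs : s ∈ Icc (0 : ℝ) 1)
    (ht : t ∈ Icc (0 : ℝ) 1) (Y : VField m M) :
    covec S s (pull S s t Y (S.γ s) : Mod m) = covec S t (Y (S.γ t) : Mod m) :=
  (congrArg (covec S s) (h.pull_curve hs ht Y)).trans (h.covec_inverse hs ht _)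

theorem covec_ne_zero (h : IsRegularCurve S D) (hs : s ∈ Icc (0 : ℝ) 1) : covec S s ≠ 0 := by
  intro h0
  apply h.lift
  obtain ⟨e, he⟩ := h.inv_start hs
  refine ContinuousLinearMap.ext fun u => ?_
  have h1 := congrArg (fun L : Mod m →L[ℝ] ℝ => L (dflow S.flow s S.x₀ u)) h0
  simp only [covec_eq, ← he, ContinuousLinearMap.inverse_equiv] at h1
  exact (congrArg (show Mod m →L[ℝ] ℝ from S.cov₀) (e.symm_apply_apply u)).symm.trans h1

theorem eventually_good (h : IsRegularCurve S D) (hs : s ∈ Icc (0 : ℝ) 1)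
    (ht : t ∈ Icc (0 : ℝ) 1) : ∀ᶠ p in 𝓝 (t, S.γ s), (p.1 - s, p.2) ∈ D ∧
      (dflow (m := m) S.flow (p.1 - s) p.2).IsInvertible := by
  have h1 := h.mem_curve s hs t ht
  have c1 : ContinuousAt (fun p : ℝ × M => (p.1 - s, p.2)) (t, S.γ s) := by fun_prop
  have c2 : ContinuousAt (fun p : ℝ × M => S.flow (p.1 - s) p.2) (t, S.γ s) :=
    ContinuousAt.comp (f := fun p : ℝ × M => (p.1 - s, p.2))
      (g := fun p : ℝ × M => S.flow p.1 p.2) (x := (t, S.γ s))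
      (((h.flow.smooth _ h1).contMDiffAt (h.flow.isOpen.mem_nhds h1)).continuousAt) c1
  have c3 : ContinuousAt (fun p : ℝ × M => (-(p.1 - s), S.flow (p.1 - s) p.2)) (t, S.γ s) :=
    (by fun_prop : ContinuousAt (fun p : ℝ × M => -(p.1 - s)) (t, S.γ s)).prodMk c2
  filter_upwards [c1.preimage_mem_nhds (h.flow.isOpen.mem_nhds h1),
    c3.preimage_mem_nhds (h.flow.isOpen.mem_nhds (by
      simp only [h.flow_γ hs ht, neg_sub]
      exact h.mem_curve t ht s hs))] with p h2 h3
  exact ⟨h2, dflow_isInvertible h.flow h.smooth₁ h2 h3⟩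

theorem hasDerivAt_pull (h : IsRegularCurve S D) {Y : VField m M} (hY : IsSmoothField Y) {x : M}
    (hx : (t - s, x) ∈ D) (hinv : (dflow (m := m) S.flow (t - s) x).IsInvertible) :
    HasDerivAt (F := Mod m) (fun τ => (pull S s τ Y x : Mod m))
      (pull S s t (VectorField.mlieBracket (𝓡 m) S.X₁ Y) x : Mod m) t := by
  have h1 : HasDerivAt (F := Mod m)
      (fun t => (VectorField.mpullback (𝓡 m) (𝓡 m) (S.flow t) Y x : Mod m))
      (pull S s t (VectorField.mlieBracket (𝓡 m) S.X₁ Y) x : Mod m) (t - s) :=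
    hasDerivAt_mpullback h.flow h.smooth₁ hx hinv hY
  exact h1.comp_sub_const t s

theorem contDiffAt_hat_pull (h : IsRegularCurve S D) (hs : s ∈ Icc (0 : ℝ) 1)
    (ht : t ∈ Icc (0 : ℝ) 1) {Y : VField m M} (hY : IsSmoothField Y) :
    ContDiffAt ℝ ∞ (fun p : ℝ × Mod m => hat (S.γ s) (pull S s p.1 Y) p.2)
      (t, extChartAt (𝓡 m) (S.γ s) (S.γ s)) := by
  have h1 := contDiffAt_hat_mpullback h.flow (h.mem_curve s hs t ht) (h.inv_curve hs ht) hY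
  have h2 : ContDiffAt ℝ ∞ (fun p : ℝ × Mod m => (p.1 - s, p.2))
      (t, extChartAt (𝓡 m) (S.γ s) (S.γ s)) := by fun_prop
  exact ContDiffAt.comp (g := fun p : ℝ × Mod m =>
      hat (S.γ s) (VectorField.mpullback (𝓡 m) (𝓡 m) (S.flow p.1) Y) p.2)
    (t, extChartAt (𝓡 m) (S.γ s) (S.γ s)) h1 h2

theorem eventually_hasDerivAt_hat_pull (h : IsRegularCurve S D) (hs : s ∈ Icc (0 : ℝ) 1)
    (ht : t ∈ Icc (0 : ℝ) 1) {Y : VField m M} (hY : IsSmoothField Y) :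
    ∀ᶠ p in 𝓝 (t, extChartAt (𝓡 m) (S.γ s) (S.γ s)),
      HasDerivAt (fun τ => hat (S.γ s) (pull S s τ Y) p.2)
        (hat (S.γ s) (pull S s p.1 (VectorField.mlieBracket (𝓡 m) S.X₁ Y)) p.2) p.1 := by
  have hc := (contMDiffAt_symmPair (m := m) (x₀ := S.γ s)
    (p := (t, extChartAt (𝓡 m) (S.γ s) (S.γ s))) (mem_extChartAt_target _)).continuousAt
  have h0 : (extChartAt (𝓡 m) (S.γ s)).symm (extChartAt (𝓡 m) (S.γ s) (S.γ s)) = S.γ s :=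
    extChartAt_to_inv _
  have he := h.eventually_good hs ht
  have hc' := hc.tendsto
  simp only [h0] at hc'
  filter_upwards [hc'.eventually he] with p hp
  have := (tcoord (S.γ s) ((extChartAt (𝓡 m) (S.γ s)).symm p.2)).hasFDerivAt.comp_hasDerivAt p.1
    (h.hasDerivAt_pull hY hp.1 hp.2)
  exact this

/-- The identity is needed on a neighbourhood of `γ(s)`, because Hamiltonian lifts and brackets
involve first derivatives of the field. -/
theorem eventually_gDot (h : IsRegularCurve S D) (hs : s ∈ Icc (0 : ℝ) 1)
    (ht : t ∈ Icc (0 : ℝ) 1) : ∀ᶠ x in 𝓝 (S.γ s),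
      S.gDot s t x = pull S s t (VectorField.mlieBracket (𝓡 m) S.X₁ S.X₂) x := by
  have hc : Filter.Tendsto (fun x : M => (t, x)) (𝓝 (S.γ s)) (𝓝 (t, S.γ s)) :=
    (Continuous.prodMk_right t).continuousAt
  filter_upwards [hc.eventually (h.eventually_good hs ht)] with x hx
  exact (h.hasDerivAt_pull h.smooth₂ hx.1 hx.2).deriv

theorem eventually_hat_congr {q : M} {X Y : VField m M} (hXY : ∀ᶠ x in 𝓝 q, X x = Y x) :
    hat q X =ᶠ[𝓝 (extChartAt (𝓡 m) q q)] hat q Y := by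
  have hc : Filter.Tendsto (extChartAt (𝓡 m) q).symm (𝓝 (extChartAt (𝓡 m) q q)) (𝓝 q) := by
    have := continuousAt_extChartAt_symm (I := 𝓡 m) q
    unfold ContinuousAt at this
    rwa [extChartAt_to_inv] at this
  filter_upwards [hc.eventually hXY] with y hy
  unfold hat
  rw [hy]

theorem hamLift_congr {q : M} (p : Mod m →L[ℝ] ℝ) {X Y : VField m M}
    (hXY : ∀ᶠ x in 𝓝 q, X x = Y x) (hY : DifferentiableAt ℝ (hat q Y) (extChartAt (𝓡 m) q q)) :
    hamLift (linHam X) (⟨q, p⟩ : Cotangent m M) = hamLift (linHam Y) ⟨q, p⟩ := by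
  have h1 := eventually_hat_congr hXY
  rw [hamLift_linHam p hY, hamLift_linHam p (hY.congr_of_eventuallyEq h1), h1.fderiv_eq,
    h1.self_of_nhds]

theorem differentiableAt_hat_pull (h : IsRegularCurve S D) (hs : s ∈ Icc (0 : ℝ) 1)
    (ht : t ∈ Icc (0 : ℝ) 1) {Y : VField m M} (hY : IsSmoothField Y) :
    DifferentiableAt ℝ (hat (S.γ s) (pull S s t Y)) (extChartAt (𝓡 m) (S.γ s) (S.γ s)) := by
  have h1 := (h.contDiffAt_hat_pull hs ht hY).differentiableAt (by simp)
  have h2 : DifferentiableAt ℝ (fun y : Mod m => (t, y))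
    (extChartAt (𝓡 m) (S.γ s) (S.γ s)) := by fun_prop
  exact DifferentiableAt.comp (g := fun p : ℝ × Mod m => hat (S.γ s) (pull S s p.1 Y) p.2)
    (extChartAt (𝓡 m) (S.γ s) (S.γ s)) h1 h2

theorem differentiableAt_hat_gDot (h : IsRegularCurve S D) (hs : s ∈ Icc (0 : ℝ) 1)
    (ht : t ∈ Icc (0 : ℝ) 1) :
    DifferentiableAt ℝ (hat (S.γ s) (S.gDot s t)) (extChartAt (𝓡 m) (S.γ s) (S.γ s)) :=
  (h.differentiableAt_hat_pull hs ht
    (h.smooth₁.mlieBracket h.smooth₂)).congr_of_eventuallyEq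
    (eventually_hat_congr (h.eventually_gDot hs ht))

theorem differentiableAt_hat_smooth {Y : VField m M} (hY : IsSmoothField Y) (q : M) :
    DifferentiableAt ℝ (hat q Y) (extChartAt (𝓡 m) q q) :=
  (smoothField_contDiffAt_hat hY (mem_extChartAt_target q)).differentiableAt (by simp)

end IsRegularCurve

/-- The Hamiltonian lift at `λ(s)` of a vector field. -/
def liftAt (S : Data m M) (s : ℝ) (X : VField m M) : PhaseMod m :=
  hamLift (linHam X) (S.lamPt s)

namespace IsRegularCurve

variable [T2Space M] {S : Data m M} {D : Set (ℝ × M)} {s t : ℝ}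

/-- In coordinates the lift has the components `F` and `-λ(s) ∘ ∂F`, with `F` the coordinate form of
the pulled-back field. The first is differentiated by the formula for pull-backs, the second by
interchanging time and space derivatives. -/
theorem contDiffAt_liftAt_pull (h : IsRegularCurve S D) (hs : s ∈ Icc (0 : ℝ) 1)
    (ht : t ∈ Icc (0 : ℝ) 1) {Y : VField m M} (hY : IsSmoothField Y) :
    ContDiffAt ℝ ∞ (fun τ => liftAt S s (pull S s τ Y)) t ∧
    HasDerivAt (fun τ => liftAt S s (pull S s τ Y))
      (liftAt S s (pull S s t (VectorField.mlieBracket (𝓡 m) S.X₁ Y))) t := by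
  set F : ℝ × Mod m → Mod m := fun p => hat (S.γ s) (pull S s p.1 Y) p.2 with hF
  set y₀ := extChartAt (𝓡 m) (S.γ s) (S.γ s) with hy₀
  have hFs : ContDiffAt ℝ ∞ F (t, y₀) := h.contDiffAt_hat_pull hs ht hY
  have hF1 : ∀ᶠ p' in 𝓝 (t, y₀), ContDiffAt ℝ 1 F p' :=
    (hFs.of_le (m := 1) (by simp)).eventually (by simp)
  have htend : Filter.Tendsto (fun τ : ℝ => (τ, y₀)) (𝓝 t) (𝓝 (t, y₀)) :=
    (continuous_id.prodMk continuous_const).tendsto' t _ rfl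
  have heq : (fun τ => liftAt S s (pull S s τ Y)) =ᶠ[𝓝 t] fun τ =>
      (F (τ, y₀), -((covec S s) ∘L fderiv ℝ (fun z => F (τ, z)) y₀)) := by
    filter_upwards [htend.eventually hF1] with τ hτ
    have h1 : DifferentiableAt ℝ (hat (S.γ s) (pull S s τ Y)) y₀ :=
      DifferentiableAt.comp (g := F) y₀ (hτ.differentiableAt (by simp))
        (by fun_prop : DifferentiableAt ℝ (fun y : Mod m => (τ, y)) y₀)
    exact hamLift_linHam (covec S s) h1
  have hpair : ContDiffAt ℝ ∞ (fun τ : ℝ => (τ, y₀)) t := by fun_prop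
  refine ⟨ContDiffAt.congr_of_eventuallyEq ?_ heq, ?_⟩
  · refine (ContDiffAt.comp (g := F) t hFs hpair).prodMk
      (contDiffAt_const.clm_comp ?_).neg
    have h2 : ContDiffAt ℝ ∞ (fun τ => (fderiv ℝ F (τ, y₀)) ∘L
        ContinuousLinearMap.inr ℝ ℝ (Mod m)) t :=
      (ContDiffAt.comp (g := fderiv ℝ F) t (hFs.fderiv_right (m := ∞) (by simp)) hpair).clm_comp
        contDiffAt_const
    refine h2.congr_of_eventuallyEq ?_
    filter_upwards [htend.eventually hF1] with τ hτ
    exact fderiv_slice' (p := (τ, y₀)) (hτ.differentiableAt (by simp))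
  · have hev := h.eventually_hasDerivAt_hat_pull hs ht hY
    have d1 := hev.self_of_nhds
    have d2 := hasDerivAt_fderiv_slice hFs hev
    have d3 : liftAt S s (pull S s t (VectorField.mlieBracket (𝓡 m) S.X₁ Y)) = _ :=
      hamLift_linHam (covec S s) (h.differentiableAt_hat_pull hs ht (h.smooth₁.mlieBracket hY))
    rw [d3]
    refine HasDerivAt.congr_of_eventuallyEq ?_ heq
    refine HasDerivAt.prodMk d1 (HasDerivAt.neg ?_)
    have := (hasDerivAt_const t (covec S s)).clm_comp d2
    rw [ContinuousLinearMap.zero_comp, zero_add] at this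
    exact this

end IsRegularCurve

end CurveData

/-! ### Symplectic relations between the lifts along the curve. -/

section CurveLifts

variable {m : ℕ} {M : Type*} [TopologicalSpace M] [ChartedSpace (EuclideanSpace ℝ (Fin m)) M]
  [IsManifold (𝓡 m) ∞ M] {S : Data m M} {D : Set (ℝ × M)} {s t : ℝ} {X Y : VField m M}

theorem symp_euler (S : Data m M) (s : ℝ) (v : PhaseMod m) :
    symp m (S.euler s) v = covec S s v.1 := by
  rw [symp_apply]
  have : v.2 (S.euler s).1 = 0 := map_zero v.2
  rw [this, sub_zero]
  rfl

theorem liftAt_fst (hX : DifferentiableAt ℝ (hat (S.γ s) X) (extChartAt (𝓡 m) (S.γ s) (S.γ s))) :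
    (liftAt S s X).1 = X (S.γ s) := by
  have h1 := congrArg Prod.fst (hamLift_linHam (covec S s) hX)
  exact h1.trans (hat_self _ _)

theorem brk_eq_symp
    (hX : DifferentiableAt ℝ (hat (S.γ s) X) (extChartAt (𝓡 m) (S.γ s) (S.γ s)))
    (hY : DifferentiableAt ℝ (hat (S.γ s) Y) (extChartAt (𝓡 m) (S.γ s) (S.γ s))) :
    S.brk s X Y = symp m (liftAt S s X) (liftAt S s Y) :=
  (symp_hamLift (covec S s) hX hY).symm

theorem smooth_mdifferentiableAt (hX : IsSmoothField X) (x : M) :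
    MDifferentiableAt (𝓡 m) (𝓡 m).tangent (fun x => (⟨x, X x⟩ : TangentBundle (𝓡 m) M)) x :=
  (hX x).mdifferentiableAt (by simp)

namespace IsRegularCurve

variable [T2Space M]

theorem eventually_inv (h : IsRegularCurve S D) (hs : s ∈ Icc (0 : ℝ) 1)
    (ht : t ∈ Icc (0 : ℝ) 1) : ∀ᶠ x in 𝓝 (S.γ s), (t - s, x) ∈ D ∧
      (dflow (m := m) S.flow (t - s) x).IsInvertible := by
  have hc : Filter.Tendsto (fun x : M => (t, x)) (𝓝 (S.γ s)) (𝓝 (t, S.γ s)) :=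
    (Continuous.prodMk_right t).continuousAt
  exact hc.eventually (h.eventually_good hs ht)

theorem liftAt_gDot (h : IsRegularCurve S D) (hs : s ∈ Icc (0 : ℝ) 1) (ht : t ∈ Icc (0 : ℝ) 1) :
    liftAt S s (S.gDot s t) =
      liftAt S s (pull S s t (VectorField.mlieBracket (𝓡 m) S.X₁ S.X₂)) :=
  hamLift_congr (covec S s) (h.eventually_gDot hs ht)
    (h.differentiableAt_hat_pull hs ht (h.smooth₁.mlieBracket h.smooth₂))

theorem hasDerivAt_liftAt_g (h : IsRegularCurve S D) (hs : s ∈ Icc (0 : ℝ) 1)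
    (ht : t ∈ Icc (0 : ℝ) 1) :
    HasDerivAt (fun τ => liftAt S s (S.g s τ)) (liftAt S s (S.gDot s t)) t := by
  rw [h.liftAt_gDot hs ht]
  exact (h.contDiffAt_liftAt_pull hs ht h.smooth₂).2

theorem continuousOn_liftAt_gDot (h : IsRegularCurve S D) (hs : s ∈ Icc (0 : ℝ) 1) :
    ContinuousOn (fun τ => liftAt S s (S.gDot s τ)) (Icc 0 1) := by
  refine ContinuousOn.congr (fun t ht => ?_) fun t ht => h.liftAt_gDot hs ht
  exact ((h.contDiffAt_liftAt_pull hs ht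
    (h.smooth₁.mlieBracket h.smooth₂)).1.continuousAt).continuousWithinAt

theorem eventually_g_self (h : IsRegularCurve S D) (hs : s ∈ Icc (0 : ℝ) 1) :
    ∀ᶠ x in 𝓝 (S.γ s), S.g s s x = S.X₂ x := by
  have h0 := h.eventually_inv hs hs
  rw [sub_self] at h0
  filter_upwards [h0] with x hx
  have h1 : (S.g s s x : Mod m) = (dflow S.flow (s - s) x).inverse
    (S.X₂ (S.flow (s - s) x) : Mod m) := rfl
  rw [sub_self, dflow_zero h.flow hx.1, ContinuousLinearMap.inverse_id] at h1
  have h2 : ∀ y : M, y = x → (S.X₂ y : Mod m) = (S.X₂ x : Mod m) := fun y hy => by rw [hy]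
  exact h1.trans (h2 _ (h.flow.zero x hx.1))

theorem liftAt_g_self (h : IsRegularCurve S D) (hs : s ∈ Icc (0 : ℝ) 1) :
    liftAt S s (S.g s s) = liftAt S s S.X₂ :=
  hamLift_congr (covec S s) (h.eventually_g_self hs) (differentiableAt_hat_smooth h.smooth₂ _)

theorem eventually_pull_X₁ (h : IsRegularCurve S D) (hs : s ∈ Icc (0 : ℝ) 1)
    (ht : t ∈ Icc (0 : ℝ) 1) :
    ∀ᶠ x in 𝓝 (S.γ s), pull S s t S.X₁ x = S.X₁ x := by
  filter_upwards [h.eventually_inv hs ht] with x hx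
  obtain ⟨e, he⟩ := hx.2
  have h1 : (pull S s t S.X₁ x : Mod m) = (dflow S.flow (t - s) x).inverse
    (S.X₁ (S.flow (t - s) x) : Mod m) := rfl
  have h2 : dflow S.flow (t - s) x (S.X₁ x) = S.X₁ (S.flow (t - s) x) :=
    dflow_field h.flow h.smooth₁ hx.1
  refine h1.trans ((congrArg (dflow S.flow (t - s) x).inverse h2).symm.trans ?_)
  rw [← he, ContinuousLinearMap.inverse_equiv]
  exact e.symm_apply_apply _

/-- The pull-back by the flow is compatible with Lie brackets, paired with the covector. -/
theorem brk_pull (h : IsRegularCurve S D) (hs : s ∈ Icc (0 : ℝ) 1) (ht : t ∈ Icc (0 : ℝ) 1)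
    (hX : IsSmoothField X) (hY : IsSmoothField Y) :
    S.brk s (pull S s t X) (pull S s t Y) = S.brk t X Y := by
  have : IsManifold (𝓡 m) (minSmoothness ℝ 2) M := by
    rw [minSmoothness_of_isRCLikeNormedField]; infer_instance
  have : IsManifold (𝓡 m) (minSmoothness ℝ 3) M := by
    rw [minSmoothness_of_isRCLikeNormedField]; infer_instance
  have h1 := VectorField.mpullback_mlieBracket (I := 𝓡 m) (I' := 𝓡 m) (n := ∞)
    (f := S.flow (t - s)) (x₀ := S.γ s) (smooth_mdifferentiableAt hX _)
    (smooth_mdifferentiableAt hY _) (contMDiffAt_flow h.flow (h.mem_curve s hs t ht))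
    (by rw [minSmoothness_of_isRCLikeNormedField]
        exact WithTop.coe_le_coe.2 le_top)
  exact (congrArg (covec S s) h1).symm.trans
    (h.covec_pull hs ht (VectorField.mlieBracket (𝓡 m) X Y))

theorem covec_Δ₂ (h : IsRegularCurve S D) (ht : t ∈ Icc (0 : ℝ) 1) :
    covec S t (S.X₁ (S.γ t) : Mod m) = 0 ∧ covec S t (S.X₂ (S.γ t) : Mod m) = 0 ∧
      S.brk t S.X₁ S.X₂ = 0 := by
  have h1 := (h.regular t ht).1
  refine ⟨h1 _ (Submodule.subset_span ?_), h1 _ (Submodule.subset_span ?_),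
    h1 _ (Submodule.subset_span ?_)⟩ <;> simp

/-- Transported to `γ(0)`, the pairing of `λ(t)` with `[X₁, X₂]` is a function of `t` that vanishes
on `[0,1]`; its derivative is the pairing with `[X₁, [X₁, X₂]]`. -/
theorem brk_X₁_bracket (h : IsRegularCurve S D) (ht : t ∈ Icc (0 : ℝ) 1) :
    S.brk t S.X₁ (VectorField.mlieBracket (𝓡 m) S.X₁ S.X₂) = 0 := by
  set Y := VectorField.mlieBracket (𝓡 m) S.X₁ S.X₂ with hY
  have hYs : IsSmoothField Y := h.smooth₁.mlieBracket h.smooth₂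
  have h0 : (0 : ℝ) ∈ Icc (0 : ℝ) 1 := by simp
  have hg := h.eventually_inv h0 ht
  have hd := (covec S 0).hasFDerivAt.comp_hasDerivAt t
    (h.hasDerivAt_pull hYs hg.self_of_nhds.1 hg.self_of_nhds.2)
  have hz : ∀ τ ∈ Icc (0 : ℝ) 1, (covec S 0 ∘ fun τ => (pull S 0 τ Y (S.γ 0) : Mod m)) τ = 0 :=
    fun τ hτ => (h.covec_pull h0 hτ Y).trans (h.covec_Δ₂ hτ).2.2
  have h1 := hd.hasDerivWithinAt (s := Icc (0 : ℝ) 1)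
  have h2 : HasDerivWithinAt (covec S 0 ∘ fun τ => (pull S 0 τ Y (S.γ 0) : Mod m)) 0
      (Icc (0 : ℝ) 1) t :=
    (hasDerivWithinAt_const t (Icc (0 : ℝ) 1) (0 : ℝ)).congr hz (hz t ht)
  have h3 := (uniqueDiffOn_Icc (zero_lt_one' ℝ) t ht).eq_deriv _ h1 h2
  exact (h.covec_pull h0 ht _).symm.trans h3

/-- Of the generators of `Δ³`, those of `Δ²` and `[X₁, [X₁, X₂]]` are annihilated by `λ(t)`, so this
is the only one left to detect regularity. It gives the nonvanishing of `l`. -/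
theorem brk_bracket_X₂_ne_zero (h : IsRegularCurve S D) (ht : t ∈ Icc (0 : ℝ) 1) :
    S.brk t (VectorField.mlieBracket (𝓡 m) S.X₁ S.X₂) S.X₂ ≠ 0 := by
  intro h0
  apply (h.regular t ht).2
  have h1 : ∀ u ∈ S.Δ₂ (S.γ t), S.lam t u = 0 := (h.regular t ht).1
  have h2 : S.lam t (VectorField.mlieBracket (𝓡 m) S.X₂
      (VectorField.mlieBracket (𝓡 m) S.X₁ S.X₂) (S.γ t)) = 0 := by
    rw [VectorField.mlieBracket_swap_apply, map_neg]
    exact neg_eq_zero.2 h0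
  have h3 : S.Δ₃ (S.γ t) ≤ LinearMap.ker (S.lam t).toLinearMap := by
    refine sup_le (fun u hu => h1 u hu) (Submodule.span_le.2 ?_)
    rintro u (rfl | rfl)
    · exact h.brk_X₁_bracket ht
    · exact h2
  exact fun u hu => h3 hu

theorem symp_euler_liftAt_X₁ (h : IsRegularCurve S D) (hs : s ∈ Icc (0 : ℝ) 1) :
    symp m (S.euler s) (liftAt S s S.X₁) = 0 := by
  rw [symp_euler, liftAt_fst (differentiableAt_hat_smooth h.smooth₁ _)]
  exact (h.covec_Δ₂ hs).1

theorem differentiableAt_hat_g (h : IsRegularCurve S D) (hs : s ∈ Icc (0 : ℝ) 1)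
    (ht : t ∈ Icc (0 : ℝ) 1) :
    DifferentiableAt ℝ (hat (S.γ s) (S.g s t)) (extChartAt (𝓡 m) (S.γ s) (S.γ s)) :=
  h.differentiableAt_hat_pull hs ht h.smooth₂

theorem symp_euler_liftAt_g (h : IsRegularCurve S D) (hs : s ∈ Icc (0 : ℝ) 1)
    (ht : t ∈ Icc (0 : ℝ) 1) : symp m (S.euler s) (liftAt S s (S.g s t)) = 0 := by
  rw [symp_euler, liftAt_fst (h.differentiableAt_hat_g hs ht)]
  exact (h.covec_pull hs ht S.X₂).trans (h.covec_Δ₂ ht).2.1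

theorem symp_euler_liftAt_gDot (h : IsRegularCurve S D) (hs : s ∈ Icc (0 : ℝ) 1)
    (ht : t ∈ Icc (0 : ℝ) 1) : symp m (S.euler s) (liftAt S s (S.gDot s t)) = 0 := by
  rw [h.liftAt_gDot hs ht, symp_euler, liftAt_fst
    (h.differentiableAt_hat_pull hs ht (h.smooth₁.mlieBracket h.smooth₂))]
  exact (h.covec_pull hs ht _).trans (h.covec_Δ₂ ht).2.2

/-- As `X₁` is its own pull-back near `γ(s)`, the product is the pairing of `λ(t)` with `[X₁, X₂]`
at `γ(t)`, an element of `Δ²`. -/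
theorem symp_liftAt_X₁_g (h : IsRegularCurve S D) (hs : s ∈ Icc (0 : ℝ) 1)
    (ht : t ∈ Icc (0 : ℝ) 1) :
    symp m (liftAt S s S.X₁) (liftAt S s (S.g s t)) = 0 := by
  have h1 : liftAt S s S.X₁ = liftAt S s (pull S s t S.X₁) :=
    (hamLift_congr (covec S s) (h.eventually_pull_X₁ hs ht)
      (differentiableAt_hat_smooth h.smooth₁ _)).symm
  rw [h1, ← brk_eq_symp (h.differentiableAt_hat_pull hs ht h.smooth₁)
    (h.differentiableAt_hat_g hs ht)]
  exact (h.brk_pull hs ht h.smooth₁ h.smooth₂).trans (h.covec_Δ₂ ht).2.2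

theorem symp_liftAt_gDot_g_ne_zero (h : IsRegularCurve S D) (hs : s ∈ Icc (0 : ℝ) 1)
    (ht : t ∈ Icc (0 : ℝ) 1) :
    symp m (liftAt S s (S.gDot s t)) (liftAt S s (S.g s t)) ≠ 0 := by
  have hb := h.smooth₁.mlieBracket h.smooth₂
  rw [h.liftAt_gDot hs ht, ← brk_eq_symp (h.differentiableAt_hat_pull hs ht hb)
    (h.differentiableAt_hat_g hs ht)]
  intro h0
  exact h.brk_bracket_X₂_ne_zero ht ((h.brk_pull hs ht hb h.smooth₂).symm.trans h0)

theorem linearIndependent_g (h : IsRegularCurve S D) (hs : s ∈ Icc (0 : ℝ) 1)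
    (ht : t ∈ Icc (0 : ℝ) 1) {a c : ℝ}
    (hac : a • (S.X₁ (S.γ s) : Mod m) + c • (S.g s t (S.γ s) : Mod m) = 0) : a = 0 ∧ c = 0 := by
  obtain ⟨e, he⟩ := h.inv_curve hs ht
  have h1 : (S.X₁ (S.γ s) : Mod m) = e.symm (S.X₁ (S.γ t) : Mod m) := by
    have := (h.eventually_pull_X₁ hs ht).self_of_nhds
    have h2 := h.pull_curve hs ht S.X₁
    rw [← he, ContinuousLinearMap.inverse_equiv] at h2
    exact this.symm.trans h2
  have h3 : (S.g s t (S.γ s) : Mod m) = e.symm (S.X₂ (S.γ t) : Mod m) := by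
    have h2 := h.pull_curve hs ht S.X₂
    rw [← he, ContinuousLinearMap.inverse_equiv] at h2
    exact h2
  have aux : ∀ u v : Mod m, a • e.symm u + c • e.symm v = 0 → a • u + c • v = 0 := by
    intro u v huv
    apply e.symm.injective
    rw [map_add, map_smul, map_smul, huv, map_zero]
  rw [h1, h3] at hac
  have h4 : a • (S.X₁ (S.γ t) : Mod m) + c • (S.X₂ (S.γ t) : Mod m) = 0 := aux _ _ hac
  exact LinearIndependent.pair_iff.1 (h.rank t ht) a c h4

end IsRegularCurve

end CurveLifts

/-! ### Fubini on a triangle. -/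

section Triangle

/-- Interchange of the order of integration over the triangle `0 ≤ τ ≤ t ≤ s`. -/
theorem integral_triangle_swap {s : ℝ} (hs : 0 ≤ s) {G : ℝ × ℝ → ℝ} (hG : Continuous G)
    {u v : ℝ → ℝ} (hu : IntegrableOn u (Ioc 0 s)) (hv : IntegrableOn v (Ioc 0 s)) :
    ∫ t in (0 : ℝ)..s, (∫ τ in (0 : ℝ)..t, u τ * G (τ, t)) * v t =
      ∫ τ in (0 : ℝ)..s, u τ * ∫ t in τ..s, G (τ, t) * v t := by
  set μ := volume.restrict (Ioc (0 : ℝ) s) with hμ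
  set A : Set (ℝ × ℝ) := {p | p.1 ≤ p.2} with hA
  have hAm : MeasurableSet A := measurableSet_le measurable_fst measurable_snd
  -- Extension by zero to the square. It is integrable because `G` is bounded on the compact square
  -- and `u`, `v` are integrable.
  set φ : ℝ × ℝ → ℝ := A.indicator fun p => G p * (u p.1 * v p.2) with hφ
  have hprod : Integrable (fun p : ℝ × ℝ => u p.1 * v p.2) (μ.prod μ) := hu.mul_prod hv
  obtain ⟨C, hC⟩ := (isCompact_Icc.prod isCompact_Icc :
    IsCompact (Icc (0 : ℝ) s ×ˢ Icc (0 : ℝ) s)).exists_bound_of_continuousOn hG.continuousOn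
  have hφi : Integrable φ (μ.prod μ) := by
    refine (Integrable.bdd_mul (c := C) hprod hG.aestronglyMeasurable ?_).indicator hAm
    rw [hμ, Measure.prod_restrict]
    refine ae_restrict_of_forall_mem (measurableSet_Ioc.prod measurableSet_Ioc) fun p hp => ?_
    exact hC p ⟨Ioc_subset_Icc_self hp.1, Ioc_subset_Icc_self hp.2⟩
  have hswap := integral_integral_swap (f := fun τ t => φ (τ, t)) hφi
  have h1 : ∫ τ, ∫ t, φ (τ, t) ∂μ ∂μ = ∫ τ in (0 : ℝ)..s, u τ * ∫ t in τ..s, G (τ, t) * v t := by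
    rw [intervalIntegral.integral_of_le hs]
    refine setIntegral_congr_fun measurableSet_Ioc fun τ hτ => ?_
    show ∫ t, φ (τ, t) ∂μ = u τ * ∫ t in τ..s, G (τ, t) * v t
    rw [intervalIntegral.integral_of_le hτ.2, ← integral_const_mul]
    have h2 : (fun t => φ (τ, t)) = (Ici τ).indicator fun t => u τ * (G (τ, t) * v t) := by
      funext t
      by_cases h : τ ≤ t
      · rw [hφ, indicator_of_mem (show (τ, t) ∈ A from h), indicator_of_mem (show t ∈ Ici τ from h)]
        ring
      · rw [hφ, indicator_of_notMem (show (τ, t) ∉ A from h),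
          indicator_of_notMem (show t ∉ Ici τ from h)]
    rw [h2, setIntegral_indicator measurableSet_Ici]
    have h3 : Ioc 0 s ∩ Ici τ = Icc τ s := by
      ext t
      simp only [mem_inter_iff, mem_Ioc, mem_Ici, mem_Icc]
      constructor
      · rintro ⟨⟨-, h⟩, h'⟩; exact ⟨h', h⟩
      · rintro ⟨h, h'⟩; exact ⟨⟨hτ.1.trans_le h, h'⟩, h⟩
    rw [h3, integral_Icc_eq_integral_Ioc]
  have h2 : ∫ t, ∫ τ, φ (τ, t) ∂μ ∂μ =
      ∫ t in (0 : ℝ)..s, (∫ τ in (0 : ℝ)..t, u τ * G (τ, t)) * v t := by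
    rw [intervalIntegral.integral_of_le hs]
    refine setIntegral_congr_fun measurableSet_Ioc fun t ht => ?_
    show ∫ τ, φ (τ, t) ∂μ = (∫ τ in (0 : ℝ)..t, u τ * G (τ, t)) * v t
    rw [intervalIntegral.integral_of_le ht.1.le, ← integral_mul_const]
    have h2 : (fun τ => φ (τ, t)) = (Iic t).indicator fun τ => u τ * G (τ, t) * v t := by
      funext τ
      by_cases h : τ ≤ t
      · rw [hφ, indicator_of_mem (show (τ, t) ∈ A from h), indicator_of_mem (show τ ∈ Iic t from h)]
        ring
      · rw [hφ, indicator_of_notMem (show (τ, t) ∉ A from h),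
          indicator_of_notMem (show τ ∉ Iic t from h)]
    rw [h2, setIntegral_indicator measurableSet_Iic, Ioc_inter_Iic, min_eq_right ht.2]
  rw [← h1, ← h2]
  exact hswap.symm

end Triangle

/-! ### The abstract Jacobi frame and primitives of controls. -/

/-- The linear data of the Jacobi equation: a presymplectic space `T` with an isotropic subspace
`ker pr`, a vector `ξ` and a curve `η` of vectors skew-orthogonal to `ξ`. -/
structure JacobiFrame (T E : Type*) [NormedAddCommGroup T] [NormedSpace ℝ T]
    [NormedAddCommGroup E] [NormedSpace ℝ E] (s : ℝ) where
  om : T →L[ℝ] T →L[ℝ] ℝ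
  pr : T →L[ℝ] E
  ξ : T
  η : ℝ → T
  η' : ℝ → T
  pos : 0 < s
  alt : ∀ x y, om x y = -om y x
  hasDerivAt_η : ∀ t, HasDerivAt η (η' t) t
  continuous_η' : Continuous η'
  om_ξ : ∀ t ∈ Icc (0 : ℝ) s, om ξ (η t) = 0
  l_ne : ∀ t ∈ Icc (0 : ℝ) s, om (η' t) (η t) ≠ 0
  isotropic : ∀ μ ν, pr μ = 0 → pr ν = 0 → om μ ν = 0
  exists_rep : ∀ p : E →ₗ[ℝ] ℝ, ∃ ν, pr ν = 0 ∧ ∀ x, om ν x = p (pr x)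
  indep : ∀ t ∈ Icc (0 : ℝ) s, ∀ a c : ℝ, pr (a • ξ + c • η t) = 0 → a = 0 ∧ c = 0

/-- The completed control space. -/
abbrev Control (s : ℝ) : Type :=
  Lp ℝ 2 (volume.restrict (Ioc (0 : ℝ) s)) × ℝ × Lp ℝ 2 (volume.restrict (Ioc (0 : ℝ) s))

namespace JacobiFrame

variable {T E : Type*} [NormedAddCommGroup T] [NormedSpace ℝ T] [CompleteSpace T]
  [NormedAddCommGroup E] [NormedSpace ℝ E] {s : ℝ} (J : JacobiFrame T E s)

include J in
theorem nonneg : 0 ≤ s := J.pos.le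

theorem om_self (x : T) : J.om x x = 0 := by
  have := J.alt x x
  linarith

/-- The Legendre coefficient `l`. -/
def l (t : ℝ) : ℝ := J.om (J.η' t) (J.η t)

theorem continuous_η : Continuous J.η :=
  continuous_iff_continuousAt.2 fun t => (J.hasDerivAt_η t).continuousAt

theorem continuous_om {f g : ℝ → T} (hf : Continuous f) (hg : Continuous g) :
    Continuous fun t => J.om (f t) (g t) :=
  (J.om.continuous.comp hf).clm_apply hg

theorem continuous_l : Continuous J.l := J.continuous_om J.continuous_η' J.continuous_η

theorem om_ξ' {t : ℝ} (ht : t ∈ Icc (0 : ℝ) s) : J.om J.ξ (J.η' t) = 0 := by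
  have h1 := ((J.om J.ξ).hasFDerivAt.comp_hasDerivAt t (J.hasDerivAt_η t)).hasDerivWithinAt
    (s := Icc 0 s)
  have h2 : HasDerivWithinAt (J.om J.ξ ∘ J.η) 0 (Icc 0 s) t :=
    (hasDerivWithinAt_const t (Icc 0 s) (0 : ℝ)).congr J.om_ξ (J.om_ξ t ht)
  exact (uniqueDiffOn_Icc J.pos t ht).eq_deriv _ h1 h2

theorem integrableOn_control (w : Lp ℝ 2 (volume.restrict (Ioc (0 : ℝ) s))) :
    IntegrableOn w (Ioc 0 s) :=
  (Lp.memLp w).integrable (by norm_num)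

theorem integrableOn_smul {F : Type*} [NormedAddCommGroup F] [NormedSpace ℝ F] {w : ℝ → ℝ}
    (hw : IntegrableOn w (Ioc 0 s)) {f : ℝ → F} (hf : Continuous f) :
    IntegrableOn (fun t => w t • f t) (Ioc 0 s) := by
  rw [← integrableOn_Icc_iff_integrableOn_Ioc] at hw ⊢
  obtain ⟨C, hC⟩ := isCompact_Icc.exists_bound_of_continuousOn (hf.continuousOn (s := Icc 0 s))
  exact Integrable.smul_bdd hw C hf.aestronglyMeasurable
    (ae_restrict_of_forall_mem measurableSet_Icc hC)

/-- `W(t) = ∫₀ᵗ w(τ) η'(τ) dτ`. -/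
def W (w : ℝ → ℝ) (t : ℝ) : T := ∫ τ in (0 : ℝ)..t, w τ • J.η' τ

variable {J} {w w' : ℝ → ℝ} {t : ℝ}

theorem intervalIntegrable_smul (hw : IntegrableOn w (Ioc 0 s)) {F : Type*} [NormedAddCommGroup F]
    [NormedSpace ℝ F] {f : ℝ → F} (hf : Continuous f) (ht : t ∈ Icc (0 : ℝ) s) :
    IntervalIntegrable (fun t => w t • f t) volume 0 t := by
  rw [intervalIntegrable_iff_integrableOn_Ioc_of_le ht.1]
  exact (integrableOn_smul hw hf).mono_set (Ioc_subset_Ioc_right ht.2)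

theorem map_W {F : Type*} [NormedAddCommGroup F] [NormedSpace ℝ F] [CompleteSpace F]
    (φ : T →L[ℝ] F) (hw : IntegrableOn w (Ioc 0 s)) (ht : t ∈ Icc (0 : ℝ) s) :
    φ (J.W w t) = ∫ τ in (0 : ℝ)..t, w τ • φ (J.η' τ) := by
  unfold W
  rw [← φ.intervalIntegral_comp_comm (intervalIntegrable_smul hw J.continuous_η' ht)]
  simp

theorem om_W_left (hw : IntegrableOn w (Ioc 0 s)) (ht : t ∈ Icc (0 : ℝ) s) (y : T) :
    J.om (J.W w t) y = ∫ τ in (0 : ℝ)..t, w τ * J.om (J.η' τ) y := by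
  have := map_W (J := J) (J.om.flip y) hw ht
  simpa using this

theorem om_W_right (hw : IntegrableOn w (Ioc 0 s)) (ht : t ∈ Icc (0 : ℝ) s) (y : T) :
    J.om y (J.W w t) = ∫ τ in (0 : ℝ)..t, w τ * J.om y (J.η' τ) := by
  have := map_W (J := J) (J.om y) hw ht
  simpa using this

theorem om_ξ_W (hw : IntegrableOn w (Ioc 0 s)) (ht : t ∈ Icc (0 : ℝ) s) :
    J.om J.ξ (J.W w t) = 0 := by
  rw [om_W_right hw ht]
  refine intervalIntegral.integral_zero_ae ?_
  refine Filter.Eventually.of_forall fun τ hτ => ?_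
  rw [uIoc_of_le ht.1] at hτ
  rw [J.om_ξ' ⟨hτ.1.le, hτ.2.trans ht.2⟩, mul_zero]

theorem continuousOn_W (hw : IntegrableOn w (Ioc 0 s)) : ContinuousOn (J.W w) (Icc 0 s) := by
  have h1 : IntegrableOn (fun t => w t • J.η' t) (uIcc 0 s) := by
    rw [uIcc_of_le J.nonneg, integrableOn_Icc_iff_integrableOn_Ioc]
    exact integrableOn_smul hw J.continuous_η'
  have := intervalIntegral.continuousOn_primitive_interval h1
  rwa [uIcc_of_le J.nonneg] at this

/-- Shifts the primitive from `w` to `w'`. This is what lets the polar form of the Hessian be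
written as a pairing with the variation itself. -/
theorem integral_om_W_swap (hw : IntegrableOn w (Ioc 0 s)) (hw' : IntegrableOn w' (Ioc 0 s)) :
    ∫ t in (0 : ℝ)..s, J.om (J.W w t) (J.η' t) * w' t =
      ∫ τ in (0 : ℝ)..s, w τ * J.om (J.η' τ) (J.W w' s - J.W w' τ) := by
  have hs : s ∈ Icc 0 s := right_mem_Icc.2 J.nonneg
  have hG : Continuous fun p : ℝ × ℝ => J.om (J.η' p.1) (J.η' p.2) :=
    (J.om.continuous.comp (J.continuous_η'.comp continuous_fst)).clm_apply
      (J.continuous_η'.comp continuous_snd)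
  have h := integral_triangle_swap J.nonneg hG hw hw'
  refine Eq.trans ?_ (h.trans ?_)
  · refine intervalIntegral.integral_congr fun t ht => ?_
    rw [uIcc_of_le J.nonneg] at ht
    simp only
    rw [om_W_left hw ht]
  · refine intervalIntegral.integral_congr fun τ hτ => ?_
    rw [uIcc_of_le J.nonneg] at hτ
    simp only
    rw [map_sub, om_W_right hw' hs, om_W_right hw' hτ,
      intervalIntegral.integral_interval_sub_left]
    · congr 1
      exact intervalIntegral.integral_congr fun t _ => mul_comm _ _
    · simpa using intervalIntegrable_smul hw'
        (J.continuous_om (continuous_const (y := J.η' τ)) J.continuous_η') hs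
    · simpa using intervalIntegrable_smul hw'
        (J.continuous_om (continuous_const (y := J.η' τ)) J.continuous_η') hτ

theorem W_congr (h : w =ᵐ[volume.restrict (Ioc 0 s)] w') (ht : t ∈ Icc (0 : ℝ) s) :
    J.W w t = J.W w' t := by
  unfold W
  rw [intervalIntegral.integral_of_le ht.1, intervalIntegral.integral_of_le ht.1]
  refine integral_congr_ae ?_
  filter_upwards [ae_mono (Measure.restrict_mono (Ioc_subset_Ioc_right ht.2) le_rfl) h] with τ hτ
  rw [hτ]

theorem W_const (c : ℝ) : J.W (fun _ => c) t = c • (J.η t - J.η 0) := by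
  unfold W
  rw [intervalIntegral.integral_smul, intervalIntegral.integral_eq_sub_of_hasDerivAt
    (fun t _ => J.hasDerivAt_η t) (J.continuous_η'.intervalIntegrable 0 t)]

theorem hasDerivWithinAt_W (hw : ContinuousOn w (Icc 0 s)) (ht : t ∈ Icc (0 : ℝ) s) :
    HasDerivWithinAt (J.W w) (w t • J.η' t) (Icc 0 s) t := by
  have hc : ContinuousOn (fun t => w t • J.η' t) (Icc 0 s) :=
    hw.smul J.continuous_η'.continuousOn
  have : Fact (t ∈ Icc (0 : ℝ) s) := ⟨ht⟩
  exact intervalIntegral.integral_hasDerivWithinAt_right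
    (by
      rw [intervalIntegrable_iff_integrableOn_Ioc_of_le ht.1]
      exact (hc.integrableOn_Icc.mono_set Ioc_subset_Icc_self).mono_set
        (Ioc_subset_Ioc_right ht.2))
    (hc.stronglyMeasurableAtFilter_nhdsWithin measurableSet_Icc t) (hc t ht)

theorem W_zero : J.W w 0 = 0 := intervalIntegral.integral_same

end JacobiFrame

/-! ### The Hessian, its polar form, and Lagrange multipliers. -/

namespace JacobiFrame

variable {T E : Type*} [NormedAddCommGroup T] [NormedSpace ℝ T] [CompleteSpace T]
  [NormedAddCommGroup E] [NormedSpace ℝ E] {s : ℝ} {J : JacobiFrame T E s}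

theorem W_add {w w' : ℝ → ℝ} {t : ℝ} (hw : IntegrableOn w (Ioc 0 s))
    (hw' : IntegrableOn w' (Ioc 0 s)) (ht : t ∈ Icc (0 : ℝ) s) :
    J.W (w + w') t = J.W w t + J.W w' t := by
  unfold W
  rw [← intervalIntegral.integral_add (intervalIntegrable_smul hw J.continuous_η' ht)
    (intervalIntegrable_smul hw' J.continuous_η' ht)]
  simp [add_smul]

theorem W_coe_add (w w' : Lp ℝ 2 (volume.restrict (Ioc (0 : ℝ) s))) {t : ℝ}
    (ht : t ∈ Icc (0 : ℝ) s) : J.W (w + w' : Lp ℝ 2 (volume.restrict (Ioc (0 : ℝ) s))) t =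
      J.W w t + J.W w' t :=
  (W_congr (Lp.coeFn_add w w') ht).trans
    (W_add (integrableOn_control w) (integrableOn_control w') ht)

variable (J) in
/-- The value at time `s` of the primitive `W`, as a linear map. -/
def WL : Lp ℝ 2 (volume.restrict (Ioc (0 : ℝ) s)) →ₗ[ℝ] T where
  toFun w := J.W w s
  map_add' w w' := W_coe_add w w' (right_mem_Icc.2 J.nonneg)
  map_smul' c w := by
    refine (W_congr (Lp.coeFn_smul c w) (right_mem_Icc.2 J.nonneg)).trans ?_
    unfold W
    rw [RingHom.id_apply, ← intervalIntegral.integral_smul]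
    simp [mul_smul]

variable (s) in
/-- Integration over `[0,s]` as a linear functional. -/
def intL (hs : 0 ≤ s) : Lp ℝ 2 (volume.restrict (Ioc (0 : ℝ) s)) →ₗ[ℝ] ℝ where
  toFun w := ∫ t in (0 : ℝ)..s, w t
  map_add' w w' := by
    simp only [intervalIntegral.integral_of_le hs]
    rw [integral_congr_ae (Lp.coeFn_add w w')]
    exact integral_add (integrableOn_control w) (integrableOn_control w')
  map_smul' c w := by
    simp only [intervalIntegral.integral_of_le hs]
    rw [integral_congr_ae (Lp.coeFn_smul c w)]
    exact integral_smul c _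

variable (J) in
/-- The lift to `T` of the differential of the endpoint map. -/
def endL : Control s →ₗ[ℝ] T :=
  ((LinearMap.toSpanSingleton ℝ T J.ξ) ∘ₗ (intL s J.nonneg) ∘ₗ LinearMap.fst ℝ _ _) +
    ((LinearMap.toSpanSingleton ℝ T (J.η s)) ∘ₗ LinearMap.fst ℝ _ _ ∘ₗ LinearMap.snd ℝ _ _) -
    J.WL ∘ₗ LinearMap.snd ℝ _ _ ∘ₗ LinearMap.snd ℝ _ _

theorem endL_apply (x : Control s) :
    J.endL x = (∫ t in (0 : ℝ)..s, x.1 t) • J.ξ + x.2.1 • J.η s - J.W x.2.2 s := rfl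

theorem endL_mk_zero (v : Lp ℝ 2 (volume.restrict (Ioc (0 : ℝ) s))) (c : ℝ) :
    J.endL (v, c, 0) = (∫ t in (0 : ℝ)..s, v t) • J.ξ + c • J.η s :=
  (congrArg (fun z => (∫ t in (0 : ℝ)..s, v t) • J.ξ + c • J.η s - z) J.WL.map_zero).trans
    (sub_zero _)

theorem integral_zero_control (hs : 0 ≤ s) :
    ∫ t in (0 : ℝ)..s, (0 : Lp ℝ 2 (volume.restrict (Ioc (0 : ℝ) s))) t = 0 :=
  (intL s hs).map_zero

theorem endL_zero_mk (c : ℝ) (w : Lp ℝ 2 (volume.restrict (Ioc (0 : ℝ) s))) :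
    J.endL (0, c, w) = c • J.η s - J.W w s := by
  have h : J.endL (0, c, w) = _ := endL_apply _
  rw [h]
  simp only [integral_zero_control J.nonneg, zero_smul, zero_add]

theorem memLp_of_continuousOn {f : ℝ → ℝ} (hf : ContinuousOn f (Icc 0 s)) :
    MemLp f 2 (volume.restrict (Ioc (0 : ℝ) s)) := by
  obtain ⟨C, hC⟩ := isCompact_Icc.exists_bound_of_continuousOn hf
  exact MemLp.of_bound ((hf.mono Ioc_subset_Icc_self).aestronglyMeasurable measurableSet_Ioc) C
    (ae_restrict_of_forall_mem measurableSet_Ioc fun t ht => hC t (Ioc_subset_Icc_self ht))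

theorem memLp_mul {f w : ℝ → ℝ} (hf : ContinuousOn f (Icc 0 s))
    (hw : MemLp w 2 (volume.restrict (Ioc (0 : ℝ) s))) :
    MemLp (fun t => f t * w t) 2 (volume.restrict (Ioc (0 : ℝ) s)) := by
  obtain ⟨C, hC⟩ := isCompact_Icc.exists_bound_of_continuousOn hf
  refine MemLp.of_le_mul (c := C) hw
    (((hf.mono Ioc_subset_Icc_self).aestronglyMeasurable measurableSet_Ioc).mul
      hw.aestronglyMeasurable)
    (ae_restrict_of_forall_mem measurableSet_Ioc fun t ht => ?_)
  rw [norm_mul]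
  exact mul_le_mul_of_nonneg_right (hC t (Ioc_subset_Icc_self ht)) (norm_nonneg _)

variable (J) in
/-- The Hessian, in the notation of the frame. -/
def hess (x : Control s) : ℝ :=
  (∫ t in (0 : ℝ)..s, J.l t * x.2.2 t ^ 2) +
  ∫ t in (0 : ℝ)..s, (x.2.1 * J.om (J.η s) (J.η' t) +
    ∫ τ in (0 : ℝ)..t, x.2.2 τ * J.om (J.η' τ) (J.η' t)) * x.2.2 t

variable (J) in
/-- The density of the Hessian. -/
def dens (x : Control s) (t : ℝ) : ℝ :=
  J.l t * x.2.2 t + J.om (x.2.1 • J.η s + J.W x.2.2 t) (J.η' t)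

theorem continuousOn_om {f g : ℝ → T} {S : Set ℝ} (hf : ContinuousOn f S)
    (hg : ContinuousOn g S) : ContinuousOn (fun t => J.om (f t) (g t)) S :=
  (J.om.continuous.comp_continuousOn hf).clm_apply hg

theorem memLp_dens (x : Control s) : MemLp (J.dens x) 2 (volume.restrict (Ioc (0 : ℝ) s)) :=
  (memLp_mul J.continuous_l.continuousOn (Lp.memLp x.2.2)).add
    (memLp_of_continuousOn (continuousOn_om
      (continuousOn_const.add (continuousOn_W (integrableOn_control x.2.2)))
      J.continuous_η'.continuousOn))

theorem dens_add (x y : Control s) :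
    J.dens (x + y) =ᵐ[volume.restrict (Ioc (0 : ℝ) s)] J.dens x + J.dens y := by
  filter_upwards [Lp.coeFn_add x.2.2 y.2.2, ae_restrict_mem measurableSet_Ioc] with t h1 ht
  have h2 : J.W (x + y).2.2 t = J.W x.2.2 t + J.W y.2.2 t :=
    W_coe_add x.2.2 y.2.2 (Ioc_subset_Icc_self ht)
  have h3 : (x + y).2.2 t = x.2.2 t + y.2.2 t := h1
  have h4 : (x + y).2.1 = x.2.1 + y.2.1 := rfl
  simp only [Pi.add_apply, dens, h2, h3, h4, map_add, add_smul, add_apply]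
  ring

theorem integrable_mul {f g : ℝ → ℝ} (hf : MemLp f 2 (volume.restrict (Ioc (0 : ℝ) s)))
    (hg : MemLp g 2 (volume.restrict (Ioc (0 : ℝ) s))) :
    Integrable (fun t => f t * g t) (volume.restrict (Ioc (0 : ℝ) s)) :=
  hf.integrable_mul hg

theorem hess_eq (x : Control s) :
    J.hess x = ∫ t in Ioc (0 : ℝ) s, J.dens x t * x.2.2 t := by
  have hw := integrableOn_control x.2.2
  have h1 : Integrable (fun t => (J.l t * x.2.2 t) * x.2.2 t)
      (volume.restrict (Ioc (0 : ℝ) s)) :=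
    integrable_mul (memLp_mul J.continuous_l.continuousOn (Lp.memLp x.2.2)) (Lp.memLp x.2.2)
  have h2 : Integrable (fun t => J.om (x.2.1 • J.η s + J.W x.2.2 t) (J.η' t) * x.2.2 t)
      (volume.restrict (Ioc (0 : ℝ) s)) :=
    integrable_mul (memLp_of_continuousOn (continuousOn_om
      (continuousOn_const.add (continuousOn_W hw)) J.continuous_η'.continuousOn)) (Lp.memLp x.2.2)
  unfold hess dens
  simp only [add_mul (J.l _ * _)]
  rw [integral_add h1 h2, intervalIntegral.integral_of_le J.nonneg,
    intervalIntegral.integral_of_le J.nonneg]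
  congr 1
  · exact integral_congr_ae (Filter.Eventually.of_forall fun t => by ring)
  · refine setIntegral_congr_fun measurableSet_Ioc fun t ht => ?_
    simp only [map_add, map_smul, add_apply, smul_apply,
      smul_eq_mul]
    rw [om_W_left hw (Ioc_subset_Icc_self ht)]

theorem polar_hess (x y : Control s) :
    QuadraticMap.polar J.hess x y = (∫ t in Ioc (0 : ℝ) s, J.dens x t * y.2.2 t) +
      ∫ t in Ioc (0 : ℝ) s, J.dens y t * x.2.2 t := by
  unfold QuadraticMap.polar
  rw [hess_eq, hess_eq, hess_eq]
  have h1 : ∫ t in Ioc (0 : ℝ) s, J.dens (x + y) t * (x + y).2.2 t =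
      ∫ t in Ioc (0 : ℝ) s, (J.dens x t * x.2.2 t + J.dens x t * y.2.2 t) +
        (J.dens y t * x.2.2 t + J.dens y t * y.2.2 t) := by
    refine integral_congr_ae ?_
    filter_upwards [dens_add (J := J) x y, Lp.coeFn_add x.2.2 y.2.2] with t h1 h2
    have h3 : (x + y).2.2 t = x.2.2 t + y.2.2 t := h2
    rw [h1, h3, Pi.add_apply]
    ring
  have hi : ∀ a b : Control s, Integrable (fun t => J.dens a t * b.2.2 t)
      (volume.restrict (Ioc (0 : ℝ) s)) := fun a b =>
    integrable_mul (memLp_dens a) (Lp.memLp b.2.2)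
  have h2 : ∀ a b c : Control s, Integrable (fun t => J.dens a t * b.2.2 t + J.dens a t * c.2.2 t)
      (volume.restrict (Ioc (0 : ℝ) s)) := fun a b c => (hi a b).add (hi a c)
  rw [h1, integral_add (h2 x x y) (h2 y x y), integral_add (hi x x) (hi x y), integral_add (hi y x) (hi y y)]
  ring

variable (J) in
/-- The gradient of the Hessian with respect to `w`. -/
def grad (x : Control s) (t : ℝ) : ℝ :=
  2 * (J.l t * x.2.2 t) +
    J.om (x.2.1 • J.η s + (2 : ℝ) • J.W x.2.2 t - J.W x.2.2 s) (J.η' t)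

theorem memLp_grad (x : Control s) : MemLp (J.grad x) 2 (volume.restrict (Ioc (0 : ℝ) s)) :=
  ((memLp_mul J.continuous_l.continuousOn (Lp.memLp x.2.2)).const_mul 2).add
    (memLp_of_continuousOn (continuousOn_om
      ((continuousOn_const.add ((continuousOn_W (integrableOn_control x.2.2)).const_smul
        (2 : ℝ))).sub continuousOn_const)
      J.continuous_η'.continuousOn))

/-- The terms that contain the primitive of `y.2.2` are rewritten by the triangle swap, so `y`
enters only through an L² pairing with `grad x` and a boundary term in `y.2.1`. -/
theorem polar_hess_eq (x y : Control s) :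
    QuadraticMap.polar J.hess x y = (∫ t in Ioc (0 : ℝ) s, J.grad x t * y.2.2 t) +
      y.2.1 * J.om (J.η s) (J.W x.2.2 s) := by
  have hs : s ∈ Icc 0 s := right_mem_Icc.2 J.nonneg
  have hw := integrableOn_control x.2.2
  have hw' := integrableOn_control y.2.2
  have hswap := integral_om_W_swap (J := J) hw' hw
  rw [intervalIntegral.integral_of_le J.nonneg, intervalIntegral.integral_of_le J.nonneg] at hswap
  have hr := om_W_right (J := J) hw hs (J.η s)
  rw [intervalIntegral.integral_of_le J.nonneg] at hr
  have i1 : Integrable (fun t => J.l t * y.2.2 t * x.2.2 t)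
      (volume.restrict (Ioc (0 : ℝ) s)) :=
    integrable_mul (memLp_mul J.continuous_l.continuousOn (Lp.memLp y.2.2)) (Lp.memLp x.2.2)
  have i2 : Integrable (fun t => y.2.1 * (x.2.2 t * J.om (J.η s) (J.η' t)))
      (volume.restrict (Ioc (0 : ℝ) s)) :=
    (integrableOn_smul hw (J.continuous_om continuous_const J.continuous_η')).const_mul _
  have i3 : Integrable (fun t => J.om (J.W y.2.2 t) (J.η' t) * x.2.2 t)
      (volume.restrict (Ioc (0 : ℝ) s)) :=
    integrable_mul (memLp_of_continuousOn (continuousOn_om (continuousOn_W hw')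
      J.continuous_η'.continuousOn)) (Lp.memLp x.2.2)
  have i4 : Integrable (fun t => y.2.2 t * J.om (J.η' t) (J.W x.2.2 s - J.W x.2.2 t))
      (volume.restrict (Ioc (0 : ℝ) s)) :=
    integrable_mul (Lp.memLp y.2.2) (memLp_of_continuousOn (continuousOn_om
      J.continuous_η'.continuousOn (continuousOn_const.sub (continuousOn_W hw))))
  have i12 : Integrable (fun t => J.l t * y.2.2 t * x.2.2 t +
      y.2.1 * (x.2.2 t * J.om (J.η s) (J.η' t))) (volume.restrict (Ioc (0 : ℝ) s)) := i1.add i2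
  have e1 : ∫ t in Ioc (0 : ℝ) s, J.dens y t * x.2.2 t =
      (∫ t in Ioc (0 : ℝ) s, J.l t * y.2.2 t * x.2.2 t) + y.2.1 * J.om (J.η s) (J.W x.2.2 s) +
        ∫ t in Ioc (0 : ℝ) s, y.2.2 t * J.om (J.η' t) (J.W x.2.2 s - J.W x.2.2 t) := by
    rw [hr, ← hswap, ← integral_const_mul, ← integral_add i1 i2, ← integral_add i12 i3]
    refine integral_congr_ae (Filter.Eventually.of_forall fun t => ?_)
    simp only [dens, map_add, map_smul, add_apply,
      smul_apply, smul_eq_mul]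
    ring
  have i5 : Integrable (fun t => J.dens x t * y.2.2 t) (volume.restrict (Ioc (0 : ℝ) s)) :=
    integrable_mul (memLp_dens x) (Lp.memLp y.2.2)
  have i51 : Integrable (fun t => J.dens x t * y.2.2 t + J.l t * y.2.2 t * x.2.2 t)
      (volume.restrict (Ioc (0 : ℝ) s)) := i5.add i1
  have e2 : ∫ t in Ioc (0 : ℝ) s, J.grad x t * y.2.2 t =
      (∫ t in Ioc (0 : ℝ) s, J.dens x t * y.2.2 t) +
      (∫ t in Ioc (0 : ℝ) s, J.l t * y.2.2 t * x.2.2 t) +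
      ∫ t in Ioc (0 : ℝ) s, y.2.2 t * J.om (J.η' t) (J.W x.2.2 s - J.W x.2.2 t) := by
    rw [← integral_add i5 i1, ← integral_add i51 i4]
    refine integral_congr_ae (Filter.Eventually.of_forall fun t => ?_)
    simp only [grad, dens, J.alt (J.η' t), map_add, map_sub, map_smul,
      add_apply, sub_apply,
      smul_apply, smul_eq_mul]
    ring
  rw [polar_hess, e1, e2]
  ring

theorem polar_hess_mk_zero (x : Control s) (v : Lp ℝ 2 (volume.restrict (Ioc (0 : ℝ) s)))
    (c : ℝ) : QuadraticMap.polar J.hess x (v, c, 0) = c * J.om (J.η s) (J.W x.2.2 s) := by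
  rw [polar_hess_eq]
  refine add_eq_right.2 ?_
  refine integral_eq_zero_of_ae ?_
  filter_upwards [Lp.coeFn_zero ℝ 2 (volume.restrict (Ioc (0 : ℝ) s))] with t ht
  exact mul_eq_zero_of_right _ ht

variable (J) in
/-- The kernel of the differential, with a constraint on the mean of `v`. -/
def ker (A : Submodule ℝ ℝ) : Set (Control s) :=
  {x | J.pr (J.endL x) = 0 ∧ ∫ t in (0 : ℝ)..s, x.1 t ∈ A}

variable (J) in
/-- The kernel of the Hessian on `ker A`. -/
def hessKer (A : Submodule ℝ ℝ) : Set (Control s) :=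
  {x | x ∈ J.ker A ∧ ∀ y ∈ J.ker A, QuadraticMap.polar J.hess x y = 0}

theorem om_ξ_endL (x : Control s) : J.om J.ξ (J.endL x) = 0 := by
  have hs : s ∈ Icc 0 s := right_mem_Icc.2 J.nonneg
  rw [endL_apply, map_sub, map_add, map_smul, map_smul, J.om_self, J.om_ξ s hs,
    om_ξ_W (integrableOn_control x.2.2) hs]
  simp

/-- The multiplier rule is purely algebraic here: a functional that vanishes on the kernel of a
linear map factors through the map, and a functional on `E` is represented by a vector of `ker pr`.
No topology on the controls is involved. -/
theorem exists_multiplier {A : Submodule ℝ ℝ} {x : Control s}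
    (hx : ∀ y ∈ J.ker A, QuadraticMap.polar J.hess x y = 0) :
    ∃ ν, J.pr ν = 0 ∧ ∀ y : Control s, ∫ t in (0 : ℝ)..s, y.1 t ∈ A →
      J.om ν (J.endL y) = QuadraticMap.polar J.hess x y := by
  set U : Submodule ℝ (Control s) :=
    A.comap ((intL s J.nonneg) ∘ₗ LinearMap.fst ℝ _ _) with hU
  set ℓ : Control s →ₗ[ℝ] ℝ :=
    { toFun := fun y => QuadraticMap.polar J.hess x y
      map_add' := fun y z => by
        simp only [polar_hess_eq]
        have : ∫ t in Ioc (0 : ℝ) s, J.grad x t * (y + z).2.2 t =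
            ∫ t in Ioc (0 : ℝ) s, (J.grad x t * y.2.2 t + J.grad x t * z.2.2 t) := by
          refine integral_congr_ae ?_
          filter_upwards [Lp.coeFn_add y.2.2 z.2.2] with t h2
          have h3 : (y + z).2.2 t = y.2.2 t + z.2.2 t := h2
          rw [h3, mul_add]
        rw [this, integral_add (integrable_mul (memLp_grad x) (Lp.memLp y.2.2))
          (integrable_mul (memLp_grad x) (Lp.memLp z.2.2))]
        have : (y + z).2.1 = y.2.1 + z.2.1 := rfl
        rw [this]
        ring
      map_smul' := fun c y => by
        simp only [polar_hess_eq]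
        have : ∫ t in Ioc (0 : ℝ) s, J.grad x t * (c • y).2.2 t =
            ∫ t in Ioc (0 : ℝ) s, c * (J.grad x t * y.2.2 t) := by
          refine integral_congr_ae ?_
          filter_upwards [Lp.coeFn_smul c y.2.2] with t h2
          have h3 : (c • y).2.2 t = c * y.2.2 t := h2
          rw [h3]
          ring
        rw [this, integral_const_mul]
        have : (c • y).2.1 = c * y.2.1 := rfl
        rw [this, RingHom.id_apply, smul_eq_mul]
        ring } with hℓ
  have h1 : ℓ ∘ₗ U.subtype ∈ (LinearMap.ker ((J.pr : T →ₗ[ℝ] E) ∘ₗ J.endL ∘ₗ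
      U.subtype)).dualAnnihilator := by
    rw [Submodule.mem_dualAnnihilator]
    exact fun y hy => hx y.1 ⟨hy, y.2⟩
  rw [← LinearMap.range_dualMap_eq_dualAnnihilator_ker] at h1
  obtain ⟨p, hp⟩ := h1
  obtain ⟨ν, hν, hνp⟩ := J.exists_rep p
  refine ⟨ν, hν, fun y hy => ?_⟩
  rw [hνp]
  exact LinearMap.congr_fun hp ⟨y, hy⟩

theorem ae_eq_zero_of_integral_mul {f : ℝ → ℝ}
    (hf : MemLp f 2 (volume.restrict (Ioc (0 : ℝ) s)))
    (h : ∀ u : Lp ℝ 2 (volume.restrict (Ioc (0 : ℝ) s)), ∫ t in Ioc (0 : ℝ) s, f t * u t = 0) :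
    f =ᵐ[volume.restrict (Ioc (0 : ℝ) s)] 0 := by
  have h1 := h (hf.toLp f)
  have h2 : ∫ t in Ioc (0 : ℝ) s, f t * f t = 0 := by
    refine Eq.trans (integral_congr_ae ?_) h1
    filter_upwards [hf.coeFn_toLp] with t ht
    rw [ht]
  rw [integral_eq_zero_iff_of_nonneg (fun t => mul_self_nonneg (f t)) (integrable_mul hf hf)] at h2
  filter_upwards [h2] with t ht
  exact mul_self_eq_zero.1 ht

theorem grad_eq (x : Control s) {t : ℝ} (ht : t ∈ Icc 0 s) :
    J.grad x t = 2 * (J.l t * x.2.2 t) - J.om (J.η' t) ((2 : ℝ) • J.W x.2.2 t + J.endL x) := by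
  have h1 : J.om (J.endL x) (J.η' t) = J.om (x.2.1 • J.η s - J.W x.2.2 s) (J.η' t) := by
    rw [endL_apply, add_sub_assoc, map_add, map_smul, add_apply,
      smul_apply, J.om_ξ' ht, smul_zero, zero_add]
  rw [J.alt (J.η' t), map_add, add_apply, h1, grad]
  simp only [map_add, map_sub, map_smul, add_apply,
    sub_apply, smul_apply, smul_eq_mul]
  ring

theorem om_W_endL (x : Control s) : J.om (J.η s) (J.W x.2.2 s) = J.om (J.endL x) (J.η s) := by
  rw [J.alt (J.endL x), endL_apply, map_sub, map_add, map_smul, map_smul, J.om_self,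
    J.alt (J.η s) J.ξ, J.om_ξ s (right_mem_Icc.2 J.nonneg)]
  simp

/-- The kernel of the Hessian in terms of Lagrange multipliers. -/
theorem mem_hessKer_iff {A : Submodule ℝ ℝ} {x : Control s} :
    x ∈ J.hessKer A ↔ ∫ t in (0 : ℝ)..s, x.1 t ∈ A ∧ J.pr (J.endL x) = 0 ∧ ∃ κ, J.pr κ = 0 ∧
      (∀ a ∈ A, a * J.om κ J.ξ = 0) ∧ J.om (κ - J.endL x) (J.η s) = 0 ∧
      ∀ᵐ t ∂(volume.restrict (Ioc (0 : ℝ) s)),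
        J.l t * x.2.2 t = J.om (J.η' t) (κ + J.W x.2.2 t) := by
  have hs : s ∈ Icc 0 s := right_mem_Icc.2 J.nonneg
  constructor
  · rintro ⟨⟨h1, h2⟩, h3⟩
    obtain ⟨ν, hν, hνy⟩ := exists_multiplier h3
    -- The polar form is written without a factor `1/2`, and `grad` contains `2 W + endL x`; halving
    -- `ν + endL x` gives `l w = ω(η', κ + W)`. The three conditions come from testing with
    -- variations of `v`, of `c` and of `w` separately.
    refine ⟨h2, h1, (2⁻¹ : ℝ) • (ν + J.endL x), by simp [hν, h1], fun a ha => ?_, ?_, ?_⟩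
    -- A constant control with integral `a`.
    · have hm : MemLp (fun _ : ℝ => a / s) 2 (volume.restrict (Ioc (0 : ℝ) s)) := memLp_const _
      have hi : ∫ t in (0 : ℝ)..s, (hm.toLp _ : ℝ → ℝ) t = a := by
        rw [intervalIntegral.integral_of_le J.nonneg, integral_congr_ae hm.coeFn_toLp]
        simp [J.nonneg, mul_div_cancel₀ _ J.pos.ne']
      have h4 := hνy (hm.toLp _, 0, 0) (by rw [hi]; exact ha)
      have h5 : J.endL (hm.toLp _, 0, 0) = a • J.ξ := by
        rw [endL_mk_zero, hi, zero_smul, add_zero]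
      have h6 : QuadraticMap.polar J.hess x (hm.toLp _, 0, 0) = 0 := by
        rw [polar_hess_mk_zero, zero_mul]
      rw [h5, h6, map_smul, smul_eq_mul] at h4
      have h7 := om_ξ_endL (J := J) x
      rw [J.alt] at h7
      rw [map_smul, map_add, smul_apply, add_apply,
        smul_eq_mul]
      linear_combination (2⁻¹ : ℝ) * h4 - (2⁻¹ : ℝ) * a * h7
    · have h4 := hνy (0, 1, 0) (by rw [integral_zero_control J.nonneg]; exact A.zero_mem)
      have h5 : J.endL (0, 1, 0) = J.η s := by
        rw [endL_mk_zero, integral_zero_control J.nonneg, zero_smul, zero_add, one_smul]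
      have h6 : QuadraticMap.polar J.hess x (0, 1, 0) = J.om (J.η s) (J.W x.2.2 s) := by
        rw [polar_hess_mk_zero, one_mul]
      rw [h5, h6, om_W_endL] at h4
      simp only [map_smul, map_add, map_sub, smul_apply,
        add_apply, sub_apply, smul_eq_mul]
      linear_combination (2⁻¹ : ℝ) * h4
    · have hcont : ContinuousOn (fun t => J.om ν (J.η' t)) (Icc 0 s) :=
        (J.continuous_om continuous_const J.continuous_η').continuousOn
      have h4 : (fun t => J.grad x t + J.om ν (J.η' t)) =ᵐ[volume.restrict (Ioc (0 : ℝ) s)] 0 := by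
        refine ae_eq_zero_of_integral_mul ((memLp_grad x).add (memLp_of_continuousOn hcont))
          fun u => ?_
        have h5 := hνy (0, 0, u) (by rw [integral_zero_control J.nonneg]; exact A.zero_mem)
        have h6 : J.endL (0, 0, u) = -J.W u s := by
          rw [endL_zero_mk, zero_smul, zero_sub]
        rw [polar_hess_eq, h6, zero_mul, add_zero, map_neg,
          om_W_right (integrableOn_control u) hs, intervalIntegral.integral_of_le J.nonneg] at h5
        have h7 : ∫ t in Ioc (0 : ℝ) s, (J.grad x t + J.om ν (J.η' t)) * u t =
            ∫ t in Ioc (0 : ℝ) s, (J.grad x t * u t + u t * J.om ν (J.η' t)) :=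
          integral_congr_ae (Filter.Eventually.of_forall fun t => by ring)
        rw [h7, integral_add (integrable_mul (memLp_grad x) (Lp.memLp u))
          (integrable_mul (Lp.memLp u) (memLp_of_continuousOn hcont)), ← h5]
        simp
      filter_upwards [h4, ae_restrict_mem measurableSet_Ioc] with t h5 ht
      have h6 : J.grad x t + J.om ν (J.η' t) = 0 := h5
      rw [grad_eq x (Ioc_subset_Icc_self ht), J.alt ν] at h6
      simp only [map_smul, map_add, smul_eq_mul] at h6 ⊢
      linear_combination (2⁻¹ : ℝ) * h6
  · rintro ⟨h2, h1, κ, hκ, hκξ, hκη, hae⟩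
    refine ⟨⟨h1, h2⟩, fun y hy => ?_⟩
    -- Both vectors project to zero, so isotropy applies; expanding `endL y` yields the polar form
    -- up to the conditions on `κ`.
    have h3 : J.om ((2 : ℝ) • κ - J.endL x) (J.endL y) = 0 :=
      J.isotropic _ _ (by simp [hκ, h1]) hy.1
    have h4 : ∫ t in Ioc (0 : ℝ) s, J.grad x t * y.2.2 t =
        -J.om ((2 : ℝ) • κ - J.endL x) (J.W y.2.2 s) := by
      rw [om_W_right (integrableOn_control y.2.2) hs, intervalIntegral.integral_of_le J.nonneg,
        ← integral_neg]
      refine integral_congr_ae ?_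
      filter_upwards [hae, ae_restrict_mem measurableSet_Ioc] with t h5 ht
      rw [grad_eq x (Ioc_subset_Icc_self ht), J.alt _ (J.η' t), h5]
      simp only [map_smul, map_add, map_sub, smul_eq_mul]
      ring
    have h5 := hκξ _ hy.2
    have h6 := om_ξ_endL (J := J) x
    rw [J.alt] at h6
    rw [polar_hess_eq, h4, om_W_endL]
    rw [endL_apply y] at h3
    simp only [map_smul, map_add, map_sub, smul_apply,
      sub_apply, smul_eq_mul] at h3 hκη ⊢
    linear_combination h3 - 2 * h5 - (∫ t in (0 : ℝ)..s, y.1 t) * h6 - 2 * y.2.1 * hκη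

end JacobiFrame

/-! ### From the kernel of the Hessian to Jacobi solutions and back. -/

namespace JacobiFrame

variable {T E : Type*} [NormedAddCommGroup T] [NormedSpace ℝ T] [CompleteSpace T]
  [NormedAddCommGroup E] [NormedSpace ℝ E] {s : ℝ} {J : JacobiFrame T E s} {b : T}
  {A : Submodule ℝ ℝ}

variable (J) in
/-- Solutions of the Jacobi equation. -/
def IsJacobi (k : ℝ → T) : Prop :=
  ∀ t ∈ Icc (0 : ℝ) s, ∃ k' : T, HasDerivWithinAt k k' (Icc 0 s) t ∧
    J.l t • k' = J.om (J.η' t) (k t) • J.η' t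

variable (J) in
/-- The boundary condition at `0`. -/
def InitialCondition (A : Submodule ℝ ℝ) (b x : T) : Prop :=
  ∃ (μ : T) (a c : ℝ), J.pr μ = 0 ∧ a ∈ A ∧ (∀ a ∈ A, a * J.om μ J.ξ = 0) ∧ J.om μ b = 0 ∧
    x = μ + a • J.ξ + c • b

variable (s) in
/-- The trivial part of the kernel of the Hessian. -/
def trivialKer : Set (Control s) :=
  {x | x.2.1 = 0 ∧ x.2.2 = 0 ∧ ∫ t in (0 : ℝ)..s, x.1 t = 0}

variable (J) in
/-- A solution `β` of the Jacobi equation along which the primitive `W` of a control is shifted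
to obtain a solution with the boundary conditions determined by `b`. -/
structure Gauge (b : T) where
  β : ℝ → T
  ε : ℝ
  ρ : T
  hasDerivAt : ∀ t, HasDerivAt β (ε • J.η' t) t
  om_β : ∀ t ∈ Icc (0 : ℝ) s, J.om (J.η' t) (β t) = ε * J.l t
  β_zero : β 0 = b - ρ
  β_end : β s = J.η s - ρ
  pr_ρ : J.pr ρ = 0
  om_ρ_ξ : J.om ρ J.ξ = 0
  om_ρ_b : J.om ρ b = 0
  -- The vector is `endL` of a control with constant `w = c ε`, the case in which the shifted
  -- solution is constant.
  indep : ∀ a c : ℝ, J.pr (a • J.ξ + c • J.η s - (c * ε) • (J.η s - J.η 0)) = 0 → a = 0 ∧ c = 0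
  -- Carries the transversality condition of the multiplier rule, stated at time `s`, to the
  -- condition with respect to `b` at time `0`.
  om_b : ∀ (w : ℝ → ℝ) (a c : ℝ) (κ : T), ContinuousOn w (Icc 0 s) →
    (∀ t ∈ Icc (0 : ℝ) s, J.l t * w t = J.om (J.η' t) (κ + J.W w t)) →
    J.pr (a • J.ξ + c • J.η s - J.W w s) = 0 →
    J.om (κ - (a • J.ξ + c • J.η s - J.W w s)) (J.η s) = J.om κ b

theorem η'_ne_zero {t : ℝ} (ht : t ∈ Icc (0 : ℝ) s) : J.η' t ≠ 0 := by
  intro h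
  apply J.l_ne t ht
  rw [h, map_zero, zero_apply]

theorem eq_of_hasDerivWithinAt_zero {F : Type*} [NormedAddCommGroup F] [NormedSpace ℝ F]
    {f : ℝ → F} (hf : ∀ t ∈ Icc (0 : ℝ) s, HasDerivWithinAt f 0 (Icc 0 s) t) :
    ∀ t ∈ Icc (0 : ℝ) s, f t = f 0 := by
  refine constant_of_derivWithin_zero (fun t ht => (hf t ht).differentiableWithinAt)
    fun t ht => ?_
  have ht' := Ico_subset_Icc_self ht
  exact (hf t ht').derivWithin (uniqueDiffOn_Icc (ht.1.trans_lt ht.2) t ht')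

theorem continuousOn_of_mul {f : ℝ → ℝ} (hf : ContinuousOn f (Icc 0 s)) :
    ContinuousOn (fun t => f t / J.l t) (Icc 0 s) :=
  hf.div J.continuous_l.continuousOn J.l_ne

theorem IsJacobi.hasDerivWithinAt {k : ℝ → T} (hk : J.IsJacobi k) {t : ℝ}
    (ht : t ∈ Icc (0 : ℝ) s) :
    HasDerivWithinAt k ((J.om (J.η' t) (k t) / J.l t) • J.η' t) (Icc 0 s) t := by
  obtain ⟨k', h1, h2⟩ := hk t ht
  have h3 : J.l t ≠ 0 := J.l_ne t ht
  have h4 : k' = (J.om (J.η' t) (k t) / J.l t) • J.η' t := by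
    rw [div_eq_inv_mul, mul_smul, ← h2, inv_smul_smul₀ h3]
  rwa [h4] at h1

theorem om_ξ_right {t : ℝ} (ht : t ∈ Icc (0 : ℝ) s) : J.om (J.η' t) J.ξ = 0 := by
  rw [J.alt, J.om_ξ' ht, neg_zero]

variable (G : J.Gauge b)
include G

theorem exists_solution_of_mem_hessKer {x : Control s} (hx : x ∈ J.hessKer A)
    (hxt : x ∉ trivialKer s) : ∃ k, J.IsJacobi k ∧ J.InitialCondition A b (k 0) ∧
      J.pr (k s) = 0 ∧ ∃ t ∈ Icc (0 : ℝ) s, k t ≠ k 0 := by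
  have h0 : (0 : ℝ) ∈ Icc 0 s := left_mem_Icc.2 J.nonneg
  have hs : s ∈ Icc 0 s := right_mem_Icc.2 J.nonneg
  obtain ⟨ha, hpr, κ, hκ, hκξ, hκη, hae⟩ := mem_hessKer_iff.1 hx
  have hw := integrableOn_control x.2.2
  set a := ∫ t in (0 : ℝ)..s, x.1 t with ha_def
  set c := x.2.1 with hc_def
  -- The continuous representative of the control; with it `W` is differentiable at every point of
  -- `[0,s]`.
  set w : ℝ → ℝ := fun t => J.om (J.η' t) (κ + J.W x.2.2 t) / J.l t with hw_def
  have hwc : ContinuousOn w (Icc 0 s) := continuousOn_of_mul (continuousOn_om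
    J.continuous_η'.continuousOn (continuousOn_const.add (continuousOn_W hw)))
  have hxw : (x.2.2 : ℝ → ℝ) =ᵐ[volume.restrict (Ioc 0 s)] w := by
    filter_upwards [hae, ae_restrict_mem measurableSet_Ioc] with t h1 ht
    have h2 : J.l t ≠ 0 := J.l_ne t (Ioc_subset_Icc_self ht)
    rw [hw_def]
    simp only
    rw [← h1, mul_div_cancel_left₀ _ h2]
  have hW : ∀ t ∈ Icc (0 : ℝ) s, J.W x.2.2 t = J.W w t := fun t ht => W_congr hxw ht
  have hlw : ∀ t ∈ Icc (0 : ℝ) s, J.l t * w t = J.om (J.η' t) (κ + J.W w t) := by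
    intro t ht
    have h2 : J.l t ≠ 0 := J.l_ne t ht
    rw [hw_def]
    simp only
    rw [mul_div_cancel₀ _ h2, hW t ht]
  have hend : J.endL x = a • J.ξ + c • J.η s - J.W w s := by rw [endL_apply, hW s hs]
  rw [hend] at hpr hκη
  have hb := G.om_b w a c κ hwc hlw hpr
  rw [hκη] at hb
  -- The shift by `a ξ` does not affect the equation, as `ω(η', ξ) = 0`, and the shift by `c β`
  -- subtracts another solution. They make `k s` equal to `κ - endL x` up to a multiple of `ρ`.
  set k : ℝ → T := fun t => κ + J.W w t - a • J.ξ - c • G.β t with hk_def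
  have hk' : ∀ t ∈ Icc (0 : ℝ) s,
      HasDerivWithinAt k ((w t - c * G.ε) • J.η' t) (Icc 0 s) t := by
    intro t ht
    have := (((hasDerivWithinAt_W (J := J) hwc ht).const_add κ).sub_const (a • J.ξ)).sub
      ((G.hasDerivAt t).hasDerivWithinAt.const_smul c)
    refine this.congr_deriv ?_
    rw [sub_smul, mul_smul]
  refine ⟨k, fun t ht => ⟨_, hk' t ht, ?_⟩, ⟨κ + c • G.ρ, -a, -c, ?_, A.neg_mem ha, ?_, ?_, ?_⟩,
    ?_, ?_⟩
  · rw [smul_smul]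
    congr 1
    simp only [hk_def, map_sub, map_smul, om_ξ_right ht, G.om_β t ht, smul_eq_mul, ← hlw t ht]
    ring
  · rw [map_add, map_smul, hκ, G.pr_ρ, smul_zero, zero_add]
  · intro a' ha'
    rw [map_add, map_smul, add_apply, smul_apply, G.om_ρ_ξ, smul_zero, add_zero]
    exact hκξ a' ha'
  · rw [map_add, map_smul, add_apply, smul_apply, G.om_ρ_b, ← hb, smul_zero, zero_add]
  · simp only [hk_def, W_zero, G.β_zero]
    module
  · have : k s = κ - (a • J.ξ + c • J.η s - J.W w s) + c • G.ρ := by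
      simp only [hk_def, G.β_end]
      module
    rw [this, map_add, map_sub, hpr, hκ, map_smul, G.pr_ρ, smul_zero, sub_zero, zero_add]
  · by_contra! hconst
    apply hxt
    -- For constant `k` the coefficient of `η'` in its derivative must vanish, since `η'` is never
    -- zero.
    have hwε : ∀ t ∈ Icc (0 : ℝ) s, w t = c * G.ε := by
      intro t ht
      have h1 : HasDerivWithinAt k 0 (Icc 0 s) t :=
        (hasDerivWithinAt_const t (Icc 0 s) (k 0)).congr hconst (hconst t ht)
      have h2 := (uniqueDiffOn_Icc J.pos t ht).eq_deriv _ (hk' t ht) h1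
      exact sub_eq_zero.1 ((smul_eq_zero.1 h2).resolve_right (η'_ne_zero ht))
    have hWs : J.W w s = (c * G.ε) • (J.η s - J.η 0) := by
      rw [← W_const]
      exact W_congr (ae_restrict_of_forall_mem measurableSet_Ioc fun t ht =>
        hwε t (Ioc_subset_Icc_self ht)) hs
    rw [hWs] at hpr
    obtain ⟨ha0, hc0⟩ := G.indep a c hpr
    refine ⟨hc0, ?_, ha0⟩
    refine (Lp.eq_zero_iff_ae_eq_zero).2 ?_
    filter_upwards [hxw, ae_restrict_mem measurableSet_Ioc] with t h1 ht
    rw [h1, hwε t (Ioc_subset_Icc_self ht), hc0, zero_mul, Pi.zero_apply]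

theorem exists_mem_hessKer_of_solution {k : ℝ → T} (hk : J.IsJacobi k)
    (hk0 : J.InitialCondition A b (k 0)) (hks : J.pr (k s) = 0)
    (hne : ∃ t ∈ Icc (0 : ℝ) s, k t ≠ k 0) : ∃ x ∈ J.hessKer A, x ∉ trivialKer s := by
  have h0 : (0 : ℝ) ∈ Icc 0 s := left_mem_Icc.2 J.nonneg
  have hs : s ∈ Icc 0 s := right_mem_Icc.2 J.nonneg
  obtain ⟨μ, a', c', hμ, ha', hμξ, hμb, hkμ⟩ := hk0
  obtain ⟨a, rfl⟩ : ∃ a, a' = -a := ⟨-a', (neg_neg _).symm⟩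
  obtain ⟨c, rfl⟩ : ∃ c, c' = -c := ⟨-c', (neg_neg _).symm⟩
  have ha : a ∈ A := by simpa using A.neg_mem ha'
  -- The coefficient of `η'` in the derivative of `k + c β`; thus the shift of the converse
  -- construction is undone.
  set w : ℝ → ℝ := fun t => J.om (J.η' t) (k t) / J.l t + c * G.ε with hw_def
  have hkc : ContinuousOn k (Icc 0 s) := fun t ht => (hk.hasDerivWithinAt ht).continuousWithinAt
  have hwc : ContinuousOn w (Icc 0 s) := (continuousOn_of_mul (continuousOn_om
    J.continuous_η'.continuousOn hkc)).add continuousOn_const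
  set κ := μ - c • G.ρ with hκ_def
  have hκ : J.pr κ = 0 := by rw [hκ_def, map_sub, map_smul, hμ, G.pr_ρ, smul_zero, sub_zero]
  have hkeq : ∀ t ∈ Icc (0 : ℝ) s, k t = κ + J.W w t - a • J.ξ - c • G.β t := by
    have hd : ∀ t ∈ Icc (0 : ℝ) s, HasDerivWithinAt
        (fun t => k t - (κ + J.W w t - a • J.ξ - c • G.β t)) 0 (Icc 0 s) t := by
      intro t ht
      have := (hk.hasDerivWithinAt ht).sub
        ((((hasDerivWithinAt_W (J := J) hwc ht).const_add κ).sub_const (a • J.ξ)).sub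
          ((G.hasDerivAt t).hasDerivWithinAt.const_smul c))
      refine this.congr_deriv ?_
      simp only [hw_def]
      module
    intro t ht
    have h1 := eq_of_hasDerivWithinAt_zero hd t ht
    simp only [W_zero, G.β_zero, hkμ, hκ_def] at h1
    have h2 : μ + -a • J.ξ + -c • b - (μ - c • G.ρ + 0 - a • J.ξ - c • (b - G.ρ)) = 0 := by
      module
    rw [h2] at h1
    exact sub_eq_zero.1 h1
  have hlw : ∀ t ∈ Icc (0 : ℝ) s, J.l t * w t = J.om (J.η' t) (κ + J.W w t) := by
    intro t ht
    have h2 : J.l t ≠ 0 := J.l_ne t ht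
    have h3 : J.om (J.η' t) (k t) = J.om (J.η' t) (κ + J.W w t) - c * (G.ε * J.l t) := by
      rw [hkeq t ht]
      simp only [map_sub, map_smul, om_ξ_right ht, G.om_β t ht, smul_eq_mul]
      ring
    have h4 : J.l t * w t = J.om (J.η' t) (k t) + c * (G.ε * J.l t) := by
      simp only [hw_def]
      field_simp
    rw [h4, h3]
    ring
  have hwm := memLp_of_continuousOn hwc
  have hvm : MemLp (fun _ : ℝ => a / s) 2 (volume.restrict (Ioc (0 : ℝ) s)) := memLp_const _
  have hvi : ∫ t in (0 : ℝ)..s, (hvm.toLp _ : ℝ → ℝ) t = a := by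
    rw [intervalIntegral.integral_of_le J.nonneg, integral_congr_ae hvm.coeFn_toLp]
    simp [J.nonneg, mul_div_cancel₀ _ J.pos.ne']
  have hW : ∀ t ∈ Icc (0 : ℝ) s, J.W (hwm.toLp w) t = J.W w t :=
    fun t ht => W_congr hwm.coeFn_toLp ht
  set x : Control s := (hvm.toLp _, c, hwm.toLp w) with hx_def
  have hend : J.endL x = a • J.ξ + c • J.η s - J.W w s := by
    have h1 : J.endL x = _ := endL_apply x
    rw [h1, ← hW s hs]
    simp only [hx_def, hvi]
  have hend' : J.endL x = κ + c • G.ρ - k s := by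
    rw [hend, hkeq s hs, G.β_end]
    module
  have hpr : J.pr (J.endL x) = 0 := by
    rw [hend', map_sub, map_add, map_smul, hκ, G.pr_ρ, hks, smul_zero, add_zero, sub_zero]
  refine ⟨x, mem_hessKer_iff.2 ⟨?_, hpr, κ, hκ, fun a' ha' => ?_, ?_, ?_⟩, fun hxt => ?_⟩
  · show ∫ t in (0 : ℝ)..s, (hvm.toLp _ : ℝ → ℝ) t ∈ A
    rw [hvi]
    exact ha
  · rw [hκ_def, map_sub, map_smul, sub_apply, smul_apply, G.om_ρ_ξ, smul_zero, sub_zero]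
    exact hμξ a' ha'
  · rw [hend] at hpr ⊢
    rw [G.om_b w a c κ hwc hlw hpr, hκ_def, map_sub, map_smul, sub_apply, smul_apply, G.om_ρ_b,
      hμb, smul_zero, sub_zero]
  · filter_upwards [hwm.coeFn_toLp, ae_restrict_mem measurableSet_Ioc] with t h1 ht
    have h2 : x.2.2 t = w t := h1
    rw [h2, hlw t (Ioc_subset_Icc_self ht), hW t (Ioc_subset_Icc_self ht)]
  · obtain ⟨hc0, hw0, -⟩ := hxt
    obtain ⟨t, ht, hkt⟩ := hne
    apply hkt
    have hc0' : c = 0 := hc0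
    have hw0' : hwm.toLp w = 0 := hw0
    have hWt : J.W w t = 0 := by
      rw [← hW t ht, hw0', W_congr (Lp.coeFn_zero ℝ 2 (volume.restrict (Ioc (0 : ℝ) s))) ht]
      simp [W]
    rw [hkeq t ht, hkeq 0 h0, hWt, W_zero, hc0', zero_smul, zero_smul]

/-- The end condition and the independence of `ξ` and `b = η(t₀)` over the base kill the
coefficients of `ξ` and `b`, so `k` is a vertical `μ`. The equation then gives `ω(μ, η') = 0`, so
`ω(μ, η(t))` is constant in `t`, and it vanishes at `t₀`. -/
theorem eq_zero_of_constant {k : ℝ → T} (hk : J.IsJacobi k)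
    (hk0 : J.InitialCondition A b (k 0)) (hks : J.pr (k s) = 0)
    (hb : ∃ t ∈ Icc (0 : ℝ) s, b = J.η t) (hconst : ∀ t ∈ Icc (0 : ℝ) s, k t = k 0)
    (hcor : ∀ μ, J.pr μ = 0 → (∀ t ∈ Icc (0 : ℝ) s, J.om μ (J.η t) = 0) →
      (∀ a ∈ A, a * J.om μ J.ξ = 0) → μ = 0) : k 0 = 0 := by
  have h0 : (0 : ℝ) ∈ Icc 0 s := left_mem_Icc.2 J.nonneg
  have hs : s ∈ Icc 0 s := right_mem_Icc.2 J.nonneg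
  obtain ⟨t₀, ht₀, hbt⟩ := hb
  obtain ⟨μ, a, c, hμ, -, hμξ, hμb, hkμ⟩ := hk0
  have h1 : J.pr (a • J.ξ + c • J.η t₀) = 0 := by
    rw [hconst s hs, hkμ, add_assoc, map_add, hμ, zero_add, hbt] at hks
    exact hks
  obtain ⟨rfl, rfl⟩ := J.indep t₀ ht₀ a c h1
  rw [zero_smul, zero_smul, add_zero, add_zero] at hkμ
  rw [hkμ]
  refine hcor μ hμ ?_ hμξ
  have h2 : ∀ t ∈ Icc (0 : ℝ) s, J.om μ (J.η' t) = 0 := by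
    intro t ht
    have h3 : HasDerivWithinAt k 0 (Icc 0 s) t :=
      (hasDerivWithinAt_const t (Icc 0 s) (k 0)).congr hconst (hconst t ht)
    have h4 := (uniqueDiffOn_Icc J.pos t ht).eq_deriv _ (hk.hasDerivWithinAt ht) h3
    have h5 := (smul_eq_zero.1 h4).resolve_right (η'_ne_zero ht)
    have h6 := (div_eq_zero_iff.1 h5).resolve_right (J.l_ne t ht)
    rw [hconst t ht, hkμ] at h6
    rw [J.alt, h6, neg_zero]
  have h3 : ∀ t ∈ Icc (0 : ℝ) s, HasDerivWithinAt (fun t => J.om μ (J.η t)) 0 (Icc 0 s) t := by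
    intro t ht
    rw [← h2 t ht]
    exact ((J.om μ).hasFDerivAt.comp_hasDerivAt t (J.hasDerivAt_η t)).hasDerivWithinAt
  intro t ht
  rw [eq_of_hasDerivWithinAt_zero h3 t ht, ← eq_of_hasDerivWithinAt_zero h3 t₀ ht₀, ← hbt, hμb]

omit G

variable (J) in
/-- The gauge for `b = η(0)`. -/
def gaugeZero : J.Gauge (J.η 0) where
  β := J.η
  ε := 1
  ρ := 0
  hasDerivAt t := by rw [one_smul]; exact J.hasDerivAt_η t
  om_β t _ := (one_mul _).symm
  β_zero := (sub_zero _).symm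
  β_end := (sub_zero _).symm
  pr_ρ := map_zero _
  om_ρ_ξ := by simp
  om_ρ_b := by simp
  -- With `ε = 1` the vector collapses to `a ξ + c η(0)`.
  indep a c h := by
    refine J.indep 0 (left_mem_Icc.2 J.nonneg) a c ?_
    rw [← h]
    congr 1
    module
  om_b w a c κ hw hlw _ := by
    have hs : s ∈ Icc 0 s := right_mem_Icc.2 J.nonneg
    -- First integral: the derivative of `ω(κ + W, η)` is `w l + ω(κ + W, η')`, which is zero by the
    -- equation for `w`.
    have hd : ∀ t ∈ Icc (0 : ℝ) s, HasDerivWithinAt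
        (fun t => J.om (κ + J.W w t) (J.η t)) 0 (Icc 0 s) t := by
      intro t ht
      have h1 := (J.om.hasFDerivAt.comp_hasDerivWithinAt t
        ((hasDerivWithinAt_W (J := J) hw ht).const_add κ)).clm_apply
        (J.hasDerivAt_η t).hasDerivWithinAt
      refine h1.congr_deriv ?_
      have h2 := hlw t ht
      rw [J.alt] at h2
      simp only [Function.comp_apply, map_smul, smul_apply, smul_eq_mul]
      change w t * J.l t + _ = 0
      linarith
    have h1 := eq_of_hasDerivWithinAt_zero hd s hs
    simp only [W_zero, add_zero] at h1
    rw [← h1]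
    simp only [map_add, map_sub, map_smul, add_apply, sub_apply, smul_apply, J.om_self,
      J.om_ξ s hs]
    simp

theorem mem_of_forall_dual [FiniteDimensional ℝ T] {Z : Submodule ℝ T} {x : T}
    (h : ∀ φ : T →L[ℝ] ℝ, (∀ z ∈ Z, φ z = 0) → φ x = 0) : x ∈ Z := by
  by_contra hx
  obtain ⟨f, hf, hfZ⟩ := Submodule.exists_le_ker_of_notMem hx
  exact hf (h (LinearMap.toContinuousLinearMap f) fun z hz => hfZ hz)

variable (J) in
/-- The span of `ξ` and of the curve `η`. -/
def spanη : Submodule ℝ T := Submodule.span ℝ (insert J.ξ (J.η '' Icc 0 s))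

theorem ξ_mem_spanη : J.ξ ∈ J.spanη := Submodule.subset_span (mem_insert _ _)

theorem η_mem_spanη {t : ℝ} (ht : t ∈ Icc (0 : ℝ) s) : J.η t ∈ J.spanη :=
  Submodule.subset_span (mem_insert_of_mem _ (mem_image_of_mem _ ht))

theorem η'_mem_spanη [FiniteDimensional ℝ T] {t : ℝ} (ht : t ∈ Icc (0 : ℝ) s) :
    J.η' t ∈ J.spanη := by
  refine mem_of_forall_dual fun φ hφ => ?_
  have h1 := (φ.hasFDerivAt.comp_hasDerivAt t (J.hasDerivAt_η t)).hasDerivWithinAt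
    (s := Icc 0 s)
  have h0 : ∀ τ ∈ Icc (0 : ℝ) s, (φ ∘ J.η) τ = 0 := fun τ hτ => hφ _ (η_mem_spanη hτ)
  have h2 : HasDerivWithinAt (φ ∘ J.η) 0 (Icc 0 s) t :=
    (hasDerivWithinAt_const t (Icc 0 s) (0 : ℝ)).congr h0 (h0 t ht)
  exact (uniqueDiffOn_Icc J.pos t ht).eq_deriv _ h1 h2

theorem W_mem_spanη [FiniteDimensional ℝ T] {w : ℝ → ℝ} (hw : IntegrableOn w (Ioc 0 s)) :
    J.W w s ∈ J.spanη := by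
  refine mem_of_forall_dual fun φ hφ => ?_
  rw [map_W φ hw (right_mem_Icc.2 J.nonneg)]
  refine intervalIntegral.integral_zero_ae (Filter.Eventually.of_forall fun τ hτ => ?_)
  rw [uIoc_of_le J.nonneg] at hτ
  rw [hφ _ (η'_mem_spanη (Ioc_subset_Icc_self hτ)), smul_zero]

/-- The projection is injective on the span, so there `ω(y, ·)` is a function of the projection. A
left inverse of the projection extends it to a functional on all of `E`, which a vertical vector
represents. -/
theorem exists_vertical_rep (hZ : ∀ z ∈ J.spanη, J.pr z = 0 → z = 0) (y : T) :
    ∃ ρ, J.pr ρ = 0 ∧ ∀ z ∈ J.spanη, J.om ρ z = J.om y z := by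
  have hinj : LinearMap.ker ((J.pr : T →ₗ[ℝ] E) ∘ₗ J.spanη.subtype) = ⊥ := by
    rw [LinearMap.ker_eq_bot']
    exact fun z hz => Subtype.ext (hZ z.1 z.2 hz)
  obtain ⟨g, hg⟩ := LinearMap.exists_leftInverse_of_injective _ hinj
  obtain ⟨ρ, hρ, hρx⟩ := J.exists_rep ((J.om y : T →ₗ[ℝ] ℝ) ∘ₗ J.spanη.subtype ∘ₗ g)
  refine ⟨ρ, hρ, fun z hz => ?_⟩
  rw [hρx]
  have h1 : g (J.pr z) = ⟨z, hz⟩ := LinearMap.congr_fun hg ⟨z, hz⟩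
  show J.om y (g (J.pr z)) = J.om y z
  rw [h1]

/-- Subtracting from `η(s)` a vertical `ρ` with the same products on the span leaves a vector
skew-orthogonal to every `η'(t)`, hence a constant solution. -/
theorem exists_gauge_end [FiniteDimensional ℝ T]
    (hZ : ∀ z ∈ J.spanη, J.pr z = 0 → z = 0) : Nonempty (J.Gauge (J.η s)) := by
  have hs : s ∈ Icc 0 s := right_mem_Icc.2 J.nonneg
  obtain ⟨ρ, hρ, hρz⟩ := exists_vertical_rep hZ (J.η s)
  exact ⟨{
    β := fun _ => J.η s - ρ
    ε := 0
    ρ := ρ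
    hasDerivAt := fun t => by rw [zero_smul]; exact hasDerivAt_const t _
    om_β := fun t ht => by
      rw [zero_mul, J.alt, map_sub, sub_apply, hρz _ (η'_mem_spanη ht), sub_self, neg_zero]
    β_zero := rfl
    β_end := rfl
    pr_ρ := hρ
    om_ρ_ξ := by rw [hρz _ ξ_mem_spanη, J.alt, J.om_ξ s hs, neg_zero]
    om_ρ_b := by rw [hρz _ (η_mem_spanη hs), J.om_self]
    indep := fun a c h => by
      rw [mul_zero, zero_smul, sub_zero] at h
      exact J.indep s hs a c h
    om_b := fun w a c κ hw _ h => by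
      -- The vector `a ξ + c η(s) - W(s)` is in the span and projects to zero, so it vanishes.
      rw [hZ _ (J.spanη.sub_mem (J.spanη.add_mem (J.spanη.smul_mem _ ξ_mem_spanη)
        (J.spanη.smul_mem _ (η_mem_spanη hs))) (W_mem_spanη
          (hw.integrableOn_Icc.mono_set Ioc_subset_Icc_self))) h, sub_zero] }⟩

/-- The kernel of the Hessian is nontrivial if and only if the Jacobi equation has a nonconstant
solution with the given boundary conditions; under a nondegeneracy condition all nonzero solutions
are nonconstant. -/
theorem exists_mem_hessKer_iff [FiniteDimensional ℝ T]
    (hb : b = J.η 0 ∨ (b = J.η s ∧ ∀ z ∈ J.spanη, J.pr z = 0 → z = 0)) :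
    ((∀ μ, J.pr μ = 0 → (∀ t ∈ Icc (0 : ℝ) s, J.om μ (J.η t) = 0) →
      (∀ a ∈ A, a * J.om μ J.ξ = 0) → μ = 0) →
      ((∃ x ∈ J.hessKer A, x ∉ trivialKer s) ↔ ∃ k, (J.IsJacobi k ∧
        J.InitialCondition A b (k 0) ∧ J.pr (k s) = 0) ∧ ∃ t ∈ Icc (0 : ℝ) s, k t ≠ 0)) ∧
    ((∃ x ∈ J.hessKer A, x ∉ trivialKer s) ↔ ∃ k, (J.IsJacobi k ∧
        J.InitialCondition A b (k 0) ∧ J.pr (k s) = 0) ∧ ∃ t ∈ Icc (0 : ℝ) s, k t ≠ k 0) := by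
  obtain ⟨⟨G⟩, hbη⟩ : Nonempty (J.Gauge b) ∧ ∃ t ∈ Icc (0 : ℝ) s, b = J.η t := by
    rcases hb with rfl | ⟨rfl, hZ⟩
    · exact ⟨⟨J.gaugeZero⟩, 0, left_mem_Icc.2 J.nonneg, rfl⟩
    · exact ⟨exists_gauge_end hZ, s, right_mem_Icc.2 J.nonneg, rfl⟩
  have h2 : (∃ x ∈ J.hessKer A, x ∉ trivialKer s) ↔ ∃ k, (J.IsJacobi k ∧
        J.InitialCondition A b (k 0) ∧ J.pr (k s) = 0) ∧ ∃ t ∈ Icc (0 : ℝ) s, k t ≠ k 0 := by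
    constructor
    · rintro ⟨x, hx, hxt⟩
      obtain ⟨k, h1, h2, h3, h4⟩ := exists_solution_of_mem_hessKer G hx hxt
      exact ⟨k, ⟨h1, h2, h3⟩, h4⟩
    · rintro ⟨k, ⟨h1, h2, h3⟩, h4⟩
      exact exists_mem_hessKer_of_solution G h1 h2 h3 h4
  refine ⟨fun hcor => ?_, h2⟩
  rw [h2]
  refine exists_congr fun k => and_congr_right fun hk => ⟨?_, ?_⟩
  · rintro ⟨t, ht, hne⟩
    by_cases h : k 0 = 0
    · exact ⟨t, ht, h ▸ hne⟩
    · exact ⟨0, left_mem_Icc.2 J.nonneg, h⟩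
  · rintro ⟨t, ht, hne⟩
    by_contra! hconst
    exact hne ((hconst t ht).trans
      (eq_zero_of_constant G hk.1 hk.2.1 hk.2.2 hbη hconst hcor))

end JacobiFrame

/-! ### A norm on a finite-dimensional topological vector space. -/

section FiniteDimensionalNorm

variable (X : Type*) [AddCommGroup X] [Module ℝ X] [TopologicalSpace X] [IsTopologicalAddGroup X]
  [ContinuousSMul ℝ X] [T2Space X] [FiniteDimensional ℝ X]

/-- A norm on a finite-dimensional Hausdorff space, compatible with the given structure. -/
abbrev normedAddCommGroupOfFiniteDimensional : NormedAddCommGroup X :=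
  { ‹AddCommGroup X›,
    -- Replacing the topology keeps the given one, so that derivatives in `X` mean the same before
    -- and after the norm is introduced.
    (MetricSpace.induced (toEuclidean (E := X)) toEuclidean.injective
      inferInstance).replaceTopology (toEuclidean (E := X)).toHomeomorph.isInducing.eq_induced with
    norm := fun x => ‖toEuclidean x‖
    dist_eq := fun x y => by
      show dist (toEuclidean x) (toEuclidean y) = ‖toEuclidean (-x + y)‖
      rw [dist_comm, dist_eq_norm, map_add, map_neg]
      congr 1
      abel }

/-- The normed space structure that belongs to `normedAddCommGroupOfFiniteDimensional`. -/
abbrev normedSpaceOfFiniteDimensional :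
    @NormedSpace ℝ X _ (normedAddCommGroupOfFiniteDimensional X).toSeminormedAddCommGroup :=
  letI := normedAddCommGroupOfFiniteDimensional X
  { ‹Module ℝ X› with
    norm_smul_le := fun c x => by
      show ‖toEuclidean (c • x)‖ ≤ ‖c‖ * ‖toEuclidean x‖
      rw [map_smul, norm_smul] }

end FiniteDimensionalNorm

/-! ### The reduced symplectic space. -/

section Reduction

variable {V : Type*} [AddCommGroup V] [Module ℝ V]

section Topology

variable [TopologicalSpace V] [IsTopologicalAddGroup V]
  [ContinuousSMul ℝ V] [T2Space V] [FiniteDimensional ℝ V] (B : LinearMap.BilinForm ℝ V) (e : V)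

instance t2Space_reduced : T2Space (Reduced B e) := by
  have : IsClosed (((Submodule.span ℝ {e}).comap (LinearMap.ker (B e)).subtype :
    Submodule ℝ (LinearMap.ker (B e))) : Set (LinearMap.ker (B e))) :=
    Submodule.closed_of_finiteDimensional _
  have := Submodule.t3_quotient_of_isClosed
    ((Submodule.span ℝ {e}).comap (LinearMap.ker (B e)).subtype :
      Submodule ℝ (LinearMap.ker (B e)))
  infer_instance

instance finiteDimensional_reduced : FiniteDimensional ℝ (Reduced B e) := inferInstance

end Topology

variable (B : LinearMap.BilinForm ℝ V) (e : V)

theorem toReduced_of_mem {v : V} (hv : B e v = 0) :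
    toReduced B e v = Submodule.Quotient.mk ⟨v, hv⟩ :=
  dif_pos (show v ∈ LinearMap.ker (B e) from hv)

/-- Since `toReduced` is set to zero outside `e^∠`, it need not be linear on `V`. A linear extension
of the quotient map allows curves of lifts to be differentiated after projection. -/
theorem exists_linear_toReduced : ∃ P : V →ₗ[ℝ] Reduced B e, ∀ v, B e v = 0 →
    P v = toReduced B e v := by
  obtain ⟨P, hP⟩ := LinearMap.exists_extend (p := LinearMap.ker (B e))
    ((Submodule.span ℝ {e}).comap (LinearMap.ker (B e)).subtype).mkQ
  refine ⟨P, fun v hv => ?_⟩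
  rw [toReduced_of_mem B e hv]
  exact LinearMap.congr_fun hP ⟨v, hv⟩

theorem exists_toReduced (x : Reduced B e) : ∃ v, B e v = 0 ∧ toReduced B e v = x := by
  obtain ⟨⟨v, hv⟩, rfl⟩ := Submodule.Quotient.mk_surjective _ x
  exact ⟨v, hv, toReduced_of_mem B e hv⟩

theorem reducedForm_toReduced (hB : B.IsAlt) {u v : V} (hu : B e u = 0) (hv : B e v = 0) :
    reducedForm B e hB (toReduced B e u) (toReduced B e v) = B u v := by
  rw [toReduced_of_mem B e hu, toReduced_of_mem B e hv, reducedForm_mk]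

theorem reducedForm_isAlt (hB : B.IsAlt) : (reducedForm B e hB).IsAlt := by
  intro x
  obtain ⟨v, hv, rfl⟩ := exists_toReduced B e x
  rw [reducedForm_toReduced B e hB hv hv]
  exact hB v

theorem toReduced_eq_zero {v : V} (hv : B e v = 0) :
    toReduced B e v = 0 ↔ ∃ c : ℝ, c • e = v := by
  rw [toReduced_of_mem B e hv, Submodule.Quotient.mk_eq_zero, Submodule.mem_comap]
  exact Submodule.mem_span_singleton

end Reduction

/-! ### Vertical vectors and the projection to the base. -/

section Vertical

variable {m : ℕ} {M : Type*} [TopologicalSpace M] [ChartedSpace (EuclideanSpace ℝ (Fin m)) M]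
  [IsManifold (𝓡 m) ∞ M] (S : Data m M) (s : ℝ)

/-- The projection of the reduced symplectic space to the tangent space of the base. -/
def baseProj : S.Sig s →ₗ[ℝ] Mod m :=
  Submodule.liftQ _ ((LinearMap.fst ℝ (Mod m) (Mod m →L[ℝ] ℝ)) ∘ₗ
    (LinearMap.ker (symp m (S.euler s))).subtype) (by
      rintro ⟨v, hv⟩ h
      obtain ⟨c, rfl⟩ := Submodule.mem_span_singleton.1 (Submodule.mem_comap.1 h)
      show c • (0 : Mod m) = 0
      exact smul_zero c)

theorem baseProj_toReduced {v : PhaseMod m} (hv : symp m (S.euler s) v = 0) :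
    baseProj S s (toReduced (symp m) (S.euler s) v) = v.1 := by
  rw [toReduced_of_mem _ _ hv]
  rfl

theorem symp_euler_vertical (p : Mod m →L[ℝ] ℝ) :
    symp m (S.euler s) ((0, p) : PhaseMod m) = 0 := by
  rw [symp_euler]
  exact map_zero _

theorem mem_Pi_iff (x : S.Sig s) : x ∈ S.Pi s ↔ baseProj S s x = 0 := by
  constructor
  · rintro ⟨⟨v, hv⟩, ⟨p, hp⟩, rfl⟩
    exact (congrArg Prod.fst hp).symm
  · intro h
    obtain ⟨v, hv, rfl⟩ := exists_toReduced _ _ x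
    rw [baseProj_toReduced S s hv] at h
    refine ⟨⟨v, hv⟩, ⟨v.2, Prod.ext h.symm rfl⟩, ?_⟩
    rw [toReduced_of_mem _ _ hv]
    rfl

theorem exists_vertical_of_mem_Pi {x : S.Sig s} (hx : baseProj S s x = 0) :
    ∃ p : Mod m →L[ℝ] ℝ, x = toReduced (symp m) (S.euler s) (0, p) := by
  obtain ⟨v, hv, rfl⟩ := exists_toReduced _ _ x
  rw [baseProj_toReduced S s hv] at hx
  exact ⟨v.2, by rw [← hx]⟩

theorem om_vertical (p : Mod m →L[ℝ] ℝ) (x : S.Sig s) :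
    S.om s (toReduced (symp m) (S.euler s) (0, p)) x = p (baseProj S s x) := by
  obtain ⟨v, hv, rfl⟩ := exists_toReduced _ _ x
  rw [baseProj_toReduced S s hv]
  refine (reducedForm_toReduced _ _ _ (symp_euler_vertical S s p) hv).trans ?_
  rw [symp_apply]
  simp

end Vertical

/-! ### Transfer of the abstract result to explicit data. -/

/-- A `JacobiFrame` asks for a curve of class C¹ on all of `ℝ`, but the lifts are controlled only
over `[0,1]`. The derivative is extended by its end values and integrated. -/
theorem exists_global_primitive {V : Type*} [NormedAddCommGroup V] [NormedSpace ℝ V]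
    [CompleteSpace V] {N N' : ℝ → V} (h : ∀ t ∈ Icc (0 : ℝ) 1, HasDerivAt N (N' t) t)
    (hc : ContinuousOn N' (Icc 0 1)) : ∃ L L' : ℝ → V, Continuous L' ∧
      (∀ t, HasDerivAt L (L' t) t) ∧ ∀ t ∈ Icc (0 : ℝ) 1, L t = N t ∧ L' t = N' t := by
  have h01 : (0 : ℝ) ≤ 1 := zero_le_one
  set L' : ℝ → V := IccExtend h01 ((Icc (0 : ℝ) 1).domRestrict N') with hL'
  have hLc : Continuous L' := hc.domRestrict.Icc_extend'
  have hLe : ∀ t ∈ Icc (0 : ℝ) 1, L' t = N' t := fun t ht => IccExtend_of_mem h01 _ ht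
  refine ⟨fun t => N 0 + ∫ τ in (0 : ℝ)..t, L' τ, L', hLc, fun t => ?_, fun t ht => ⟨?_, hLe t ht⟩⟩
  · exact (hLc.integral_hasStrictDerivAt 0 t).hasDerivAt.const_add _
  · have hsub : uIcc 0 t ⊆ Icc (0 : ℝ) 1 := by
      rw [uIcc_of_le ht.1]
      exact Icc_subset_Icc_right ht.2
    have h1 : ∫ τ in (0 : ℝ)..t, L' τ = N t - N 0 := by
      refine intervalIntegral.integral_eq_sub_of_hasDerivAt (fun τ hτ => ?_)
        (hLc.intervalIntegrable 0 t)
      rw [hLe τ (hsub hτ)]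
      exact h τ (hsub hτ)
    simp only [h1]
    abel

/-- The multiplier `κ = 0` works, as `endL` and `W` vanish on such controls. -/
theorem JacobiFrame.trivialKer_subset_hessKer {T E : Type*} [NormedAddCommGroup T]
    [NormedSpace ℝ T] [CompleteSpace T] [NormedAddCommGroup E] [NormedSpace ℝ E] {s : ℝ}
    (J : JacobiFrame T E s) (A : Submodule ℝ ℝ) : trivialKer s ⊆ J.hessKer A := by
  rintro ⟨v, c, w⟩ ⟨hc, hw, hv⟩
  obtain rfl : c = 0 := hc
  obtain rfl : w = 0 := hw
  have hv' : ∫ t in (0 : ℝ)..s, v t = 0 := hv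
  have hend : J.endL (v, 0, 0) = 0 := by
    rw [JacobiFrame.endL_mk_zero, hv', zero_smul, zero_smul, add_zero]
  refine JacobiFrame.mem_hessKer_iff.2 ⟨?_, ?_, 0, map_zero _, fun a _ => ?_, ?_, ?_⟩
  · exact hv'.symm ▸ A.zero_mem
  · rw [hend, map_zero]
  · rw [map_zero, zero_apply, mul_zero]
  · rw [hend, sub_zero, map_zero, zero_apply]
  · filter_upwards [Lp.coeFn_zero ℝ 2 (volume.restrict (Ioc (0 : ℝ) s)),
      ae_restrict_mem measurableSet_Ioc] with t h1 ht
    have h2 : J.W (0 : Lp ℝ 2 (volume.restrict (Ioc (0 : ℝ) s))) t = 0 := by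
      rw [JacobiFrame.W_congr (Lp.coeFn_zero ℝ 2 (volume.restrict (Ioc (0 : ℝ) s)))
        (Ioc_subset_Icc_self ht)]
      simp [JacobiFrame.W]
    simp only [h1, h2, Pi.zero_apply, mul_zero, zero_add, map_zero]

/-- `JacobiFrame.exists_mem_hessKer_iff`, with the frame, the Hessian, the kernel and the boundary
conditions given by explicit expressions on `[0,s]`. -/
theorem JacobiFrame.conjugate_iff {T E : Type*} [NormedAddCommGroup T] [NormedSpace ℝ T]
    [FiniteDimensional ℝ T] [NormedAddCommGroup E] [NormedSpace ℝ E] [CompleteSpace E] {s : ℝ}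
    (J : JacobiFrame T E s)
    {B : LinearMap.BilinForm ℝ T} {π' : T →ₗ[ℝ] E} {Pi Γ : Submodule ℝ T} {ξ b : T} {η η' : ℝ → T}
    (hB : ∀ x y, J.om x y = B x y) (hπ : ∀ x, J.pr x = π' x) (hPi : ∀ x, x ∈ Pi ↔ π' x = 0)
    (hξ : J.ξ = ξ) (hη : ∀ t ∈ Icc 0 s, J.η t = η t) (hη' : ∀ t ∈ Icc 0 s, J.η' t = η' t)
    (hb : b = η 0 ∨ (b = η s ∧ Pi ⊓ Submodule.span ℝ (insert ξ (η '' Icc 0 s)) = ⊥))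
    {A : Submodule ℝ ℝ} (hΓ : ∀ z, z ∈ Γ ↔ ∃ a ∈ A, ∃ c : ℝ, a • ξ + c • b = z)
    {hess : Control s → ℝ} (hhess : ∀ x, hess x =
      (∫ t in (0 : ℝ)..s, B (η' t) (η t) * x.2.2 t ^ 2) +
      ∫ t in (0 : ℝ)..s, (x.2.1 * B (η s) (η' t) +
        ∫ τ in (0 : ℝ)..t, x.2.2 τ * B (η' τ) (η' t)) * x.2.2 t)
    {K : Set (Control s)} (hK : ∀ x, x ∈ K ↔ (∫ t in (0 : ℝ)..s, x.1 t) • π' ξ + x.2.1 • π' (η s) -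
      (∫ t in (0 : ℝ)..s, x.2.2 t • π' (η' t)) = 0 ∧ ∫ t in (0 : ℝ)..s, x.1 t ∈ A) :
    ((∀ μ, π' μ = 0 → (∀ t ∈ Icc 0 s, B μ (η t) = 0) → μ = 0) →
      (trivialKer s ⊂ {x | x ∈ K ∧ ∀ y ∈ K, QuadraticMap.polar hess x y = 0} ↔
        ∃ k : ℝ → T, ((∀ t ∈ Icc 0 s, ∃ k', HasDerivWithinAt k k' (Icc 0 s) t ∧
          B (η' t) (η t) • k' = B (η' t) (k t) • η' t) ∧
          k 0 ∈ Pi ⊓ B.orthogonal Γ ⊔ Γ ∧ k s ∈ Pi) ∧ ∃ t ∈ Icc 0 s, k t ≠ 0)) ∧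
    (trivialKer s ⊂ {x | x ∈ K ∧ ∀ y ∈ K, QuadraticMap.polar hess x y = 0} ↔
        ∃ k : ℝ → T, ((∀ t ∈ Icc 0 s, ∃ k', HasDerivWithinAt k k' (Icc 0 s) t ∧
          B (η' t) (η t) • k' = B (η' t) (k t) • η' t) ∧
          k 0 ∈ Pi ⊓ B.orthogonal Γ ⊔ Γ ∧ k s ∈ Pi) ∧ ∃ t ∈ Icc 0 s, k t ≠ k 0) := by
  have : CompleteSpace T := FiniteDimensional.complete ℝ T
  have hs := J.nonneg
  have hss : s ∈ Icc 0 s := right_mem_Icc.2 hs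
  obtain rfl := hξ
  have hPi' : ∀ x, x ∈ Pi ↔ J.pr x = 0 := fun x => by rw [hPi, hπ]
  have hhess' : hess = J.hess := by
    funext x
    rw [hhess]
    unfold JacobiFrame.hess
    congr 1
    · refine intervalIntegral.integral_congr fun t ht => ?_
      rw [uIcc_of_le hs] at ht
      simp only [l, hB, hη t ht, hη' t ht]
    · refine intervalIntegral.integral_congr fun t ht => ?_
      rw [uIcc_of_le hs] at ht
      have : ∫ τ in (0 : ℝ)..t, x.2.2 τ * B (η' τ) (η' t) =
          ∫ τ in (0 : ℝ)..t, x.2.2 τ * J.om (J.η' τ) (J.η' t) := by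
        refine intervalIntegral.integral_congr fun τ hτ => ?_
        rw [uIcc_of_le ht.1] at hτ
        simp only [hB, hη' t ht, hη' τ ⟨hτ.1, hτ.2.trans ht.2⟩]
      simp only [this, hB, hη s hss, hη' t ht]
  have hK' : K = J.ker A := by
    ext x
    rw [hK]
    refine and_congr_left' ?_
    rw [endL_apply, map_sub, map_add, map_smul, map_smul,
      map_W J.pr (integrableOn_control x.2.2) hss, hπ, hπ, hη s hss]
    have : ∫ t in (0 : ℝ)..s, x.2.2 t • π' (η' t) = ∫ t in (0 : ℝ)..s, x.2.2 t • J.pr (J.η' t) := by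
      refine intervalIntegral.integral_congr fun t ht => ?_
      rw [uIcc_of_le hs] at ht
      simp only [hπ, hη' t ht]
    rw [this]
  have hker : trivialKer s ⊂ {x | x ∈ K ∧ ∀ y ∈ K, QuadraticMap.polar hess x y = 0} ↔
      ∃ x ∈ J.hessKer A, x ∉ trivialKer s := by
    rw [hhess', hK']
    exact Set.ssubset_iff_exists.trans (and_iff_right (J.trivialKer_subset_hessKer A))
  have hort : ∀ μ, μ ∈ B.orthogonal Γ ↔ (∀ a ∈ A, a * J.om μ J.ξ = 0) ∧ J.om μ b = 0 := by
    intro μ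
    rw [LinearMap.BilinForm.mem_orthogonal_iff]
    constructor
    · intro h
      have h1 : ∀ z ∈ Γ, J.om μ z = 0 := fun z hz => by
        have h2 : B z μ = 0 := h z hz
        rw [J.alt, hB, h2, neg_zero]
      refine ⟨fun a ha => ?_, h1 b ((hΓ b).2 ⟨0, A.zero_mem, 1, by simp⟩)⟩
      have h2 := h1 (a • J.ξ) ((hΓ _).2 ⟨a, ha, 0, by simp⟩)
      rwa [map_smul, smul_eq_mul] at h2
    · rintro ⟨h1, h2⟩ z hz
      obtain ⟨a, ha, c, rfl⟩ := (hΓ z).1 hz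
      show B (a • J.ξ + c • b) μ = 0
      rw [← hB, J.alt, map_add, map_smul, map_smul, smul_eq_mul, h1 a ha, h2, smul_zero, add_zero,
        neg_zero]
  have hbd : ∀ x, x ∈ Pi ⊓ B.orthogonal Γ ⊔ Γ ↔ J.InitialCondition A b x := by
    intro x
    rw [Submodule.mem_sup]
    constructor
    · rintro ⟨μ, ⟨h1, h2⟩, z, hz, rfl⟩
      obtain ⟨a, ha, c, rfl⟩ := (hΓ z).1 hz
      obtain ⟨h3, h4⟩ := (hort μ).1 h2
      exact ⟨μ, a, c, (hPi' μ).1 h1, ha, h3, h4, (add_assoc _ _ _).symm⟩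
    · rintro ⟨μ, a, c, h1, ha, h3, h4, rfl⟩
      exact ⟨μ, ⟨(hPi' μ).2 h1, (hort μ).2 ⟨h3, h4⟩⟩, _, (hΓ _).2 ⟨a, ha, c, rfl⟩,
        (add_assoc _ _ _).symm⟩
  have hjac : ∀ k : ℝ → T, (∀ t ∈ Icc 0 s, ∃ k', HasDerivWithinAt k k' (Icc 0 s) t ∧
      B (η' t) (η t) • k' = B (η' t) (k t) • η' t) ↔ J.IsJacobi k := by
    intro k
    refine forall₂_congr fun t ht => exists_congr fun k' => and_congr_right fun _ => ?_
    rw [l, hB, hB, hη t ht, hη' t ht]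
  have hb' : b = J.η 0 ∨ (b = J.η s ∧ ∀ z ∈ J.spanη, J.pr z = 0 → z = 0) := by
    refine hb.imp (fun hb => ?_) fun hb => ⟨?_, fun z hz hz0 => ?_⟩
    · rw [hη 0 (left_mem_Icc.2 hs), hb]
    · rw [hη s hss, hb.1]
    · rw [spanη, image_congr hη] at hz
      exact (Submodule.mem_bot ℝ).1 (hb.2 ▸ ⟨(hPi' z).2 hz0, hz⟩)
  have main := exists_mem_hessKer_iff (J := J) (A := A) hb'
  simp only [hker, hjac, hbd, hPi']
  refine ⟨fun hcor => main.1 fun μ hμ hμη _ => hcor μ (by rw [← hπ]; exact hμ) fun t ht => ?_,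
    main.2⟩
  rw [← hB, ← hη t ht]
  exact hμη t ht

/-- `JacobiFrame.conjugate_iff` on a finite-dimensional topological vector space `X`; the curve `η`
is the image of a differentiable curve of a normed space. -/
theorem conjugate_iff_of_finiteDimensional {X V E : Type*} [AddCommGroup X] [Module ℝ X]
    [TopologicalSpace X] [IsTopologicalAddGroup X] [ContinuousSMul ℝ X] [T2Space X]
    [FiniteDimensional ℝ X] [NormedAddCommGroup V] [NormedSpace ℝ V] [FiniteDimensional ℝ V]
    [NormedAddCommGroup E] [NormedSpace ℝ E] [CompleteSpace E] {s : ℝ} (hs : 0 < s)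
    {B : LinearMap.BilinForm ℝ X} (hB : B.IsAlt) {π' : X →ₗ[ℝ] E} {Pi Γ : Submodule ℝ X}
    (hPi : ∀ x, x ∈ Pi ↔ π' x = 0) {ξ b : X} {η η' : ℝ → X}
    (P : V →ₗ[ℝ] X) {L L' : ℝ → V} (hLc : Continuous L') (hLd : ∀ t, HasDerivAt L (L' t) t)
    (hη : ∀ t ∈ Icc 0 s, P (L t) = η t) (hη' : ∀ t ∈ Icc 0 s, P (L' t) = η' t)
    (hξη : ∀ t ∈ Icc 0 s, B ξ (η t) = 0) (hl : ∀ t ∈ Icc 0 s, B (η' t) (η t) ≠ 0)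
    (hiso : ∀ μ ν, π' μ = 0 → π' ν = 0 → B μ ν = 0)
    (hrep : ∀ p : E →ₗ[ℝ] ℝ, ∃ ν, π' ν = 0 ∧ ∀ x, B ν x = p (π' x))
    (hindep : ∀ t ∈ Icc 0 s, ∀ a c : ℝ, a • π' ξ + c • π' (η t) = 0 → a = 0 ∧ c = 0)
    (hb : b = η 0 ∨ (b = η s ∧ Pi ⊓ Submodule.span ℝ (insert ξ (η '' Icc 0 s)) = ⊥))
    {A : Submodule ℝ ℝ} (hΓ : ∀ z, z ∈ Γ ↔ ∃ a ∈ A, ∃ c : ℝ, a • ξ + c • b = z)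
    {hess : Control s → ℝ} (hhess : ∀ x, hess x =
      (∫ t in (0 : ℝ)..s, B (η' t) (η t) * x.2.2 t ^ 2) +
      ∫ t in (0 : ℝ)..s, (x.2.1 * B (η s) (η' t) +
        ∫ τ in (0 : ℝ)..t, x.2.2 τ * B (η' τ) (η' t)) * x.2.2 t)
    {K : Set (Control s)} (hK : ∀ x, x ∈ K ↔ (∫ t in (0 : ℝ)..s, x.1 t) • π' ξ + x.2.1 • π' (η s) -
      (∫ t in (0 : ℝ)..s, x.2.2 t • π' (η' t)) = 0 ∧ ∫ t in (0 : ℝ)..s, x.1 t ∈ A) :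
    ((∀ μ, π' μ = 0 → (∀ t ∈ Icc 0 s, B μ (η t) = 0) → μ = 0) →
      (JacobiFrame.trivialKer s ⊂ {x | x ∈ K ∧ ∀ y ∈ K, QuadraticMap.polar hess x y = 0} ↔
        ∃ k : ℝ → X, ((∀ t ∈ Icc 0 s, ∃ k', HasDerivWithinAt k k' (Icc 0 s) t ∧
          B (η' t) (η t) • k' = B (η' t) (k t) • η' t) ∧
          k 0 ∈ Pi ⊓ B.orthogonal Γ ⊔ Γ ∧ k s ∈ Pi) ∧ ∃ t ∈ Icc 0 s, k t ≠ 0)) ∧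
    (JacobiFrame.trivialKer s ⊂ {x | x ∈ K ∧ ∀ y ∈ K, QuadraticMap.polar hess x y = 0} ↔
        ∃ k : ℝ → X, ((∀ t ∈ Icc 0 s, ∃ k', HasDerivWithinAt k k' (Icc 0 s) t ∧
          B (η' t) (η t) • k' = B (η' t) (k t) • η' t) ∧
          k 0 ∈ Pi ⊓ B.orthogonal Γ ⊔ Γ ∧ k s ∈ Pi) ∧ ∃ t ∈ Icc 0 s, k t ≠ k 0) := by
  let _ := normedAddCommGroupOfFiniteDimensional X
  let _ := normedSpaceOfFiniteDimensional X
  let J : JacobiFrame X E s :=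
    { om := B.toContinuousBilinearMap
      pr := LinearMap.toContinuousLinearMap π'
      ξ := ξ
      η := fun t => P (L t)
      η' := fun t => P (L' t)
      pos := hs
      alt := fun x y => (hB.neg_eq y x).symm
      hasDerivAt_η := fun t =>
        (LinearMap.toContinuousLinearMap P).hasFDerivAt.comp_hasDerivAt t (hLd t)
      continuous_η' := (LinearMap.toContinuousLinearMap P).continuous.comp hLc
      om_ξ := fun t ht => (congrArg (B ξ) (hη t ht)).trans (hξη t ht)
      l_ne := fun t ht => by
        show B (P (L' t)) (P (L t)) ≠ 0
        rw [hη t ht, hη' t ht]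
        exact hl t ht
      isotropic := hiso
      exists_rep := hrep
      indep := fun t ht a c hac => by
        have h1 : π' (a • ξ + c • P (L t)) = 0 := hac
        rw [hη t ht, map_add, map_smul, map_smul] at h1
        exact hindep t ht a c h1 }
  exact J.conjugate_iff (fun _ _ => rfl) (fun _ => rfl) hPi rfl hη hη' hb hΓ hhess hK

/-- The annihilator of a subspace of codimension one is a line. -/
theorem exists_smul_eq_of_finrank_quotient {V : Type*} [AddCommGroup V] [Module ℝ V]
    {R : Submodule ℝ V} (hR : Module.finrank ℝ (V ⧸ R) = 1) {p q : V →ₗ[ℝ] ℝ}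
    (hp : ∀ v ∈ R, p v = 0) (hq : ∀ v ∈ R, q v = 0) (hq0 : q ≠ 0) : ∃ c : ℝ, c • q = p := by
  obtain ⟨u, hu⟩ : ∃ u, q u ≠ 0 := by
    by_contra! h
    exact hq0 (LinearMap.ext h)
  have hu' : R.mkQ u ≠ 0 := fun h => hu (hq u ((Submodule.Quotient.mk_eq_zero R).1 h))
  refine ⟨p u / q u, LinearMap.ext fun v => ?_⟩
  obtain ⟨c, hc⟩ := (finrank_eq_one_iff_of_nonzero' _ hu').1 hR (R.mkQ v)
  have h1 : c • u - v ∈ R := by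
    rw [← Submodule.Quotient.mk_eq_zero]
    show R.mkQ (c • u - v) = 0
    rw [map_sub, map_smul, hc, sub_self]
  have h2 := hp _ h1
  have h3 := hq _ h1
  rw [map_sub, map_smul, smul_eq_mul, sub_eq_zero] at h2 h3
  rw [LinearMap.smul_apply, smul_eq_mul, ← h2, ← h3]
  field_simp

/-! ### Conjugate points in terms of the frame, and the degenerate case `s = 0`. -/

section Conjugate

variable {m : ℕ} {M : Type*} [TopologicalSpace M] [ChartedSpace (EuclideanSpace ℝ (Fin m)) M]
  [IsManifold (𝓡 m) ∞ M] [T2Space M] {S : Data m M} {D : Set (ℝ × M)} {s t : ℝ}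

namespace IsRegularCurve

theorem ηDot_eq (h : IsRegularCurve S D) (hs : s ∈ Icc (0 : ℝ) 1) (ht : t ∈ Icc (0 : ℝ) 1) :
    S.ηDot s t = toReduced (symp m) (S.euler s) (liftAt S s (S.gDot s t)) :=
  congrArg (toReduced (symp m) (S.euler s)) (h.hasDerivAt_liftAt_g hs ht).deriv

omit [T2Space M] in
theorem om_toReduced {u v : PhaseMod m} (hu : symp m (S.euler s) u = 0)
    (hv : symp m (S.euler s) v = 0) :
    S.om s (toReduced (symp m) (S.euler s) u) (toReduced (symp m) (S.euler s) v) = symp m u v :=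
  reducedForm_toReduced _ _ _ hu hv

theorem baseProj_ξ₁ (h : IsRegularCurve S D) (hs : s ∈ Icc (0 : ℝ) 1) :
    baseProj S s (S.ξ₁ s) = S.X₁ (S.γ s) :=
  (baseProj_toReduced S s (h.symp_euler_liftAt_X₁ hs)).trans
    (liftAt_fst (differentiableAt_hat_smooth h.smooth₁ _))

theorem baseProj_η (h : IsRegularCurve S D) (hs : s ∈ Icc (0 : ℝ) 1) (ht : t ∈ Icc (0 : ℝ) 1) :
    baseProj S s (S.η s t) = S.g s t (S.γ s) :=
  (baseProj_toReduced S s (h.symp_euler_liftAt_g hs ht)).trans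
    (liftAt_fst (h.differentiableAt_hat_g hs ht))

theorem baseProj_ηDot (h : IsRegularCurve S D) (hs : s ∈ Icc (0 : ℝ) 1)
    (ht : t ∈ Icc (0 : ℝ) 1) : baseProj S s (S.ηDot s t) = S.gDot s t (S.γ s) := by
  rw [h.ηDot_eq hs ht]
  exact (baseProj_toReduced S s (h.symp_euler_liftAt_gDot hs ht)).trans
    (liftAt_fst (h.differentiableAt_hat_gDot hs ht))

theorem om_ηDot_η (h : IsRegularCurve S D) (hs : s ∈ Icc (0 : ℝ) 1) (ht : t ∈ Icc (0 : ℝ) 1) :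
    S.om s (S.ηDot s t) (S.η s t) = S.brk s (S.gDot s t) (S.g s t) := by
  rw [h.ηDot_eq hs ht, brk_eq_symp (h.differentiableAt_hat_gDot hs ht)
    (h.differentiableAt_hat_g hs ht)]
  exact om_toReduced (h.symp_euler_liftAt_gDot hs ht) (h.symp_euler_liftAt_g hs ht)

theorem om_η_ηDot (h : IsRegularCurve S D) (hs : s ∈ Icc (0 : ℝ) 1) (ht : t ∈ Icc (0 : ℝ) 1) :
    S.om s (S.η s s) (S.ηDot s t) = S.brk s S.X₂ (S.gDot s t) := by
  rw [h.ηDot_eq hs ht, brk_eq_symp (IsRegularCurve.differentiableAt_hat_smooth h.smooth₂ _)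
    (h.differentiableAt_hat_gDot hs ht), ← h.liftAt_g_self hs]
  exact om_toReduced (h.symp_euler_liftAt_g hs hs) (h.symp_euler_liftAt_gDot hs ht)

theorem om_ηDot_ηDot (h : IsRegularCurve S D) (hs : s ∈ Icc (0 : ℝ) 1) {τ : ℝ}
    (hτ : τ ∈ Icc (0 : ℝ) 1) (ht : t ∈ Icc (0 : ℝ) 1) :
    S.om s (S.ηDot s τ) (S.ηDot s t) = S.brk s (S.gDot s τ) (S.gDot s t) := by
  rw [h.ηDot_eq hs ht, h.ηDot_eq hs hτ, brk_eq_symp (h.differentiableAt_hat_gDot hs hτ)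
    (h.differentiableAt_hat_gDot hs ht)]
  exact om_toReduced (h.symp_euler_liftAt_gDot hs hτ) (h.symp_euler_liftAt_gDot hs ht)

theorem hess_eq (h : IsRegularCurve S D) (hs : s ∈ Icc (0 : ℝ) 1) (x : Control s) :
    S.hess s x = (∫ t in (0 : ℝ)..s, S.om s (S.ηDot s t) (S.η s t) * x.2.2 t ^ 2) +
      ∫ t in (0 : ℝ)..s, (x.2.1 * S.om s (S.η s s) (S.ηDot s t) +
        ∫ τ in (0 : ℝ)..t, x.2.2 τ * S.om s (S.ηDot s τ) (S.ηDot s t)) * x.2.2 t := by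
  have hsub : ∀ t ∈ Icc (0 : ℝ) s, t ∈ Icc (0 : ℝ) 1 := fun t ht => ⟨ht.1, ht.2.trans hs.2⟩
  unfold Data.hess
  congr 1
  · refine intervalIntegral.integral_congr fun t ht => ?_
    rw [uIcc_of_le hs.1] at ht
    simp only [h.om_ηDot_η hs (hsub t ht)]
  · refine intervalIntegral.integral_congr fun t ht => ?_
    rw [uIcc_of_le hs.1] at ht
    have : ∫ τ in (0 : ℝ)..t, x.2.2 τ * S.brk s (S.gDot s τ) (S.gDot s t) =
        ∫ τ in (0 : ℝ)..t, x.2.2 τ * S.om s (S.ηDot s τ) (S.ηDot s t) := by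
      refine intervalIntegral.integral_congr fun τ hτ => ?_
      rw [uIcc_of_le ht.1] at hτ
      simp only [h.om_ηDot_ηDot hs (hsub τ ⟨hτ.1, hτ.2.trans ht.2⟩) (hsub t ht)]
    simp only [h.om_η_ηDot hs (hsub t ht), this]

theorem dFext_eq (h : IsRegularCurve S D) (hs : s ∈ Icc (0 : ℝ) 1) (x : Control s) :
    (S.dFext s x : Mod m) = (∫ t in (0 : ℝ)..s, x.1 t) • baseProj S s (S.ξ₁ s) +
      x.2.1 • baseProj S s (S.η s s) -
      ∫ t in (0 : ℝ)..s, x.2.2 t • baseProj S s (S.ηDot s t) := by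
  have h1 := h.baseProj_ξ₁ hs
  have h2 : baseProj S s (S.η s s) = S.X₂ (S.γ s) :=
    (h.baseProj_η hs hs).trans (h.eventually_g_self hs).self_of_nhds
  have h3 : ∫ t in (0 : ℝ)..s, x.2.2 t • baseProj S s (S.ηDot s t) =
      tanIntegral (S.γ s) (fun t => x.2.2 t • S.gDot s t (S.γ s)) 0 s := by
    refine intervalIntegral.integral_congr fun t ht => ?_
    rw [uIcc_of_le hs.1] at ht
    exact congrArg (fun u : Mod m => x.2.2 t • u)
      (h.baseProj_ηDot hs ⟨ht.1, ht.2.trans hs.2⟩)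
  rw [h1, h2, h3]
  rfl

/-- A covector which annihilates all `g_t^s` only sees the component of `d₀F` along `X₁`. -/
theorem apply_dF (h : IsRegularCurve S D) (hs : s ∈ Icc (0 : ℝ) 1)
    (p : Mod m →L[ℝ] ℝ) (hp : ∀ t ∈ Icc 0 s, p (S.g s t (S.γ s) : Mod m) = 0)
    (v : Data.L2 s × Data.L2 s) :
    p (S.dF s v : Mod m) = Data.dJ s v * p (S.X₁ (S.γ s) : Mod m) := by
  have hsub : ∀ t ∈ Icc (0 : ℝ) s, t ∈ Icc (0 : ℝ) 1 := fun t ht => ⟨ht.1, ht.2.trans hs.2⟩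
  obtain ⟨L, L', -, hLd, hLe⟩ := exists_global_primitive
    (fun t ht => h.hasDerivAt_liftAt_g hs ht) (h.continuousOn_liftAt_gDot hs)
  have hLc : Continuous fun t => (L t).1 :=
    continuous_fst.comp (continuous_iff_continuousAt.2 fun t => (hLd t).continuousAt)
  have hg : ∀ t ∈ Icc 0 s, (L t).1 = S.g s t (S.γ s) := fun t ht => by
    rw [(hLe t (hsub t ht)).1]
    exact liftAt_fst (h.differentiableAt_hat_g hs (hsub t ht))
  have h1 : ∫ t in (0 : ℝ)..s, v.2 t • (L t).1 =
      tanIntegral (S.γ s) (fun t => v.2 t • S.g s t (S.γ s)) 0 s := by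
    refine intervalIntegral.integral_congr fun t ht => ?_
    rw [uIcc_of_le hs.1] at ht
    exact congrArg (fun u : Mod m => v.2 t • u) (hg t ht)
  have h0 : p (∫ t in (0 : ℝ)..s, v.2 t • (L t).1) = 0 := by
    rw [← p.intervalIntegral_comp_comm (JacobiFrame.intervalIntegrable_smul
      (JacobiFrame.integrableOn_control v.2) hLc (right_mem_Icc.2 hs.1))]
    refine intervalIntegral.integral_zero_ae (Filter.Eventually.of_forall fun t ht => ?_)
    rw [uIoc_of_le hs.1] at ht
    have ht' := Ioc_subset_Icc_self ht
    have h3 : p (L t).1 = 0 := (congrArg p (hg t ht')).trans (hp t ht')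
    rw [map_smul, h3, smul_zero]
  have h2 : p (tanIntegral (S.γ s) (fun t => v.2 t • S.g s t (S.γ s)) 0 s : Mod m) = 0 :=
    (congrArg p h1).symm.trans h0
  have h3 : ∀ u w : Mod m, p (Data.dJ s v • u + w) = Data.dJ s v * p u + p w := fun u w => by
    rw [map_add, map_smul, smul_eq_mul]
  have h4 : p (S.dF s v : Mod m) = Data.dJ s v * p (S.X₁ (S.γ s) : Mod m) +
    p (tanIntegral (S.γ s) (fun t => v.2 t • S.g s t (S.γ s)) 0 s : Mod m) := h3 _ _
  rw [h4, h2, add_zero]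

set_option synthInstance.maxHeartbeats 200000 in
-- The covector `p` of `μ` annihilates every `g_t^s`. Strict singularity adds `X₁`, so `p` and
-- `λ(s)` both annihilate the image of `d₀F`; in corank one they are proportional, and `λ(s)` is
-- divided out in `Σ`.
theorem eq_zero_of_corankOne (h : IsRegularCurve S D)
    (hs : s ∈ Icc (0 : ℝ) 1) (hcor : S.CorankOne s) (hsing : S.StrictlySingular s)
    {μ : S.Sig s} (hμ : baseProj S s μ = 0) (hμη : ∀ t ∈ Icc 0 s, S.om s μ (S.η s t) = 0) :
    μ = 0 := by
  have hsub : ∀ t ∈ Icc (0 : ℝ) s, t ∈ Icc (0 : ℝ) 1 := fun t ht => ⟨ht.1, ht.2.trans hs.2⟩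
  obtain ⟨p, rfl⟩ := exists_vertical_of_mem_Pi S s hμ
  have hp : ∀ t ∈ Icc 0 s, p (S.g s t (S.γ s) : Mod m) = 0 := fun t ht =>
    (congrArg p (h.baseProj_η hs (hsub t ht))).symm.trans
      ((om_vertical S s p _).symm.trans (hμη t ht))
  have hpX : p (S.X₁ (S.γ s) : Mod m) = 0 := by
    -- On the image of the differential `p` equals `⟨p, X₁⟩ dJ`, so `(p, -⟨p, X₁⟩)` is a Lagrange
    -- multiplier of the extended endpoint map.
    refine neg_eq_zero.1 (hsing p (-p (S.X₁ (S.γ s) : Mod m)) fun v => ?_)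
    have h1 := h.apply_dF hs p hp v
    have h2 : p (S.dF s v : Mod m) + -p (S.X₁ (S.γ s) : Mod m) * Data.dJ s v = 0 := by
      rw [h1]
      ring
    exact h2
  have hspan : ∀ q : Mod m →L[ℝ] ℝ, (∀ t ∈ Icc 0 s, q (S.g s t (S.γ s) : Mod m) = 0) →
      q (S.X₁ (S.γ s) : Mod m) = 0 →
      ∀ v ∈ Submodule.span ℝ (range (S.dF s)), (q : Mod m →ₗ[ℝ] ℝ) v = 0 := by
    intro q hq hqX v hv
    have h1 : Submodule.span ℝ (range (S.dF s)) ≤ LinearMap.ker (q : Mod m →ₗ[ℝ] ℝ) := by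
      refine Submodule.span_le.2 ?_
      rintro _ ⟨v, rfl⟩
      exact (h.apply_dF hs q hq v).trans (mul_eq_zero_of_right _ hqX)
    exact h1 hv
  have hcg : ∀ t ∈ Icc 0 s, covec S s (S.g s t (S.γ s) : Mod m) = 0 := fun t ht =>
    (h.covec_pull hs (hsub t ht) S.X₂).trans (h.covec_Δ₂ (hsub t ht)).2.1
  obtain ⟨c, hc⟩ := exists_smul_eq_of_finrank_quotient hcor (hspan p hp hpX)
    (hspan (covec S s) hcg (h.covec_Δ₂ hs).1) (fun h0 => h.covec_ne_zero hs
      (ContinuousLinearMap.coe_injective h0))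
  refine (toReduced_eq_zero _ _ (symp_euler_vertical S s p)).2 ⟨c, Prod.ext (smul_zero c) ?_⟩
  exact ContinuousLinearMap.coe_injective hc

set_option maxHeartbeats 1000000 in
-- The subspace `A` of admissible values of `∫ v` treats both maps at once: `⊤` belongs to `F` and
-- `⊥` to `(F, J)`, and accordingly `ξ₁` is present in or absent from `Γ`.
theorem conjugate_iff_of_pos (h : IsRegularCurve S D) (hs : s ∈ Icc (0 : ℝ) 1) (h0 : 0 < s)
    {b : S.Sig s} (hb : b = S.η s 0 ∨ (b = S.ξ₂ s ∧ S.Pi s ⊓ S.Zspan s = ⊥))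
    {A : Submodule ℝ ℝ} {Γ : Submodule ℝ (S.Sig s)}
    (hΓ : ∀ z, z ∈ Γ ↔ ∃ a ∈ A, ∃ c : ℝ, a • S.ξ₁ s + c • b = z) {K : Set (Control s)}
    (hK : ∀ x, x ∈ K ↔ S.dFext s x = 0 ∧ ∫ t in (0 : ℝ)..s, x.1 t ∈ A) :
    (S.CorankOne s → S.StrictlySingular s → (Data.Z₁ s ⊂ S.hessKer s K ↔
        ∃ k, S.IsJacobiBVP s Γ k ∧ ∃ t ∈ Icc 0 s, k t ≠ 0)) ∧
    (Data.Z₁ s ⊂ S.hessKer s K ↔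
        ∃ k, S.IsJacobiBVP s Γ k ∧ ∃ t ∈ Icc 0 s, k t ≠ k 0) := by
  have hsub : ∀ t ∈ Icc (0 : ℝ) s, t ∈ Icc (0 : ℝ) 1 := fun t ht => ⟨ht.1, ht.2.trans hs.2⟩
  obtain ⟨P, hP⟩ := exists_linear_toReduced (symp m) (S.euler s)
  obtain ⟨L, L', hLc, hLd, hLe⟩ := exists_global_primitive
    (fun t ht => h.hasDerivAt_liftAt_g hs ht) (h.continuousOn_liftAt_gDot hs)
  have hη : ∀ t ∈ Icc (0 : ℝ) s, P (L t) = S.η s t := fun t ht => by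
    rw [(hLe t (hsub t ht)).1, hP _ (h.symp_euler_liftAt_g hs (hsub t ht))]
    rfl
  have hη' : ∀ t ∈ Icc (0 : ℝ) s, P (L' t) = S.ηDot s t := fun t ht => by
    rw [(hLe t (hsub t ht)).2, hP _ (h.symp_euler_liftAt_gDot hs (hsub t ht)),
      h.ηDot_eq hs (hsub t ht)]
  have hξη : ∀ t ∈ Icc (0 : ℝ) s, S.om s (S.ξ₁ s) (S.η s t) = 0 := fun t ht =>
    (om_toReduced (h.symp_euler_liftAt_X₁ hs) (h.symp_euler_liftAt_g hs (hsub t ht))).trans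
      (h.symp_liftAt_X₁_g hs (hsub t ht))
  have hl : ∀ t ∈ Icc (0 : ℝ) s, S.om s (S.ηDot s t) (S.η s t) ≠ 0 := fun t ht => by
    rw [h.ηDot_eq hs (hsub t ht)]
    exact (om_toReduced (h.symp_euler_liftAt_gDot hs (hsub t ht))
      (h.symp_euler_liftAt_g hs (hsub t ht))).trans_ne
      (h.symp_liftAt_gDot_g_ne_zero hs (hsub t ht))
  have hiso : ∀ μ ν, baseProj S s μ = 0 → baseProj S s ν = 0 → S.om s μ ν = 0 := by
    intro μ ν hμ hν
    obtain ⟨p, rfl⟩ := exists_vertical_of_mem_Pi S s hμ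
    exact (om_vertical S s p ν).trans ((congrArg p hν).trans (map_zero p))
  have hrep : ∀ p : Mod m →ₗ[ℝ] ℝ, ∃ ν, baseProj S s ν = 0 ∧
      ∀ x, S.om s ν x = p (baseProj S s x) := fun p =>
    ⟨toReduced (symp m) (S.euler s) (0, LinearMap.toContinuousLinearMap p),
      baseProj_toReduced S s (symp_euler_vertical S s _),
      fun x => om_vertical S s (LinearMap.toContinuousLinearMap p) x⟩
  have hindep : ∀ t ∈ Icc (0 : ℝ) s, ∀ a c : ℝ,
      a • baseProj S s (S.ξ₁ s) + c • baseProj S s (S.η s t) = 0 → a = 0 ∧ c = 0 := by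
    intro t ht a c hac
    rw [h.baseProj_ξ₁ hs, h.baseProj_η hs (hsub t ht)] at hac
    exact h.linearIndependent_g hs (hsub t ht) hac
  have hξ₂ : S.ξ₂ s = S.η s s :=
    congrArg (toReduced (symp m) (S.euler s)) (h.liftAt_g_self hs).symm
  have hb' : b = S.η s 0 ∨ (b = S.η s s ∧
      S.Pi s ⊓ Submodule.span ℝ (insert (S.ξ₁ s) (S.η s '' Icc 0 s)) = ⊥) := by
    rw [← hξ₂]
    exact hb
  have hK' : ∀ x, x ∈ K ↔ (∫ t in (0 : ℝ)..s, x.1 t) • baseProj S s (S.ξ₁ s) +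
      x.2.1 • baseProj S s (S.η s s) -
      (∫ t in (0 : ℝ)..s, x.2.2 t • baseProj S s (S.ηDot s t)) = 0 ∧
      ∫ t in (0 : ℝ)..s, x.1 t ∈ A := fun x => by
    rw [hK, ← h.dFext_eq hs x]
    rfl
  have main := conjugate_iff_of_finiteDimensional h0 (B := S.om s) (reducedForm_isAlt _ _ _)
    (mem_Pi_iff S s) P hLc hLd hη hη' hξη hl hiso hrep hindep hb' hΓ (h.hess_eq hs) hK'
  exact ⟨fun hcor hsing => main.1 fun μ => h.eq_zero_of_corankOne hs hcor hsing, main.2⟩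

/-- The constant curve `γ|_{[0,0]}` does not have corank one. -/
theorem not_corankOne_zero (h : IsRegularCurve S D) : ¬ S.CorankOne 0 := by
  intro hcor
  have hz : ∀ v, (S.dF 0 v : Mod m) = 0 := by
    intro v
    have h1 : ∀ (a : ℝ) (u w : Mod m), a = 0 → w = 0 → a • u + w = 0 := by
      rintro a u w rfl rfl
      rw [zero_smul, add_zero]
    exact h1 _ _ _ intervalIntegral.integral_same intervalIntegral.integral_same
  have hspan : Submodule.span ℝ (range (S.dF 0)) = ⊥ := by
    rw [Submodule.span_eq_bot]
    rintro _ ⟨v, rfl⟩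
    exact hz v
  have h1 : Module.finrank ℝ (Mod m ⧸ (⊥ : Submodule ℝ (Mod m))) = 1 := by
    unfold Data.CorankOne at hcor
    rw [hspan] at hcor
    exact hcor
  rw [(Submodule.quotEquivOfEqBot ⊥ rfl).finrank_eq, finrank_euclideanSpace_fin] at h1
  have h2 : LinearIndependent ℝ ![(S.X₁ (S.γ 0) : Mod m), (S.X₂ (S.γ 0) : Mod m)] :=
    h.rank 0 (by simp)
  have h3 : ∀ u w : Mod m, LinearIndependent ℝ ![u, w] → 2 ≤ m := fun u w huw => by
    have := huw.fintype_card_le_finrank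
    rwa [finrank_euclideanSpace_fin, Fintype.card_fin] at this
  have h4 := h3 _ _ h2
  omega

/-- On a null interval all integrals and all L² functions vanish, so the kernel condition reduces to
`c X₂ = 0` and leaves only trivial controls. -/
theorem not_conjugate_zero (h : IsRegularCurve S D) {K : Set (Control 0)}
    (hK : ∀ x ∈ K, S.dFext 0 x = 0) : ¬ Data.Z₁ 0 ⊂ S.hessKer 0 K := by
  intro hss
  obtain ⟨-, ⟨v, c, w⟩, hx, hxZ⟩ := Set.ssubset_iff_exists.1 hss
  apply hxZ
  have h1 : (S.dFext 0 (v, c, w) : Mod m) = 0 := hK _ hx.1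
  have h2 : c • (S.X₂ (S.γ 0) : Mod m) = 0 := by
    have h3 : ∀ (a c : ℝ) (u x w : Mod m), a = 0 → w = 0 → a • u + c • x - w = 0 → c • x = 0 := by
      rintro a c u x w rfl rfl h
      rwa [zero_smul, zero_add, sub_zero] at h
    exact h3 _ _ _ _ _ intervalIntegral.integral_same intervalIntegral.integral_same h1
  have hX : (S.X₂ (S.γ 0) : Mod m) ≠ 0 := (h.rank 0 (by simp)).ne_zero 1
  refine ⟨(smul_eq_zero.1 h2).resolve_right hX, ?_, intervalIntegral.integral_same⟩
  refine Lp.eq_zero_iff_ae_eq_zero.2 ?_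
  have hμ : volume.restrict (Ioc (0 : ℝ) 0) = 0 := by rw [Ioc_self, Measure.restrict_empty]
  have hae : ∀ (μ : Measure ℝ) (p : ℝ → Prop), μ = 0 → ∀ᵐ t ∂μ, p t := by
    rintro _ p rfl
    simp
  exact hae _ _ hμ

end IsRegularCurve
end Conjugate

end RankTwo

end

/-! ### The main theorem. -/

theorem proposition6p1 (m : ℕ) (M : Type*) [TopologicalSpace M] [T2Space M]
    [ChartedSpace (EuclideanSpace ℝ (Fin m)) M] [IsManifold (𝓡 m) ∞ M]
    -- the frame, the flow of `X₁`, the initial point and the initial covector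
    (S : RankTwo.Data m M) (D : Set (ℝ × M))
    (hX₁ : RankTwo.IsSmoothField S.X₁) (hX₂ : RankTwo.IsSmoothField S.X₂)
    (hflow : RankTwo.IsLocalFlow S.X₁ S.flow D)
    (hx₀ : ∀ t ∈ Icc (0 : ℝ) 1, (t, S.x₀) ∈ D)
    (hD : ∀ t ∈ Icc (0 : ℝ) 1, ∀ τ ∈ Icc (0 : ℝ) 1, (τ - t, S.γ t) ∈ D)
    (hrank : ∀ t ∈ Icc (0 : ℝ) 1, LinearIndependent ℝ ![S.X₁ (S.γ t), S.X₂ (S.γ t)])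
    -- `γ` is a regular singular curve with lift `λ(·)`
    (hlift : S.IsAbnormalLift) (hreg : S.IsRegularLift)
    (s : ℝ) (hs : s ∈ Icc (0 : ℝ) 1)
    -- the vector that enters the condition at `t = 0`
    (b : S.Sig s) (hb : b = S.η s 0 ∨ (b = S.ξ₂ s ∧ S.Pi s ⊓ S.Zspan s = ⊥)) :
    -- conjugate points along a corank-one strictly singular curve, with nonzero solutions
    (S.CorankOne s → S.StrictlySingular s →
      (S.IsConjF s ↔ ∃ k, S.IsJacobiBVP s (Submodule.span ℝ {S.ξ₁ s, b}) k ∧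
        ∃ t ∈ Icc 0 s, k t ≠ 0) ∧
      (S.IsConjFJ s ↔ ∃ k, S.IsJacobiBVP s (Submodule.span ℝ {b}) k ∧
        ∃ t ∈ Icc 0 s, k t ≠ 0)) ∧
    -- without these two assumptions on `γ|_{[0,s]}`, with nonconstant solutions
    ((S.IsConjF s ↔ ∃ k, S.IsJacobiBVP s (Submodule.span ℝ {S.ξ₁ s, b}) k ∧
        ∃ t ∈ Icc 0 s, k t ≠ k 0) ∧
      (S.IsConjFJ s ↔ ∃ k, S.IsJacobiBVP s (Submodule.span ℝ {b}) k ∧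
        ∃ t ∈ Icc 0 s, k t ≠ k 0)) := by
  have h : RankTwo.IsRegularCurve S D := ⟨hX₁, hX₂, hflow, hx₀, hD, hrank, hlift.1, hreg⟩
  rcases hs.1.eq_or_lt with rfl | h0
  -- The frame needs an interval of positive length. At `s = 0` corank one fails because two
  -- independent fields force `m ≥ 2`, and otherwise both sides are false: no function on a single
  -- point is nonconstant.
  · refine ⟨fun hcor => absurd hcor h.not_corankOne_zero, ?_⟩
    have hk : ∀ Γ : Submodule ℝ (S.Sig 0),
        ¬ ∃ k, S.IsJacobiBVP 0 Γ k ∧ ∃ t ∈ Icc (0 : ℝ) 0, k t ≠ k 0 := by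
      rintro Γ ⟨k, -, t, ht, hne⟩
      exact hne (congrArg k (le_antisymm ht.2 ht.1))
    exact ⟨iff_of_false (h.not_conjugate_zero fun x hx => hx) (hk _),
      iff_of_false (h.not_conjugate_zero fun x hx => hx.1) (hk _)⟩
  · have hF := h.conjugate_iff_of_pos hs h0 hb (A := ⊤)
      (Γ := Submodule.span ℝ {S.ξ₁ s, b}) (K := S.kerF s)
      (fun z => by simp [Submodule.mem_span_pair]) (fun x => (and_iff_left trivial).symm)
    have hFJ := h.conjugate_iff_of_pos hs h0 hb (A := ⊥)
      (Γ := Submodule.span ℝ {b}) (K := S.kerFJ s)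
      (fun z => by simp [Submodule.mem_span_singleton]) (fun x => Iff.rfl)
    exact ⟨fun hcor hsing => ⟨hF.1 hcor hsing, hFJ.1 hcor hsing⟩, hF.2, hFJ.2⟩
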